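/- **Setting.** Let $\rho_0\in C^\infty([0,\pi])$ be a positive profile (for instance the equilibrium profile of a sessile drop), and let, in polar coordinates, $\Omega_0=\{0<r<\rho_0(\theta),\ 0<\theta<\pi\}\subset\mathbb R^2$. Let $\varepsilon_-,\varepsilon_+,\alpha$ satisfy $0<\varepsilon_-<\varepsilon_+\le\frac{\varepsilon_-+1}{2}$, $0<\alpha<\varepsilon_-$ and $\alpha<\min\{\frac{1-\varepsilon_+}{2},\frac{\varepsilon_+-\varepsilon_-}{2}\}$, and put $q_+=\frac{2}{2-\varepsilon_+}$. Norms of $u,p$ are over $\Omega_0$, norms of $\xi$ over $(0,\pi)$; norms of fractional order are Sobolev–Slobodeckij norms. Consider on $(0,T)$ a quadruple $(u,p,\xi,\mathfrak n)$ with $u(t):\overline{\Omega_0}\to\mathbb R^2$ continuous, $p(t):\Omega_0\to\mathbb R$, $\xi(t)\in C^1([0,\pi])$ and $\mathfrak n:(0,T)\to\mathbb R$ differentiable. Here $u$ is twice differentiable in time with respect to the $H^1(\Omega_0)$ norm, $\xi$ is twice differentiable in time with respect to the $H^1(0,\pi)$ norm, and $p$ is differentiable in time with respect to the $L^2(\Omega_0)$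 norm. Write $\rho=\rho_0+\xi$ for the free surface in polar coordinates centred at the pole $(\mathfrak n(t),0)$, $\hat e_r=(\cos\theta,\sin\theta)$, $\hat e_\phi=(-\sin\theta,\cos\theta)$ and $\mathcal N=-\rho'\hat e_\phi+\rho\,\hat e_r$. Assume for all $t\in(0,T)$: * (kinematic condition in the moving frame) $\partial_t\xi=\frac1\rho\big(u-(\mathfrak n'(t),0)\big)\cdot\mathcal N$ for a.e. $\theta\in(0,\pi)$, where $u$ is evaluated at the point of $\partial\Omega_0$ with polar coordinates $(\rho_0(\theta),\theta)$; * (choice of the pole) $c=0$ is a local minimizer of $c\mapsto\int_0^\pi(\rho_{0,c}(\theta)-\rho(t,\theta))^2\,d\theta$, where $\rho_{0,c}$ is the polar profile (about the pole) of the curve $r=\rho_0(\theta)$ translated horizontally by $c$. (Sufficiently regular solutions of the contact line Navier–Stokes system written in moving polar coordinates are of this kind.) Define $$\begin{aligned}\mathcal E_-={}&\|u\|_{W^{2,q_+}}^2+\|\partial_tu\|_{H^{1+\varepsilon_- /2}}^2+\|\partial_t^2u\|_{L^2}^2+\|p\|_{W^{1,q_+}}^2+\|\partial_tp\|_{L^2}^2+\sum_{k=0}^2\big(\|\partial_t^ku\|_{L^2}^2+\|\partial_t^k\xi\|_{H^1}^2\big)\\&+\|\xi\|_{W^{3-1/q_+,q_+}}^2+\|\partial_t\xi\|_{H^{3/2+(\varepsilon_--\alpha)/2}}^2+\|\partial_t^2\xi\|_{H^1}^2,\end{aligned}$$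 and $\mathcal E=\mathcal E_-+|\mathfrak n'|^2+|\mathfrak n''|^2$. **Theorem.** There are constants $\delta>0$ and $C\ge 0$, depending only on $\rho_0,\varepsilon_-,\varepsilon_+,\alpha$, such that for every $T$ and every quadruple as above with $\mathcal E(t)\le\delta$ for all $t\in(0,T)$, the function $\mathfrak n$ is three times differentiable on $(0,T)$ and, for all $t\in(0,T)$, $$|\mathfrak n'(t)|\le C\|u(t)\|_{H^1},\qquad |\mathfrak n''(t)|\le C\big(\|\partial_tu(t)\|_{H^1}+\mathcal E_-(t)\big),\qquad |\mathfrak n'''(t)|\le C\big(\|\partial_t^2u(t)\|_{H^1}+\mathcal E_-(t)\big).$$ (In the definition of $\mathcal E$, as long as it is not known that $\mathfrak n''(t)$ exists, the term $|\mathfrak n''(t)|^2$ is read as $0$.) -/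

import Mathlib

open Set Filter Topology MeasureTheory
open scoped ENNReal NNReal ContDiff

namespace Drop

/-! ### Sobolev and Sobolev-Slobodeckij norms on an open set -/

section Sobolev

/-- `G` is the weak (distributional) gradient of `f` on the open set `Ω`. -/
def HasWeakGradient {E F : Type} [NormedAddCommGroup E] [NormedSpace ℝ E] [MeasureSpace E]
    [NormedAddCommGroup F] [NormedSpace ℝ F]
    (Ω : Set E) (f : E → F) (G : E → E →L[ℝ] F) : Prop :=
  LocallyIntegrableOn f Ω ∧ LocallyIntegrableOn G Ω ∧
    ∀ φ : E → ℝ, ContDiff ℝ ∞ φ → HasCompactSupport φ → tsupport φ ⊆ Ω →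
      ∀ v : E, ∫ x in Ω, (fderiv ℝ φ x v) • f x = - ∫ x in Ω, φ x • G x v

/-- The Gagliardo seminorm
`(∫_Ω ∫_Ω ‖f x - f y‖ ^ p / ‖x - y‖ ^ (d + s p) dx dy) ^ (1 / p)`, `d` the dimension of `E`,
for `0 < s < 1` and `1 ≤ p < ∞`. -/
noncomputable def gagliardo {E F : Type} [NormedAddCommGroup E] [NormedSpace ℝ E] [MeasureSpace E]
    [NormedAddCommGroup F] (Ω : Set E) (s p : ℝ) (f : E → F) : ℝ≥0∞ :=
  (∫⁻ x in Ω, ∫⁻ y in Ω,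
    ‖f x - f y‖ₑ ^ p / ‖x - y‖ₑ ^ ((Module.finrank ℝ E : ℝ) + s * p)) ^ (1 / p)

open scoped Classical in
/-- The norm of `W^{m+s,p}(Ω)`, `m` a natural number and `0 ≤ s < 1`: the sum of the `L^p` norms
of the weak derivatives up to order `m` and, if `s > 0`, of the Gagliardo seminorm of the
derivative of order `m`. The value is `∞` if `f` is not in the space. (Weak gradients are unique
almost everywhere, so the infimum only serves to pick the weak gradient if there is one.) -/
noncomputable def sobolevAux {E : Type} [NormedAddCommGroup E] [NormedSpace ℝ E] [MeasureSpace E]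
    (Ω : Set E) (s p : ℝ) :
    ℕ → ∀ {F : Type} [NormedAddCommGroup F] [NormedSpace ℝ F], (E → F) → ℝ≥0∞
  | 0, _, _, _, f =>
      ⨅ _ : AEStronglyMeasurable f (volume.restrict Ω),
        (eLpNorm f (ENNReal.ofReal p) (volume.restrict Ω) +
          if s = 0 then 0 else gagliardo Ω s p f)
  | m + 1, _, _, _, f =>
      eLpNorm f (ENNReal.ofReal p) (volume.restrict Ω) +
        ⨅ (G : E → E →L[ℝ] _) (_ : HasWeakGradient Ω f G), sobolevAux Ω s p m G

/-- The norm of `W^{r,p}(Ω)` for a real order `r ≥ 0` and `1 ≤ p < ∞`. -/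
noncomputable def sobolevNorm {E F : Type} [NormedAddCommGroup E] [NormedSpace ℝ E]
    [MeasureSpace E] [NormedAddCommGroup F] [NormedSpace ℝ F]
    (Ω : Set E) (r p : ℝ) (f : E → F) : ℝ≥0∞ :=
  sobolevAux Ω (Int.fract r) p ⌊r⌋₊ f

/-- `w'` is the derivative at time `t` of the curve of functions `w` with respect to the
norm `N`. -/
def HasTimeDeriv {E F : Type} [AddCommGroup F] [Module ℝ F]
    (N : (E → F) → ℝ≥0∞) (w : ℝ → E → F) (w' : E → F) (t : ℝ) : Prop :=
  Tendsto (fun h : ℝ => N (h⁻¹ • (w (t + h) - w t) - w')) (𝓝[≠] 0) (𝓝 0)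

end Sobolev

/-! ### Geometry -/

/-- The Euclidean plane. -/
abbrev Plane : Type := EuclideanSpace ℝ (Fin 2)

/-- The radial unit vector. -/
noncomputable def eR (θ : ℝ) : Plane := !₂[Real.cos θ, Real.sin θ]

/-- The angular unit vector. -/
noncomputable def ePhi (θ : ℝ) : Plane := !₂[-Real.sin θ, Real.cos θ]

/-- The drop `{0 < r < ρ(θ), 0 < θ < π}` with profile `ρ` in polar coordinates. -/
def domain (ρ : ℝ → ℝ) : Set Plane :=
  {x | ∃ θ ∈ Ioo 0 Real.pi, ∃ r : ℝ, 0 < r ∧ r < ρ θ ∧ x = r • eR θ}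

/-- The outer normal `-ρ' e_φ + ρ e_r` (not normalized) to the curve `r = ρ(θ)`. -/
noncomputable def normal (ρ : ℝ → ℝ) (θ : ℝ) : Plane :=
  (-deriv ρ θ) • ePhi θ + ρ θ • eR θ

/-- The profile, in polar coordinates around the origin, of the curve `r = ρ₀(φ)`, `0 ≤ φ ≤ π`,
translated horizontally by `c`: the radius `r > 0` at which the ray of angle `θ` meets the
translated curve. (For `c` near `0` there is exactly one such radius.) -/
noncomputable def shiftedProfile (ρ₀ : ℝ → ℝ) (c θ : ℝ) : ℝ :=
  sSup {r : ℝ | 0 < r ∧ ∃ φ ∈ Icc 0 Real.pi, r • eR θ = ρ₀ φ • eR φ + !₂[c, 0]}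

/-! ### Motions of a drop in moving polar coordinates -/

/-- Velocity `u`, pressure perturbation `p` (on the reference drop), perturbation `ξ` of the
profile, their time derivatives, and the abscissa `n` of the pole; the first argument is time. -/
structure Motion where
  u : ℝ → Plane → Plane
  ut : ℝ → Plane → Plane
  utt : ℝ → Plane → Plane
  p : ℝ → Plane → ℝ
  pt : ℝ → Plane → ℝ
  ξ : ℝ → ℝ → ℝ
  ξt : ℝ → ℝ → ℝ
  ξtt : ℝ → ℝ → ℝ
  n : ℝ → ℝ

/-- The free surface `ρ = ρ₀ + ξ` in polar coordinates centred at the moving pole `(n(t), 0)`. -/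
def Motion.ρ (M : Motion) (ρ₀ : ℝ → ℝ) (t θ : ℝ) : ℝ := ρ₀ θ + M.ξ t θ

/-- `q = 2 / (2 - ε)`. -/
noncomputable def qExp (ε : ℝ) : ℝ := 2 / (2 - ε)

/-- The energy without the contributions of the pole. -/
noncomputable def energyMinus (ρ₀ : ℝ → ℝ) (εm εp α : ℝ) (M : Motion) (t : ℝ) : ℝ≥0∞ :=
  (sobolevNorm (domain ρ₀) 2 (qExp εp) (M.u t)) ^ 2
  + (sobolevNorm (domain ρ₀) (1 + εm / 2) 2 (M.ut t)) ^ 2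
  + (sobolevNorm (domain ρ₀) 0 2 (M.utt t)) ^ 2
  + (sobolevNorm (domain ρ₀) 1 (qExp εp) (M.p t)) ^ 2
  + (sobolevNorm (domain ρ₀) 0 2 (M.pt t)) ^ 2
  + ((sobolevNorm (domain ρ₀) 0 2 (M.u t)) ^ 2
    + (sobolevNorm (domain ρ₀) 0 2 (M.ut t)) ^ 2
    + (sobolevNorm (domain ρ₀) 0 2 (M.utt t)) ^ 2
    + (sobolevNorm (Ioo 0 Real.pi) 1 2 (M.ξ t)) ^ 2
    + (sobolevNorm (Ioo 0 Real.pi) 1 2 (M.ξt t)) ^ 2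
    + (sobolevNorm (Ioo 0 Real.pi) 1 2 (M.ξtt t)) ^ 2)
  + (sobolevNorm (Ioo 0 Real.pi) (3 - 1 / qExp εp) (qExp εp) (M.ξ t)) ^ 2
  + (sobolevNorm (Ioo 0 Real.pi) (3 / 2 + (εm - α) / 2) 2 (M.ξt t)) ^ 2
  + (sobolevNorm (Ioo 0 Real.pi) 1 2 (M.ξtt t)) ^ 2

/-- The full energy. -/
noncomputable def energy (ρ₀ : ℝ → ℝ) (εm εp α : ℝ) (M : Motion) (t : ℝ) : ℝ≥0∞ :=
  energyMinus ρ₀ εm εp α M t + ‖deriv M.n t‖ₑ ^ 2 + ‖iteratedDeriv 2 M.n t‖ₑ ^ 2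

/-- `M` is a motion of the drop on the time interval `(0, T)`, in polar coordinates centred at the
moving pole, around the reference profile `ρ₀`. -/
structure IsMovingDrop (ρ₀ : ℝ → ℝ) (T : ℝ) (M : Motion) : Prop where
  /-- `u(t)` is the representative that is continuous up to the boundary. -/
  cont_u : ∀ t ∈ Ioo 0 T, ContinuousOn (M.u t) (closure (domain ρ₀))
  /-- `ξ(t)` is the representative that is continuously differentiable up to the boundary. -/
  cont_ξ : ∀ t ∈ Ioo 0 T, ContDiffOn ℝ 1 (M.ξ t) (Icc 0 Real.pi)
  /-- `ut`, `utt` are the first and second time derivatives of `u` in `H¹`. -/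
  deriv_u : ∀ t ∈ Ioo 0 T, HasTimeDeriv (sobolevNorm (domain ρ₀) 1 2) M.u (M.ut t) t
  deriv_ut : ∀ t ∈ Ioo 0 T, HasTimeDeriv (sobolevNorm (domain ρ₀) 1 2) M.ut (M.utt t) t
  /-- `pt` is the time derivative of `p` in `L²`. -/
  deriv_p : ∀ t ∈ Ioo 0 T, HasTimeDeriv (sobolevNorm (domain ρ₀) 0 2) M.p (M.pt t) t
  /-- `ξt`, `ξtt` are the first and second time derivatives of `ξ` in `H¹(0, π)`. -/
  deriv_ξ : ∀ t ∈ Ioo 0 T, HasTimeDeriv (sobolevNorm (Ioo 0 Real.pi) 1 2) M.ξ (M.ξt t) t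
  deriv_ξt : ∀ t ∈ Ioo 0 T, HasTimeDeriv (sobolevNorm (Ioo 0 Real.pi) 1 2) M.ξt (M.ξtt t) t
  /-- The pole has a velocity. -/
  diff_n : ∀ t ∈ Ioo 0 T, DifferentiableAt ℝ M.n t
  /-- The kinematic boundary condition `∂ₜρ = ρ⁻¹ (u - (n', 0)) · 𝒩` in the moving frame. -/
  kinematic : ∀ t ∈ Ioo 0 T, ∀ᵐ θ ∂(volume.restrict (Ioo 0 Real.pi)),
    M.ξt t θ = (M.ρ ρ₀ t θ)⁻¹ *
      inner ℝ (M.u t (ρ₀ θ • eR θ) - !₂[deriv M.n t, 0]) (normal (M.ρ ρ₀ t) θ)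
  /-- The position of the pole: among the horizontal translates of the reference profile, the one
  centred at the pole (`c = 0`) is closest in `L²(0, π)` to the free surface. -/
  pole : ∀ t ∈ Ioo 0 T,
    IsLocalMin (fun c : ℝ => ∫ θ in (0 : ℝ)..Real.pi,
      (shiftedProfile ρ₀ c θ - M.ρ ρ₀ t θ) ^ 2) 0

end Drop

/-! Write g for `shiftDeriv ρ₀`, the derivative at c = 0 of the translated profile. Minimality at c
= 0 gives the Euler equation ∫ ξ g = 0 at every time (`integral_mul_shiftDeriv_eq_zero`), and
differentiating it in time gives ∫ ∂ₜξ g = 0. Inserting the kinematic condition yields one scalar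
equation, linear in n': with W = g 𝒩 / ρ = g (e_r - (ρ'/ρ) e_φ) and e₁ = (1, 0), it reads ⟨W, u⟩ =
n' ⟨W, e₁⟩ in L²(0, π), u being taken on the boundary curve (`inner_weight_trace`). For ξ = 0 the
factor ⟨W, e₁⟩ equals ∫ g², which is positive because ρ₀ g is the derivative of ρ₀ sin θ
(`inner_weight_horizontal_ne_zero`).

Hence n' = Λ(q) U. Here U is the trace of u, q consists of ρ as an element of C([0, π]) and of the
L² field ρ' g e_φ, and Λ is `poleFunctional`. The only nonlinear operations in Λ are reciprocals in
the Banach algebra C([0, π]) and of a nonzero scalar, so Λ is C² near the reference profile, with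
bounds there (`exists_poleFunctional_bounds`). Smallness of the energy keeps q in that
neighbourhood. The chain and product rules then give n'' and n'''; every term other than Λ(q) ∂ₜᵏU
contains at least two factors controlled by the square root of the energy, so it is bounded by a
multiple of the energy (`deriv_bounds_of_eq_apply`).

The time derivatives of u and ξ are limits in H¹ only and need not have pointwise traces or
classical derivatives. Traces and profiles are therefore treated as linear relations with bounds
(`traceRel`, `profileRel`). Such a relation can be replaced by its closure with the same bound, and
a curve related to an N-differentiable curve is then differentiable (`exists_hasDerivAt_of_rel`,
`exists_two_derivs`). The bounds needed are the trace inequality in H¹, the sup bound on the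
boundary for W^{2,q}, which is part of the energy, and the embedding of H¹(0, π) in C([0, π]). The
two trace estimates are proved by mollification and one-dimensional estimates along rays and along
curves parallel to the boundary. -/

namespace Drop

set_option maxSynthPendingDepth 3
set_option linter.unusedSectionVars false

/-! ### Weak gradients and the Sobolev norms of order one and two. -/

section SobolevBasics

variable {E F : Type} [NormedAddCommGroup E] [NormedSpace ℝ E] [MeasureSpace E] [BorelSpace E]
  [NormedAddCommGroup F] [NormedSpace ℝ F] {Ω : Set E}

theorem integrable_smul_of_tsupport_subset {φ : E → ℝ} {f : E → F} (hφ : Continuous φ)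
    (hc : HasCompactSupport φ) (hs : tsupport φ ⊆ Ω) (hf : LocallyIntegrableOn f Ω) :
    Integrable (fun x => φ x • f x) := by
  have h1 : IntegrableOn f (tsupport φ) := hf.integrableOn_compact_subset hs hc
  have h2 : IntegrableOn (fun x => φ x • f x) (tsupport φ) :=
    h1.continuousOn_smul hφ.continuousOn hc
  refine (integrableOn_iff_integrable_of_support_subset ?_).1 h2
  intro x hx
  refine subset_tsupport _ ?_
  intro h
  exact hx (by simp [h])

theorem integrable_fderiv_smul_of_tsupport_subset {φ : E → ℝ} {f : E → F}
    (hφ : ContDiff ℝ ∞ φ) (hc : HasCompactSupport φ) (hs : tsupport φ ⊆ Ω)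
    (hf : LocallyIntegrableOn f Ω) (v : E) :
    Integrable (fun x => (fderiv ℝ φ x v) • f x) :=
  integrable_smul_of_tsupport_subset
    ((hφ.continuous_fderiv (by simp)).clm_apply continuous_const)
    (hc.fderiv_apply ℝ v) ((tsupport_fderiv_apply_subset ℝ v).trans hs) hf

theorem _root_.MeasureTheory.LocallyIntegrableOn.add_of_normed {f g : E → F}
    (hf : LocallyIntegrableOn f Ω) (hg : LocallyIntegrableOn g Ω) :
    LocallyIntegrableOn (f + g) Ω := hf.add hg

theorem locallyIntegrableOn_zero_of_normed : LocallyIntegrableOn (0 : E → F) Ω :=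
  fun _ _ => ⟨univ, univ_mem, integrableOn_zero⟩

theorem _root_.MeasureTheory.eLpNorm_add_le_of_normed {f g : E → F} {μ : Measure E} {p : ℝ≥0∞}
    (hf : AEStronglyMeasurable f μ) (hg : AEStronglyMeasurable g μ) (hp : 1 ≤ p) :
    eLpNorm (f + g) p μ ≤ eLpNorm f p μ + eLpNorm g p μ := eLpNorm_add_le hf hg hp

theorem eLpNorm_zero_of_normed {μ : Measure E} {p : ℝ≥0∞} : eLpNorm (0 : E → F) p μ = 0 :=
  eLpNorm_zero

theorem HasWeakGradient.add {f g : E → F} {G H : E → E →L[ℝ] F} (hf : HasWeakGradient Ω f G)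
    (hg : HasWeakGradient Ω g H) : HasWeakGradient Ω (f + g) (G + H) := by
  refine ⟨hf.1.add_of_normed hg.1, hf.2.1.add_of_normed hg.2.1, fun φ hφ hc hs v => ?_⟩
  have hG : ∀ {G : E → E →L[ℝ] F}, LocallyIntegrableOn G Ω →
      Integrable (fun x => φ x • G x v) := fun {G} h =>
    (integrable_smul_of_tsupport_subset hφ.continuous hc hs h).apply_continuousLinearMap v
  simp only [Pi.add_apply, smul_add, add_apply]
  rw [integral_add (integrable_fderiv_smul_of_tsupport_subset hφ hc hs hf.1 v).integrableOn
      (integrable_fderiv_smul_of_tsupport_subset hφ hc hs hg.1 v).integrableOn,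
    integral_add (hG hf.2.1).integrableOn (hG hg.2.1).integrableOn,
    hf.2.2 φ hφ hc hs v, hg.2.2 φ hφ hc hs v, neg_add]

theorem HasWeakGradient.const_smul {f : E → F} {G : E → E →L[ℝ] F} (hf : HasWeakGradient Ω f G)
    (c : ℝ) : HasWeakGradient Ω (c • f) (c • G) := by
  refine ⟨hf.1.smul c, hf.2.1.smul c, fun φ hφ hc hs v => ?_⟩
  simp only [Pi.smul_apply, smul_apply, smul_comm _ c]
  rw [integral_smul, integral_smul, hf.2.2 φ hφ hc hs v, smul_neg]

theorem sobolevNorm_one (p : ℝ) (f : E → F) :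
    sobolevNorm Ω 1 p f = eLpNorm f (ENNReal.ofReal p) (volume.restrict Ω) +
      ⨅ (G : E → E →L[ℝ] F) (_ : HasWeakGradient Ω f G),
        ⨅ _ : AEStronglyMeasurable G (volume.restrict Ω),
          eLpNorm G (ENNReal.ofReal p) (volume.restrict Ω) := by
  simp [sobolevNorm, sobolevAux]

/-- An infimum over an empty family is ∞, so a finite bound produces an actual measurable weak
gradient. The estimates by Sobolev norms below pass through such a near-optimal gradient. -/
theorem exists_of_sobolevNorm_one_lt {p : ℝ} {f : E → F} {b : ℝ≥0∞} (h : sobolevNorm Ω 1 p f < b) :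
    ∃ G, HasWeakGradient Ω f G ∧ AEStronglyMeasurable G (volume.restrict Ω) ∧
      eLpNorm f (ENNReal.ofReal p) (volume.restrict Ω) +
        eLpNorm G (ENNReal.ofReal p) (volume.restrict Ω) < b := by
  rw [sobolevNorm_one, ENNReal.add_iInf] at h
  obtain ⟨G, hG⟩ := iInf_lt_iff.1 h
  by_cases hw : HasWeakGradient Ω f G
  · by_cases hm : AEStronglyMeasurable G (volume.restrict Ω)
    · exact ⟨G, hw, hm, by simpa [hw, hm] using hG⟩
    · simp [hm] at hG
  · simp [hw] at hG

theorem sobolevNorm_one_le {p : ℝ} {f : E → F} {G : E → E →L[ℝ] F} (h : HasWeakGradient Ω f G)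
    (hm : AEStronglyMeasurable G (volume.restrict Ω)) :
    sobolevNorm Ω 1 p f ≤ eLpNorm f (ENNReal.ofReal p) (volume.restrict Ω) +
        eLpNorm G (ENNReal.ofReal p) (volume.restrict Ω) := by
  rw [sobolevNorm_one]
  gcongr
  exact iInf_le_of_le G (iInf_le_of_le h (iInf_le_of_le hm le_rfl))

theorem sobolevNorm_one_add_le [FiniteDimensional ℝ E] {p : ℝ} (hp : 1 ≤ p) (f g : E → F) :
    sobolevNorm Ω 1 p (f + g) ≤ sobolevNorm Ω 1 p f + sobolevNorm Ω 1 p g := by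
  refine ENNReal.le_of_forall_pos_le_add fun ε hε hlt => ?_
  have hf : sobolevNorm Ω 1 p f < ⊤ := (le_self_add).trans_lt hlt
  have hg : sobolevNorm Ω 1 p g < ⊤ := (le_add_self).trans_lt hlt
  have hε2 : ((ε / 2 : ℝ≥0) : ℝ≥0∞) ≠ 0 := by simpa using hε.ne'
  obtain ⟨G, hG, hGm, hGb⟩ := exists_of_sobolevNorm_one_lt (ENNReal.lt_add_right hf.ne hε2)
  obtain ⟨H, hH, hHm, hHb⟩ := exists_of_sobolevNorm_one_lt (ENNReal.lt_add_right hg.ne hε2)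
  have hp' : 1 ≤ ENNReal.ofReal p := by simpa using hp
  refine (sobolevNorm_one_le (hG.add hH) (hGm.add hHm)).trans ?_
  calc _ ≤ (eLpNorm f (ENNReal.ofReal p) (volume.restrict Ω)
          + eLpNorm g (ENNReal.ofReal p) (volume.restrict Ω))
        + (eLpNorm G (ENNReal.ofReal p) (volume.restrict Ω)
          + eLpNorm H (ENNReal.ofReal p) (volume.restrict Ω)) := by
        gcongr
        · exact eLpNorm_add_le_of_normed hG.1.aestronglyMeasurable hH.1.aestronglyMeasurable hp'
        · exact eLpNorm_add_le_of_normed hGm hHm hp'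
    _ = _ := add_add_add_comm _ _ _ _
    _ ≤ _ := add_le_add hGb.le hHb.le
    _ = sobolevNorm Ω 1 p f + sobolevNorm Ω 1 p g + ((ε / 2 : ℝ≥0) + (ε / 2 : ℝ≥0) : ℝ≥0∞) :=
        add_add_add_comm _ _ _ _
    _ = _ := by rw [← ENNReal.coe_add, add_halves]

theorem sobolevNorm_one_smul_le {p : ℝ} (c : ℝ) (hc : c ≠ 0) (f : E → F) :
    sobolevNorm Ω 1 p (c • f) ≤ ‖c‖ₑ * sobolevNorm Ω 1 p f := by
  rcases eq_or_ne (sobolevNorm Ω 1 p f) ⊤ with h | h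
  · rw [h, ENNReal.mul_top (by simpa using hc)]; exact le_top
  refine ENNReal.le_of_forall_pos_le_add fun ε hε _ => ?_
  have hc0 : ‖c‖ₑ ≠ 0 := by simpa using hc
  have hε2 : (ε : ℝ≥0∞) / ‖c‖ₑ ≠ 0 := by
    simp [ENNReal.div_eq_zero_iff, hε.ne']
  obtain ⟨G, hG, hGm, hGb⟩ := exists_of_sobolevNorm_one_lt (ENNReal.lt_add_right h hε2)
  refine (sobolevNorm_one_le (hG.const_smul c) (hGm.const_smul c)).trans ?_
  rw [eLpNorm_const_smul c f, eLpNorm_const_smul c G, ← mul_add]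
  refine (mul_le_mul_right hGb.le _).trans ?_
  rw [mul_add, ENNReal.mul_div_cancel hc0 (by simp)]

theorem eLpNorm_le_sobolevNorm_one (p : ℝ) (f : E → F) :
    eLpNorm f (ENNReal.ofReal p) (volume.restrict Ω) ≤ sobolevNorm Ω 1 p f := by
  rw [sobolevNorm_one]; exact le_self_add

/-- The integer part of r is 1, so the two norms differ only by the Gagliardo term. This puts the H¹
norm of ∂ₜu under the energy. -/
theorem sobolevNorm_one_le_sobolevNorm {r p : ℝ} (hr : 1 ≤ r) (hr2 : r < 2) (f : E → F) :
    sobolevNorm Ω 1 p f ≤ sobolevNorm Ω r p f := by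
  have hfl : ⌊r⌋₊ = 1 := by
    rw [Nat.floor_eq_iff (by linarith)]; norm_num; exact ⟨hr, hr2⟩
  rw [sobolevNorm_one, sobolevNorm, hfl]
  simp only [sobolevAux]
  gcongr
  exact le_self_add

theorem exists_of_sobolevNorm_two_lt {p : ℝ} {f : E → F} {b : ℝ≥0∞} (h : sobolevNorm Ω 2 p f < b) :
    ∃ G H, HasWeakGradient Ω f G ∧ HasWeakGradient Ω G H ∧
      AEStronglyMeasurable H (volume.restrict Ω) ∧
      eLpNorm f (ENNReal.ofReal p) (volume.restrict Ω) +
        (eLpNorm G (ENNReal.ofReal p) (volume.restrict Ω) +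
        eLpNorm H (ENNReal.ofReal p) (volume.restrict Ω)) < b := by
  have h2 : sobolevNorm Ω 2 p f = eLpNorm f (ENNReal.ofReal p) (volume.restrict Ω) +
      ⨅ (G : E → E →L[ℝ] F) (_ : HasWeakGradient Ω f G), sobolevNorm Ω 1 p G := by
    have : ⌊(2 : ℝ)⌋₊ = 1 + 1 := by norm_num
    have h3 : Int.fract (2 : ℝ) = 0 := by
      exact Int.fract_natCast (R := ℝ) 2
    simp only [sobolevNorm, this, h3]
    simp [sobolevAux]
  rw [h2, ENNReal.add_iInf] at h
  obtain ⟨G, hG⟩ := iInf_lt_iff.1 h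
  by_cases hw : HasWeakGradient Ω f G
  · simp only [hw, iInf_pos] at hG
    have hfin : eLpNorm f (ENNReal.ofReal p) (volume.restrict Ω) ≠ ⊤ :=
      (le_self_add.trans_lt hG).ne_top
    have h4 : sobolevNorm Ω 1 p G < b - eLpNorm f (ENNReal.ofReal p) (volume.restrict Ω) :=
      lt_tsub_iff_left.2 hG
    obtain ⟨H, hH, hm, hb⟩ := exists_of_sobolevNorm_one_lt h4
    exact ⟨G, H, hw, hH, hm, lt_tsub_iff_left.1 hb⟩
  · simp [hw] at hG

end SobolevBasics

/-! ### Bounded linear relations, their closures, and differentiation in time. -/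

section ClosedRelations

variable {V W : Type} [AddCommGroup V] [Module ℝ V] [NormedAddCommGroup W] [NormedSpace ℝ W]

/-- A relation between vectors measured by `N` and a normed space contains its limits. -/
def IsClosedRel (N : V → ℝ≥0∞) (S : Submodule ℝ (V × W)) : Prop :=
  ∀ v w, (∀ ε : ℝ≥0∞, 0 < ε → ∃ v' w', (v', w') ∈ S ∧ N (v - v') < ε ∧ ‖w - w'‖ₑ < ε) → (v, w) ∈ S

/-- The properties of a norm used here. -/
structure IsPrenorm (N : V → ℝ≥0∞) : Prop where
  add_le : ∀ v w, N (v + w) ≤ N v + N w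
  smul_le : ∀ (c : ℝ), c ≠ 0 → ∀ v, N (c • v) ≤ ‖c‖ₑ * N v
  zero : N 0 = 0

theorem IsPrenorm.neg_le {N : V → ℝ≥0∞} (hN : IsPrenorm N) (v : V) : N (-v) ≤ N v := by
  simpa using hN.smul_le (-1) (by norm_num) v

/-- The closure of a relation. -/
def closureRel {N : V → ℝ≥0∞} (hN : IsPrenorm N) (S : Submodule ℝ (V × W)) :
    Submodule ℝ (V × W) where
  carrier := {x | ∀ ε : ℝ≥0∞, 0 < ε → ∃ v' w', (v', w') ∈ S ∧ N (x.1 - v') < ε ∧ ‖x.2 - w'‖ₑ < ε}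
  zero_mem' := fun ε hε => ⟨0, 0, S.zero_mem, by simpa [hN.zero] using hε, by simpa using hε⟩
  add_mem' := by
    intro a b ha hb ε hε
    obtain ⟨v, w, hS, h1, h2⟩ := ha (ε / 2) (ENNReal.half_pos hε.ne')
    obtain ⟨v', w', hS', h1', h2'⟩ := hb (ε / 2) (ENNReal.half_pos hε.ne')
    refine ⟨v + v', w + w', S.add_mem hS hS', ?_, ?_⟩
    · rw [Prod.fst_add, add_sub_add_comm, ← ENNReal.add_halves ε]
      exact (hN.add_le _ _).trans_lt (ENNReal.add_lt_add h1 h1')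
    · rw [Prod.snd_add, add_sub_add_comm, ← ENNReal.add_halves ε]
      exact (enorm_add_le _ _).trans_lt (ENNReal.add_lt_add h2 h2')
  smul_mem' := by
    intro c a ha ε hε
    rcases eq_or_ne c 0 with rfl | hc
    · exact ⟨0, 0, S.zero_mem, by simpa [hN.zero] using hε, by simpa using hε⟩
    have hc0 : ‖c‖ₑ ≠ 0 := by simpa using hc
    obtain ⟨v, w, hS, h1, h2⟩ := ha (ε / ‖c‖ₑ) (ENNReal.div_pos hε.ne' (by simp))
    refine ⟨c • v, c • w, S.smul_mem c hS, ?_, ?_⟩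
    · rw [Prod.smul_fst, ← smul_sub]
      refine (hN.smul_le c hc _).trans_lt ?_
      rw [mul_comm]
      exact (ENNReal.lt_div_iff_mul_lt (Or.inl hc0) (Or.inl (by simp))).1 h1
    · rw [Prod.smul_snd, ← smul_sub, enorm_smul, mul_comm]
      exact (ENNReal.lt_div_iff_mul_lt (Or.inl hc0) (Or.inl (by simp))).1 h2

theorem le_closureRel {N : V → ℝ≥0∞} (hN : IsPrenorm N) (S : Submodule ℝ (V × W)) :
    S ≤ closureRel hN S := fun x hx ε hε =>
  ⟨x.1, x.2, hx, by simpa [hN.zero] using hε, by simpa using hε⟩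

theorem isClosedRel_closureRel {N : V → ℝ≥0∞} (hN : IsPrenorm N) (S : Submodule ℝ (V × W)) :
    IsClosedRel N (closureRel hN S) := by
  intro v w h ε hε
  obtain ⟨v1, w1, hS, h1, h2⟩ := h (ε / 2) (ENNReal.half_pos hε.ne')
  obtain ⟨v2, w2, hS', h1', h2'⟩ := hS (ε / 2) (ENNReal.half_pos hε.ne')
  refine ⟨v2, w2, hS', ?_, ?_⟩
  · rw [← sub_add_sub_cancel _ v1, ← ENNReal.add_halves ε]
    exact (hN.add_le _ _).trans_lt (ENNReal.add_lt_add h1 h1')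
  · change ‖w - w2‖ₑ < ε
    rw [← sub_add_sub_cancel _ w1, ← ENNReal.add_halves ε]
    exact (enorm_add_le _ _).trans_lt (ENNReal.add_lt_add h2 h2')

/-- The bound passes to limits with the same constant, by the triangle inequality on both sides.
Thus a trace bound proved for continuous fields also holds for their H¹ limits. -/
theorem closureRel_bound {N : V → ℝ≥0∞} (hN : IsPrenorm N) {S : Submodule ℝ (V × W)} {C : ℝ≥0}
    (hS : ∀ v w, (v, w) ∈ S → ‖w‖ₑ ≤ C * N v) (v : V) (w : W) (h : (v, w) ∈ closureRel hN S) :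
    ‖w‖ₑ ≤ C * N v := by
  refine ENNReal.le_of_forall_pos_le_add fun ε hε _ => ?_
  have hC : ((C + 1 : ℝ≥0) : ℝ≥0∞) ≠ 0 := by simp
  obtain ⟨v', w', hm, h1, h2⟩ := h ((ε : ℝ≥0∞) / (C + 1 : ℝ≥0))
    (ENNReal.div_pos (by simp [hε.ne']) (by simp))
  change N (v - v') < _ at h1
  change ‖w - w'‖ₑ < _ at h2
  have h3 : N v' ≤ N v + N (v - v') := by
    calc N v' = N (v + -(v - v')) := by congr 1; abel
      _ ≤ _ := (hN.add_le _ _).trans (by gcongr; exact hN.neg_le _)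
  calc ‖w‖ₑ = ‖w' + (w - w')‖ₑ := by congr 1; abel
    _ ≤ ‖w'‖ₑ + ‖w - w'‖ₑ := enorm_add_le _ _
    _ ≤ C * (N v + (ε : ℝ≥0∞) / (C + 1 : ℝ≥0)) + (ε : ℝ≥0∞) / (C + 1 : ℝ≥0) := by
        gcongr
        exact (hS _ _ hm).trans (by gcongr; exact h3.trans (by gcongr))
    _ = C * N v + (C + 1 : ℝ≥0) * ((ε : ℝ≥0∞) / (C + 1 : ℝ≥0)) := by
        push_cast; ring
    _ = C * N v + ε := by rw [ENNReal.mul_div_cancel hC (by simp)]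

/-- If `w` depends on `v` through a closed bounded relation, a curve `v` that is differentiable with
respect to `N` gives a differentiable curve `w`. -/
theorem exists_hasDerivAt_of_rel [CompleteSpace W] {N : V → ℝ≥0∞} (hN : IsPrenorm N)
    {S : Submodule ℝ (V × W)} (hcl : IsClosedRel N S) {C : ℝ≥0}
    (hb : ∀ v w, (v, w) ∈ S → ‖w‖ₑ ≤ C * N v) {v : ℝ → V} {v' : V} {w : ℝ → W} {t : ℝ}
    (hvw : ∀ᶠ s in 𝓝 t, (v s, w s) ∈ S)
    (hv : Tendsto (fun h : ℝ => N (h⁻¹ • (v (t + h) - v t) - v')) (𝓝[≠] 0) (𝓝 0)) :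
    ∃ w', HasDerivAt w w' t ∧ (v', w') ∈ S := by
  set Q : ℝ → W := fun h => h⁻¹ • (w (t + h) - w t) with hQ
  set P : ℝ → V := fun h => h⁻¹ • (v (t + h) - v t) with hP
  have hmem : ∀ᶠ h in 𝓝[≠] (0 : ℝ), (P h, Q h) ∈ S := by
    have h0 : (v t, w t) ∈ S := hvw.self_of_nhds
    have : Tendsto (fun h : ℝ => t + h) (𝓝[≠] 0) (𝓝 t) := by
      have : Tendsto (fun h : ℝ => t + h) (𝓝 0) (𝓝 (t + 0)) := tendsto_const_nhds.add tendsto_id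
      rw [add_zero] at this
      exact this.mono_left nhdsWithin_le_nhds
    filter_upwards [this.eventually hvw] with h hh
    exact S.smul_mem _ (S.sub_mem hh h0)
  -- Linearity puts differences of difference quotients in S, so the bound turns N-convergence of P
  -- into the Cauchy property of Q.
  have hest : ∀ h k, (P h, Q h) ∈ S → (P k, Q k) ∈ S →
      edist (Q h) (Q k) ≤ C * (N (P h - v') + N (P k - v')) := by
    intro h k hh hk
    rw [edist_eq_enorm_sub]
    refine (hb _ _ (S.sub_mem hh hk)).trans ?_
    gcongr
    calc N (P h - P k) = N ((P h - v') + -(P k - v')) := by congr 1; abel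
      _ ≤ _ := (hN.add_le _ _).trans (by gcongr; exact hN.neg_le _)
  have hsmall : ∀ ε : ℝ≥0∞, 0 < ε → ∀ᶠ h in 𝓝[≠] (0 : ℝ), N (P h - v') < ε :=
    fun ε hε => hv.eventually (gt_mem_nhds hε)
  have hcau : Cauchy (map Q (𝓝[≠] 0)) := by
    rw [EMetric.cauchy_iff]
    refine ⟨map_neBot.ne, fun ε hε => ?_⟩
    -- The factor C + 1 instead of C covers C = 0; the 2 accounts for the two errors in `hest`.
    have hδ : 0 < ε / (2 * (C + 1 : ℝ≥0)) :=
      ENNReal.div_pos hε.ne' (by simp [ENNReal.mul_eq_top])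
    refine ⟨Q '' {h | (P h, Q h) ∈ S ∧ N (P h - v') < ε / (2 * (C + 1 : ℝ≥0))},
      image_mem_map (hmem.and (hsmall _ hδ)), ?_⟩
    rintro _ ⟨h, ⟨h1, h2⟩, rfl⟩ _ ⟨k, ⟨k1, k2⟩, rfl⟩
    refine (hest h k h1 k1).trans_lt ?_
    have h3 : N (P h - v') + N (P k - v') < ε / (C + 1 : ℝ≥0) := by
      refine (ENNReal.add_lt_add h2 k2).trans_le ?_
      rw [← two_mul, ENNReal.div_eq_inv_mul, ENNReal.mul_inv (by simp) (by simp), ← mul_assoc,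
        ← mul_assoc, ENNReal.mul_inv_cancel (by simp) (by simp), one_mul, ENNReal.div_eq_inv_mul]
    calc (C : ℝ≥0∞) * (N (P h - v') + N (P k - v'))
        ≤ (C + 1 : ℝ≥0) * (N (P h - v') + N (P k - v')) := by
          gcongr; simp
      _ < (C + 1 : ℝ≥0) * (ε / (C + 1 : ℝ≥0)) := by
          rw [ENNReal.mul_lt_mul_iff_right (by simp) (by simp)]
          exact h3
      _ ≤ ε := ENNReal.mul_div_le
  obtain ⟨w', hw'⟩ := CompleteSpace.complete hcau
  have hlim : Tendsto Q (𝓝[≠] 0) (𝓝 w') := hw'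
  refine ⟨w', ?_, ?_⟩
  · rw [hasDerivAt_iff_tendsto_slope_zero]; exact hlim
  · refine hcl _ _ fun ε hε => ?_
    have h1 : ∀ᶠ h in 𝓝[≠] (0 : ℝ), edist (Q h) w' < ε :=
      hlim.eventually (Metric.eball_mem_nhds w' hε)
    obtain ⟨h, ⟨h2, h3⟩, h4⟩ := ((hmem.and (hsmall ε hε)).and h1).exists
    refine ⟨P h, Q h, h2, ?_, ?_⟩
    · rw [← neg_sub]; exact (hN.neg_le _).trans_lt h3
    · rwa [← edist_eq_enorm_sub, edist_comm]

end ClosedRelations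

theorem isPrenorm_sobolevNorm_one {E F : Type} [NormedAddCommGroup E] [NormedSpace ℝ E]
    [FiniteDimensional ℝ E] [MeasureSpace E] [BorelSpace E] [NormedAddCommGroup F] [NormedSpace ℝ F]
    (Ω : Set E) {p : ℝ} (hp : 1 ≤ p) :
    IsPrenorm (sobolevNorm Ω 1 p : (E → F) → ℝ≥0∞) where
  add_le := sobolevNorm_one_add_le hp
  smul_le := sobolevNorm_one_smul_le
  zero := by
    have h : HasWeakGradient Ω (0 : E → F) 0 := by
      exact ⟨locallyIntegrableOn_zero_of_normed, locallyIntegrableOn_zero_of_normed,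
        fun φ _ _ _ v => by simp⟩
    refine le_antisymm ((sobolevNorm_one_le h aestronglyMeasurable_zero).trans ?_) zero_le
    exact (add_eq_zero.2 ⟨eLpNorm_zero_of_normed, eLpNorm_zero_of_normed⟩).le

/-! ### Mollification of functions on a plane open set. -/

section Mollification

open scoped Convolution

variable {F : Type} [NormedAddCommGroup F] [NormedSpace ℝ F]

/-- The mollification of `f`, extended by zero outside `Ω`. -/
noncomputable def mollify (φ : ContDiffBump (0 : Plane)) (Ω : Set Plane) (f : Plane → F) :
    Plane → F :=
  (φ.normed volume) ⋆[ContinuousLinearMap.lsmul ℝ ℝ, volume] (Ω.indicator f)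

/-- The mollification of a nonnegative function. -/
noncomputable def lmollify (φ : ContDiffBump (0 : Plane)) (p : Plane → ℝ≥0∞) (x : Plane) : ℝ≥0∞ :=
  ∫⁻ y, ENNReal.ofReal (φ.normed volume (x - y)) * p y

variable {φ : ContDiffBump (0 : Plane)} {Ω : Set Plane}

theorem mollify_apply (hΩ : MeasurableSet Ω) (f : Plane → F) (x : Plane) :
    mollify φ Ω f x = ∫ y in Ω, φ.normed volume (x - y) • f y := by
  rw [mollify, convolution_eq_swap, ← integral_indicator hΩ]
  congr 1; ext y
  by_cases hy : y ∈ Ω <;> simp [hy]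

theorem continuous_mollify (hΩ : MeasurableSet Ω) {f : Plane → F} (hf : IntegrableOn f Ω) :
    Continuous (mollify φ Ω f) :=
  φ.hasCompactSupport_normed.continuous_convolution_left _ φ.continuous_normed
    ((integrable_indicator_iff hΩ).2 hf).locallyIntegrable

/-- At points whose kernel ball stays inside Ω the jump of the zero extension is not seen, so
mollification commutes with the weak gradient. -/
theorem hasFDerivAt_mollify (hΩ : MeasurableSet Ω) {f : Plane → F} {G : Plane → Plane →L[ℝ] F}
    [CompleteSpace F]
    (h : HasWeakGradient Ω f G) (hf : IntegrableOn f Ω) (hG : IntegrableOn G Ω) {x : Plane}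
    (hx : Metric.closedBall x φ.rOut ⊆ Ω) :
    HasFDerivAt (mollify φ Ω f) (mollify φ Ω G x) x := by
  have h1 := (φ.hasCompactSupport_normed (μ := volume)).hasFDerivAt_convolution_left (μ := volume)
    (ContinuousLinearMap.lsmul ℝ ℝ) (φ.contDiff_normed (n := 1))
    ((integrable_indicator_iff hΩ).2 hf).locallyIntegrable x
  refine h1.congr_fderiv ?_
  ext w
  have hsm : ContDiff ℝ ∞ (φ.normed (volume : Measure Plane)) := φ.contDiff_normed
  have hcs : HasCompactSupport (φ.normed (volume : Measure Plane)) := φ.hasCompactSupport_normed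
  set k := φ.normed (volume : Measure Plane) with hk
  have hGi : Integrable (fun t => k (x - t) • Ω.indicator G t) :=
    (hcs.convolutionExists_left (ContinuousLinearMap.lsmul ℝ ℝ) φ.continuous_normed
      ((integrable_indicator_iff hΩ).2 hG).locallyIntegrable x).integrable_swap
  have hfi := ((hcs.fderiv (𝕜 := ℝ)).convolutionExists_left
      ((ContinuousLinearMap.lsmul ℝ ℝ : ℝ →L[ℝ] F →L[ℝ] F).precompL Plane)
      (hsm.continuous_fderiv (by simp))
      ((integrable_indicator_iff hΩ).2 hf).locallyIntegrable x).integrable_swap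
  rw [convolution_eq_swap, ContinuousLinearMap.integral_apply hfi]
  have h2 : (mollify φ Ω G x) w = ∫ t in Ω, k (x - t) • G t w := by
    have h3 : mollify φ Ω G x = ∫ t, k (x - t) • Ω.indicator G t := by
      rw [mollify, convolution_eq_swap]; rfl
    rw [h3, ContinuousLinearMap.integral_apply hGi, ← integral_indicator hΩ]
    congr 1; ext y
    by_cases hy : y ∈ Ω <;> simp [hy]
  -- This is the test function for the weak gradient. Its support lies in the closed ball about x,
  -- and the sign from the reflection t ↦ x - t cancels that of the integration by parts.
  have hψ : ContDiff ℝ ∞ (fun t => k (x - t)) := hsm.comp (contDiff_const.sub contDiff_id)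
  have hψd : ∀ t, fderiv ℝ (fun t => k (x - t)) t w = -fderiv ℝ k (x - t) w := by
    intro t
    have h3 : HasFDerivAt (fun t => k (x - t)) ((fderiv ℝ k (x - t)).comp
        (-ContinuousLinearMap.id ℝ Plane)) t :=
      ((hsm.differentiable (by simp)) (x - t)).hasFDerivAt.comp t
        ((hasFDerivAt_id t).const_sub x)
    rw [h3.fderiv]; simp
  have hsub : tsupport (fun t => k (x - t)) ⊆ Metric.closedBall x φ.rOut := by
    refine closure_minimal ?_ Metric.isClosed_closedBall
    intro t ht
    have : x - t ∈ Function.support k := ht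
    rw [hk, φ.support_normed_eq, Metric.mem_ball, dist_zero_right] at this
    rw [Metric.mem_closedBall, dist_comm, dist_eq_norm]
    exact this.le
  have h4 := h.2.2 (fun t => k (x - t)) hψ
    (HasCompactSupport.of_support_subset_isCompact (isCompact_closedBall x φ.rOut)
      (subset_closure.trans hsub)) (hsub.trans hx) w
  rw [h2, ← neg_eq_iff_eq_neg.2 h4, ← integral_indicator hΩ, ← integral_neg]
  congr 1; ext y
  by_cases hy : y ∈ Ω <;> simp [hy, hψd, ContinuousLinearMap.precompL]

theorem enorm_mollify_le (hΩ : MeasurableSet Ω) (f : Plane → F) (x : Plane) :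
    ‖mollify φ Ω f x‖ₑ ≤ lmollify φ (Ω.indicator fun y => ‖f y‖ₑ) x := by
  rw [mollify_apply hΩ, lmollify]
  refine (enorm_integral_le_lintegral_enorm _).trans (le_of_eq ?_)
  rw [← lintegral_indicator hΩ]
  congr 1; ext y
  by_cases hy : y ∈ Ω
  · simp [hy, enorm_smul, Real.enorm_of_nonneg (φ.nonneg_normed _)]
  · simp [hy]

/-- For fixed x the kernel is a probability density in y, so the monotonicity of L^q means gives the
pointwise inequality; Tonelli and the unit mass of the kernel in x then give the integrated one. -/
theorem lintegral_lmollify_rpow_le {p : Plane → ℝ≥0∞} (hp : AEMeasurable p) {q : ℝ} (hq : 1 ≤ q) :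
    ∫⁻ x, (lmollify φ p x) ^ q ≤ ∫⁻ x, p x ^ q := by
  set k : Plane → ℝ≥0∞ := fun z => ENNReal.ofReal (φ.normed volume z) with hk
  have hkm : Measurable k := (φ.continuous_normed.measurable).ennreal_ofReal
  have hk1 : ∫⁻ z, k z = 1 := by
    rw [← ofReal_integral_eq_lintegral_ofReal φ.integrable_normed
      (Eventually.of_forall fun z => φ.nonneg_normed z), φ.integral_normed, ENNReal.ofReal_one]
  have hkx : ∀ x, ∫⁻ y, k (x - y) = 1 := fun x => by rw [lintegral_sub_left_eq_self k x, hk1]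
  have hky : ∀ y, ∫⁻ x, k (x - y) = 1 := fun y => by rw [lintegral_sub_right_eq_self k y, hk1]
  have hq0 : 0 < q := by linarith
  have hJ : ∀ x, (lmollify φ p x) ^ q ≤ ∫⁻ y, k (x - y) * p y ^ q := by
    intro x
    have hkxm : Measurable fun y => k (x - y) := hkm.comp (measurable_const.sub measurable_id)
    set m : Measure Plane := volume.withDensity fun y => k (x - y) with hm
    have hpm : AEMeasurable p m := hp.mono_ac (withDensity_absolutelyContinuous _ _)
    have : IsProbabilityMeasure m := ⟨by rw [hm, withDensity_apply _ MeasurableSet.univ,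
      Measure.restrict_univ, hkx]⟩
    have h1 : lmollify φ p x = ∫⁻ y, p y ∂m := by
      rw [hm, lintegral_withDensity_eq_lintegral_mul₀ hkxm.aemeasurable hp]; rfl
    have h2 : ∫⁻ y, k (x - y) * p y ^ q = ∫⁻ y, p y ^ q ∂m := by
      rw [hm, lintegral_withDensity_eq_lintegral_mul₀ hkxm.aemeasurable (hp.pow_const q)]; rfl
    have h3 := eLpNorm'_le_eLpNorm'_of_exponent_le (μ := m) one_pos hq (f := p)
      hpm.aestronglyMeasurable
    simp only [eLpNorm', enorm_eq_self, ENNReal.rpow_one, div_one] at h3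
    rw [h1, h2]
    calc _ ≤ ((∫⁻ y, p y ^ q ∂m) ^ (1 / q)) ^ q := ENNReal.rpow_le_rpow h3 hq0.le
      _ = _ := by rw [← ENNReal.rpow_mul, one_div, inv_mul_cancel₀ hq0.ne', ENNReal.rpow_one]
  calc _ ≤ ∫⁻ x, ∫⁻ y, k (x - y) * p y ^ q := lintegral_mono hJ
    _ = ∫⁻ y, ∫⁻ x, k (x - y) * p y ^ q := by
        refine lintegral_lintegral_swap ?_
        refine AEMeasurable.mul ?_ ?_
        · exact (hkm.comp (measurable_fst.sub measurable_snd)).aemeasurable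
        · exact (hp.pow_const q).comp_snd
    _ = ∫⁻ y, p y ^ q := by
        congr 1; ext y
        have h5 : Measurable fun x => k (x - y) := hkm.comp (measurable_id.sub_const y)
        rw [lintegral_mul_const _ h5, hky, one_mul]

theorem tendsto_mollify {ι : Type} {l : Filter ι} {ψ : ι → ContDiffBump (0 : Plane)}
    [CompleteSpace F]
    (hψ : Tendsto (fun i => (ψ i).rOut) l (𝓝 0)) (hΩ : IsOpen Ω) {f : Plane → F}
    (hf : ContinuousOn f Ω) {x : Plane} (hx : x ∈ Ω) :
    Tendsto (fun i => mollify (ψ i) Ω f x) l (𝓝 (f x)) := by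
  refine ContDiffBump.convolution_tendsto_right hψ (Eventually.of_forall fun _ => ?_) ?_
    tendsto_const_nhds
  · exact (aestronglyMeasurable_indicator_iff hΩ.measurableSet).2
      (hf.aestronglyMeasurable hΩ.measurableSet)
  · have h1 : Tendsto (Ω.indicator f) (𝓝 x) (𝓝 (f x)) := by
      refine ((hf x hx).continuousAt (hΩ.mem_nhds hx)).tendsto.congr' ?_
      filter_upwards [hΩ.mem_nhds hx] with y hy
      simp [hy]
    exact h1.comp tendsto_snd

end Mollification

/-! ### Polar coordinates and the reference drop. -/

section Geometry

theorem norm_eR (θ : ℝ) : ‖eR θ‖ = 1 := by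
  rw [EuclideanSpace.norm_eq]; simp [eR, Fin.sum_univ_two]

theorem norm_ePhi (θ : ℝ) : ‖ePhi θ‖ = 1 := by
  rw [EuclideanSpace.norm_eq]; simp [ePhi, Fin.sum_univ_two]

theorem hasDerivAt_eR (θ : ℝ) : HasDerivAt eR (ePhi θ) θ := by
  rw [hasDerivAt_iff_hasFDerivAt, ← hasFDerivWithinAt_univ, hasFDerivWithinAt_euclidean]
  intro i
  rw [hasFDerivWithinAt_univ]
  fin_cases i
  · refine (Real.hasDerivAt_cos θ).hasFDerivAt.congr_fderiv ?_
    ext; simp [ePhi]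
  · refine (Real.hasDerivAt_sin θ).hasFDerivAt.congr_fderiv ?_
    ext; simp [ePhi]

theorem continuous_eR : Continuous eR :=
  continuous_iff_continuousAt.2 fun θ => (hasDerivAt_eR θ).continuousAt

theorem continuous_ePhi : Continuous ePhi := by
  unfold ePhi
  fun_prop

variable {ρ₀ : ℝ → ℝ}

/-- In the upper half plane the polar angle is arccos(x₀/‖x‖), which is continuous there; this form
shows that the drop is open. -/
theorem mem_domain_iff {x : Plane} :
    x ∈ domain ρ₀ ↔ 0 < x 1 ∧ ‖x‖ < ρ₀ (Real.arccos (x 0 / ‖x‖)) := by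
  constructor
  · rintro ⟨θ, hθ, r, hr, hrρ, rfl⟩
    have hn : ‖r • eR θ‖ = r := by rw [norm_smul, norm_eR, mul_one, Real.norm_of_nonneg hr.le]
    have h0 : (r • eR θ) 0 = r * Real.cos θ := by simp [eR]
    have h1 : (r • eR θ) 1 = r * Real.sin θ := by simp [eR]
    rw [hn, h0, h1, mul_div_cancel_left₀ _ hr.ne', Real.arccos_cos hθ.1.le hθ.2.le]
    exact ⟨mul_pos hr (Real.sin_pos_of_mem_Ioo hθ), hrρ⟩
  · rintro ⟨h1, h2⟩
    have hn2 : ‖x‖ ^ 2 = x 0 ^ 2 + x 1 ^ 2 := by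
      rw [EuclideanSpace.norm_sq_eq]; simp [Fin.sum_univ_two]
    have hn : 0 < ‖x‖ := by
      rw [norm_pos_iff]; rintro rfl; simp at h1
    have hlt : |x 0| < ‖x‖ := by
      rw [← abs_of_pos hn, ← sq_lt_sq]; nlinarith
    have hc : |x 0 / ‖x‖| < 1 := by
      rw [abs_div, abs_of_pos hn, div_lt_one hn]; exact hlt
    rw [abs_lt] at hc
    refine ⟨Real.arccos (x 0 / ‖x‖), ⟨?_, ?_⟩, ‖x‖, hn, h2, ?_⟩
    · exact Real.arccos_pos.2 hc.2
    · refine lt_of_le_of_ne (Real.arccos_le_pi _) fun h => ?_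
      have := Real.arccos_eq_pi.1 h
      linarith
    · have hs : Real.sin (Real.arccos (x 0 / ‖x‖)) = x 1 / ‖x‖ := by
        rw [Real.sin_arccos, show 1 - (x 0 / ‖x‖) ^ 2 = (x 1 / ‖x‖) ^ 2 by
          field_simp; linarith, Real.sqrt_sq (by positivity)]
      have hcs := Real.cos_arccos hc.1.le hc.2.le
      ext i
      fin_cases i
      · simp [eR, hcs]; field_simp
      · simp [eR, hs]; field_simp

theorem isOpen_domain (hρ : ContinuousOn ρ₀ (Icc 0 Real.pi)) : IsOpen (domain ρ₀) := by
  have h : domain ρ₀ = {x : Plane | 0 < x 1} ∩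
      {x : Plane | 0 < x 1 ∧ ‖x‖ < ρ₀ (Real.arccos (x 0 / ‖x‖))} := by
    ext x; simp only [mem_inter_iff, mem_ofPred_eq, mem_domain_iff]; tauto
  have hU : IsOpen {x : Plane | 0 < x 1} := isOpen_lt continuous_const (by fun_prop)
  have hc : ContinuousOn (fun x : Plane => ρ₀ (Real.arccos (x 0 / ‖x‖)) - ‖x‖)
      {x : Plane | 0 < x 1} := by
    refine ContinuousOn.sub (hρ.comp ?_ fun x _ => ⟨Real.arccos_nonneg _, Real.arccos_le_pi _⟩)
      continuous_norm.continuousOn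
    refine Real.continuous_arccos.comp_continuousOn (ContinuousOn.div (by fun_prop) (by fun_prop) ?_)
    intro x hx h
    rw [norm_eq_zero] at h
    simp [h] at hx
  have := hc.isOpen_inter_preimage hU (isOpen_Ioi (a := (0 : ℝ)))
  convert this using 1
  ext x
  simp [mem_domain_iff]

theorem domain_subset_closedBall {R : ℝ} (hR : ∀ θ ∈ Icc 0 Real.pi, ρ₀ θ ≤ R) :
    domain ρ₀ ⊆ Metric.closedBall 0 R := by
  rintro x ⟨θ, hθ, r, hr, hrρ, rfl⟩
  rw [mem_closedBall_zero_iff, norm_smul, norm_eR, mul_one, Real.norm_of_nonneg hr.le]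
  exact hrρ.le.trans (hR θ (Ioo_subset_Icc_self hθ))

theorem boundary_mem_closure (hpos : ∀ θ ∈ Icc 0 Real.pi, 0 < ρ₀ θ) {θ : ℝ}
    (hθ : θ ∈ Ioo 0 Real.pi) : ρ₀ θ • eR θ ∈ closure (domain ρ₀) := by
  have hp := hpos θ (Ioo_subset_Icc_self hθ)
  have h : ρ₀ θ ∈ closure (Ioo 0 (ρ₀ θ)) := by
    rw [closure_Ioo hp.ne]; exact ⟨hp.le, le_rfl⟩
  have hc : ContinuousOn (fun r : ℝ => r • eR θ) (closure (Ioo 0 (ρ₀ θ))) := by fun_prop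
  exact closure_mono (by rintro _ ⟨r, hr, rfl⟩; exact ⟨θ, hθ, r, hr.1, hr.2, rfl⟩)
    (hc.image_closure ⟨_, h, rfl⟩)

theorem measurePreserving_plane :
    MeasurePreserving (fun p : ℝ × ℝ => (!₂[p.1, p.2] : Plane)) := by
  have h1 := (EuclideanSpace.volume_preserving_symm_measurableEquiv_toLp (Fin 2)).symm
  have h2 := (volume_preserving_finTwoArrow ℝ).symm
  have h3 : (fun p : ℝ × ℝ => (!₂[p.1, p.2] : Plane)) =
      (MeasurableEquiv.toLp 2 (Fin 2 → ℝ)).symm.symm ∘ (MeasurableEquiv.finTwoArrow (α := ℝ)).symm := by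
    ext p i
    fin_cases i <;> simp
  rw [h3]
  exact h1.comp h2

/-- The points at radial depth σ < a below the boundary have radius at least a, since ρ₀ ≥ 2a. The
polar Jacobian is therefore at least a on this layer. -/
theorem lintegral_polar_le (hρ : ContinuousOn ρ₀ (Icc 0 Real.pi)) {a : ℝ} (ha : 0 < a)
    (hρa : ∀ θ ∈ Icc 0 Real.pi, 2 * a ≤ ρ₀ θ) {f : Plane → ℝ≥0∞} (hf : Measurable f) :
    ∫⁻ θ in Ioo 0 Real.pi, ∫⁻ σ in Ioo 0 a, f ((ρ₀ θ - σ) • eR θ) ≤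
      (ENNReal.ofReal a)⁻¹ * ∫⁻ x in domain ρ₀, f x := by
  have hΩ := (isOpen_domain hρ).measurableSet
  have ha0 : ENNReal.ofReal a ≠ 0 := by simpa using ha
  set h : Plane → ℝ≥0∞ := (domain ρ₀).indicator f with hh
  have hhm : Measurable h := hf.indicator hΩ
  have hem : MeasurableEmbedding (fun p : ℝ × ℝ => (!₂[p.1, p.2] : Plane)) := by
    have h3 : (fun p : ℝ × ℝ => (!₂[p.1, p.2] : Plane)) =
        (MeasurableEquiv.finTwoArrow (α := ℝ)).symm.trans (MeasurableEquiv.toLp 2 (Fin 2 → ℝ)) := by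
      ext p i
      fin_cases i <;> simp
    rw [h3]
    exact MeasurableEquiv.measurableEmbedding _
  have h1 : ∫⁻ x in domain ρ₀, f x =
      ∫⁻ p in polarCoord.target, ENNReal.ofReal p.1 * h (p.1 • eR p.2) := by
    rw [← lintegral_indicator hΩ, ← measurePreserving_plane.lintegral_comp_emb hem,
      ← lintegral_comp_polarCoord_symm]
    refine lintegral_congr fun p => ?_
    rw [smul_eq_mul]
    congr 2
    ext i
    fin_cases i <;> simp [eR, polarCoord]
  have hsub : Ioi (0 : ℝ) ×ˢ Ioo 0 Real.pi ⊆ polarCoord.target := by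
    rw [polarCoord_target]
    exact prod_mono le_rfl (Ioo_subset_Ioo (by linarith [Real.pi_pos]) le_rfl)
  have hme : Measurable fun p : ℝ × ℝ => ENNReal.ofReal p.1 * h (p.1 • eR p.2) := by
    refine measurable_fst.ennreal_ofReal.mul (hhm.comp ?_)
    exact (Continuous.smul continuous_fst (continuous_eR.comp continuous_snd)).measurable
  have h2 : ∫⁻ θ in Ioo 0 Real.pi, ∫⁻ r in Ioi (0 : ℝ), ENNReal.ofReal r * h (r • eR θ) ≤
      ∫⁻ x in domain ρ₀, f x := by
    rw [h1]
    refine le_trans (le_of_eq ?_) (lintegral_mono_set hsub)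
    rw [Measure.volume_eq_prod, ← Measure.prod_restrict, lintegral_prod_symm _ hme.aemeasurable]
  have h3 : ∀ θ ∈ Ioo 0 Real.pi, ENNReal.ofReal a * ∫⁻ σ in Ioo 0 a, f ((ρ₀ θ - σ) • eR θ) ≤
      ∫⁻ r in Ioi (0 : ℝ), ENNReal.ofReal r * h (r • eR θ) := by
    intro θ hθ
    have hp := hρa θ (Ioo_subset_Icc_self hθ)
    rw [← lintegral_const_mul' _ _ ENNReal.ofReal_ne_top, ← lintegral_indicator measurableSet_Ioo,
      ← lintegral_indicator measurableSet_Ioi, ← lintegral_sub_left_eq_self ((Ioi (0 : ℝ)).indicator _) (ρ₀ θ)]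
    refine lintegral_mono fun σ => ?_
    by_cases hσ : σ ∈ Ioo 0 a
    · have h4 : ρ₀ θ - σ ∈ Ioi (0 : ℝ) := by simp only [mem_Ioi]; linarith [hσ.2]
      have h5 : (ρ₀ θ - σ) • eR θ ∈ domain ρ₀ := ⟨θ, hθ, _, h4, by linarith [hσ.1], rfl⟩
      rw [indicator_of_mem hσ, indicator_of_mem h4, hh, indicator_of_mem h5]
      gcongr
      linarith [hσ.2]
    · rw [indicator_of_notMem hσ]; exact zero_le
  rw [← ENNReal.mul_le_iff_le_inv ha0 ENNReal.ofReal_ne_top,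
    ← lintegral_const_mul' _ _ ENNReal.ofReal_ne_top]
  exact (setLIntegral_mono' measurableSet_Ioo h3).trans h2

end Geometry

/-! ### The one-dimensional Sobolev estimate. -/

section OneDimensional

variable {F : Type} [NormedAddCommGroup F] [NormedSpace ℝ F] [CompleteSpace F]

/-- A continuously differentiable function of one variable is bounded by the mean of its norm and
the integral of the norm of its derivative. -/
theorem enorm_le_lintegral_add_deriv {a b : ℝ} (hab : a < b) {h h' : ℝ → F}
    (hd : ∀ x ∈ Icc a b, HasDerivWithinAt h (h' x) (Icc a b) x) (hc : ContinuousOn h' (Icc a b))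
    {c : ℝ} (hcm : c ∈ Icc a b) :
    ‖h c‖ₑ ≤ (ENNReal.ofReal (b - a))⁻¹ * (∫⁻ x in Ioo a b, ‖h x‖ₑ) + ∫⁻ x in Ioo a b, ‖h' x‖ₑ := by
  have hb0 : ENNReal.ofReal (b - a) ≠ 0 := by simpa using hab
  have h1 : ∀ x ∈ Ioo a b, ‖h c‖ₑ ≤ ‖h x‖ₑ + ∫⁻ x in Ioo a b, ‖h' x‖ₑ := by
    intro x hx
    have hsub : uIcc x c ⊆ Icc a b := uIcc_subset_Icc (Ioo_subset_Icc_self hx) hcm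
    have hiv : IntervalIntegrable h' volume x c := (hc.mono hsub).intervalIntegrable
    have h2 : ∫ y in x..c, h' y = h c - h x := by
      refine intervalIntegral.integral_eq_sub_of_hasDeriv_right
        (fun y hy => (hd y (hsub hy)).continuousWithinAt.mono hsub) (fun y hy => ?_) hiv
      have hy' : y ∈ Ioo a b :=
        ⟨(le_min hx.1.le hcm.1).trans_lt hy.1, hy.2.trans_le (max_le hx.2.le hcm.2)⟩
      exact ((hd y (Ioo_subset_Icc_self hy')).hasDerivAt (Icc_mem_nhds hy'.1 hy'.2)).hasDerivWithinAt
    calc ‖h c‖ₑ = ‖h x + (h c - h x)‖ₑ := by congr 1; abel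
      _ ≤ ‖h x‖ₑ + ‖h c - h x‖ₑ := enorm_add_le _ _
      _ ≤ _ := by
        gcongr
        rw [← h2, intervalIntegral.intervalIntegral_eq_integral_uIoc, enorm_smul]
        have h4 : ‖(if x ≤ c then (1 : ℝ) else -1)‖ₑ = 1 := by split_ifs <;> simp
        rw [h4, one_mul]
        refine (enorm_integral_le_lintegral_enorm _).trans ?_
        rw [restrict_Ioo_eq_restrict_Icc]
        exact lintegral_mono_set (uIoc_subset_uIcc.trans hsub)
  have h5 : ENNReal.ofReal (b - a) * ‖h c‖ₑ ≤
      (∫⁻ x in Ioo a b, ‖h x‖ₑ) + ENNReal.ofReal (b - a) * ∫⁻ x in Ioo a b, ‖h' x‖ₑ := by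
    calc ENNReal.ofReal (b - a) * ‖h c‖ₑ = ∫⁻ x in Ioo a b, ‖h c‖ₑ := by
          rw [setLIntegral_const, Real.volume_Ioo, mul_comm]
      _ ≤ ∫⁻ x in Ioo a b, (‖h x‖ₑ + ∫⁻ x in Ioo a b, ‖h' x‖ₑ) :=
          setLIntegral_mono' measurableSet_Ioo h1
      _ = _ := by
          rw [lintegral_add_right _ measurable_const, setLIntegral_const, Real.volume_Ioo, mul_comm]
  rw [ENNReal.mul_le_iff_le_inv hb0 ENNReal.ofReal_ne_top, mul_add, ← mul_assoc,
    ENNReal.inv_mul_cancel hb0 ENNReal.ofReal_ne_top, one_mul] at h5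
  exact h5

end OneDimensional

/-! ### Trace inequalities on the curved boundary. -/

section Traces

variable {F : Type} [NormedAddCommGroup F] [NormedSpace ℝ F] [CompleteSpace F]
  {Ω : Set Plane} {φ : ContDiffBump (0 : Plane)}

theorem measurable_lmollify {p : Plane → ℝ≥0∞} (hp : Measurable p) : Measurable (lmollify φ p) := by
  refine Measurable.lintegral_prod_right'
    (f := fun z : Plane × Plane => ENNReal.ofReal (φ.normed volume (z.1 - z.2)) * p z.2) ?_
  exact ((φ.continuous_normed.measurable.comp (measurable_fst.sub measurable_snd)).ennreal_ofReal).mul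
    (hp.comp measurable_snd)

theorem lmollify_congr_ae {p p' : Plane → ℝ≥0∞} (h : p =ᵐ[volume] p') :
    lmollify φ p = lmollify φ p' := by
  ext x
  refine lintegral_congr_ae ?_
  filter_upwards [h] with y hy
  rw [hy]

theorem lmollify_mono {p p' : Plane → ℝ≥0∞} (h : p ≤ p') (x : Plane) :
    lmollify φ p x ≤ lmollify φ p' x :=
  lintegral_mono fun y => by gcongr; exact h y

theorem exists_bump_seq : ∃ ψ : ℕ → ContDiffBump (0 : Plane),
    Tendsto (fun n => (ψ n).rOut) atTop (𝓝 0) := by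
  refine ⟨fun n => ⟨1 / (n + 1) / 2, 1 / (n + 1), by positivity, ?_⟩,
    tendsto_one_div_add_atTop_nhds_zero_nat⟩
  have : (0 : ℝ) < 1 / (n + 1) := by positivity
  linarith

/-- `enorm_le_lintegral_add_deriv` applied to the smooth function along γ, with the chain rule. It
serves for rays and for curves parallel to the boundary. -/
theorem enorm_mollify_curve_le (hΩ : MeasurableSet Ω) {f : Plane → F} {G : Plane → Plane →L[ℝ] F}
    (h : HasWeakGradient Ω f G) (hf : IntegrableOn f Ω) (hG : IntegrableOn G Ω) {a b : ℝ}
    (hab : a < b) {γ γ' : ℝ → Plane} (hγ : ∀ x ∈ Icc a b, HasDerivAt γ (γ' x) x)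
    (hγ' : ContinuousOn γ' (Icc a b)) {K : ℝ≥0} (hK : ∀ x ∈ Icc a b, ‖γ' x‖ₑ ≤ K)
    (hin : ∀ x ∈ Icc a b, Metric.closedBall (γ x) φ.rOut ⊆ Ω) {c : ℝ} (hc : c ∈ Icc a b) :
    ‖mollify φ Ω f (γ c)‖ₑ ≤ (ENNReal.ofReal (b - a))⁻¹ * (∫⁻ x in Ioo a b, ‖mollify φ Ω f (γ x)‖ₑ)
      + K * ∫⁻ x in Ioo a b, ‖mollify φ Ω G (γ x)‖ₑ := by
  have hγc : ContinuousOn γ (Icc a b) := fun x hx => (hγ x hx).continuousAt.continuousWithinAt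
  refine (enorm_le_lintegral_add_deriv hab (h := fun x => mollify φ Ω f (γ x))
    (h' := fun x => mollify φ Ω G (γ x) (γ' x)) (fun x hx => ?_) ?_ hc).trans ?_
  · exact ((hasFDerivAt_mollify hΩ h hf hG (hin x hx)).comp_hasDerivAt x (hγ x hx)).hasDerivWithinAt
  · exact ((continuous_mollify hΩ hG).comp_continuousOn hγc).clm_apply hγ'
  · gcongr
    rw [← lintegral_const_mul' _ _ ENNReal.coe_ne_top]
    refine setLIntegral_mono' measurableSet_Ioo fun x hx => ?_
    rw [mul_comm]
    exact (ContinuousLinearMap.le_opENorm _ _).trans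
      (by gcongr; exact hK x (Ioo_subset_Icc_self hx))

theorem eventually_closedBall_subset (hΩ : IsOpen Ω) {K : Set Plane} (hK : IsCompact K)
    (hKΩ : K ⊆ Ω) {ψ : ℕ → ContDiffBump (0 : Plane)}
    (hψ : Tendsto (fun n => (ψ n).rOut) atTop (𝓝 0)) :
    ∀ᶠ n in atTop, ∀ x ∈ K, Metric.closedBall x (ψ n).rOut ⊆ Ω := by
  obtain ⟨δ, hδ, hsub⟩ := hK.exists_cthickening_subset_open hΩ hKΩ
  filter_upwards [hψ.eventually (gt_mem_nhds hδ)] with n hn x hx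
  exact ((Metric.closedBall_subset_closedBall hn.le).trans
    (Metric.closedBall_subset_cthickening hx δ)).trans hsub

variable {ρ₀ : ℝ → ℝ}

theorem hasDerivAt_ray (ρ θ σ : ℝ) : HasDerivAt (fun σ : ℝ => (ρ - σ) • eR θ) (-eR θ) σ := by
  have := ((hasDerivAt_id σ).const_sub ρ).smul_const (eR θ)
  simpa using this

theorem ray_mem_domain {a θ σ : ℝ} (hρa : ∀ θ ∈ Icc 0 Real.pi, 2 * a ≤ ρ₀ θ)
    (hθ : θ ∈ Ioo 0 Real.pi) (h0 : 0 < σ) (ha : σ ≤ a) : (ρ₀ θ - σ) • eR θ ∈ domain ρ₀ :=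
  ⟨θ, hθ, _, by linarith [hρa θ (Ioo_subset_Icc_self hθ)], by linarith, rfl⟩

theorem tendsto_ray (hpos : ∀ θ ∈ Icc 0 Real.pi, 0 < ρ₀ θ) {a θ : ℝ} (ha : 0 < a)
    (hρa : ∀ θ ∈ Icc 0 Real.pi, 2 * a ≤ ρ₀ θ) {v : Plane → F}
    (hc : ContinuousOn v (closure (domain ρ₀))) (hθ : θ ∈ Ioo 0 Real.pi) :
    Tendsto (fun η : ℝ => v ((ρ₀ θ - η) • eR θ)) (𝓝[>] 0) (𝓝 (v (ρ₀ θ • eR θ))) := by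
  have h1 : Tendsto (fun η : ℝ => (ρ₀ θ - η) • eR θ) (𝓝[>] 0)
      (𝓝[closure (domain ρ₀)] (ρ₀ θ • eR θ)) := by
    refine tendsto_nhdsWithin_iff.2 ⟨?_, ?_⟩
    · have : Tendsto (fun η : ℝ => (ρ₀ θ - η) • eR θ) (𝓝 0) (𝓝 ((ρ₀ θ - 0) • eR θ)) :=
        (hasDerivAt_ray (ρ₀ θ) θ 0).continuousAt
      rw [sub_zero] at this
      exact this.mono_left nhdsWithin_le_nhds
    · filter_upwards [Ioo_mem_nhdsGT ha] with η hη
      exact subset_closure (ray_mem_domain hρa hθ hη.1 hη.2.le)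
  exact (hc _ (boundary_mem_closure hpos hθ)).tendsto.comp h1

theorem lintegral_indicator_rpow (hΩ : MeasurableSet Ω) (p : Plane → ℝ≥0∞) {q : ℝ} (hq : 0 < q) :
    ∫⁻ x, (Ω.indicator p x) ^ q = ∫⁻ x in Ω, p x ^ q := by
  rw [← lintegral_indicator hΩ]
  congr 1; ext x
  by_cases hx : x ∈ Ω <;> simp [hx, hq]

/-- The trace inequality in `L²`. -/
theorem lintegral_trace_sq_le (hρ : ContinuousOn ρ₀ (Icc 0 Real.pi)) {a : ℝ} (ha : 0 < a)
    (hρa : ∀ θ ∈ Icc 0 Real.pi, 2 * a ≤ ρ₀ θ) {v : Plane → F} {G : Plane → Plane →L[ℝ] F}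
    (hc : ContinuousOn v (closure (domain ρ₀))) (hw : HasWeakGradient (domain ρ₀) v G)
    (hvi : IntegrableOn v (domain ρ₀)) (hGi : IntegrableOn G (domain ρ₀)) :
    ∫⁻ θ in Ioo 0 Real.pi, ‖v (ρ₀ θ • eR θ)‖ₑ ^ (2 : ℝ) ≤
      ((ENNReal.ofReal (a / 2))⁻¹ + 1) ^ (2 : ℝ) *
        ∫⁻ x in domain ρ₀, (‖v x‖ₑ + ‖G x‖ₑ) ^ (2 : ℝ) := by
  have hΩo := isOpen_domain hρ
  have hΩ := hΩo.measurableSet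
  have hpos : ∀ θ ∈ Icc 0 Real.pi, 0 < ρ₀ θ := fun θ hθ => by linarith [hρa θ hθ]
  set A : ℝ≥0∞ := (ENNReal.ofReal (a / 2))⁻¹ + 1 with hA
  set p₀ : Plane → ℝ≥0∞ := (domain ρ₀).indicator fun x => ‖v x‖ₑ + ‖G x‖ₑ with hp₀
  have hp₀m : AEMeasurable p₀ :=
    (aemeasurable_indicator_iff hΩ).2 (hvi.1.enorm.add hGi.1.enorm)
  -- A measurable version, as required in polar coordinates; mollification does not see the null
  -- set.
  set p := hp₀m.mk p₀
  have hpm : Measurable p := hp₀m.measurable_mk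
  obtain ⟨ψ, hψ⟩ := exists_bump_seq
  set P : ℕ → Plane → ℝ≥0∞ := fun n => lmollify (ψ n) p with hP
  have hPm : ∀ n, Measurable (P n) := fun n => measurable_lmollify hpm
  have hPv : ∀ n x, ‖mollify (ψ n) (domain ρ₀) v x‖ₑ ≤ P n x := fun n x => by
    rw [hP]; simp only; rw [← lmollify_congr_ae hp₀m.ae_eq_mk]
    refine (enorm_mollify_le hΩ v x).trans (lmollify_mono (fun y => ?_) x)
    exact indicator_le_indicator le_self_add
  have hPG : ∀ n x, ‖mollify (ψ n) (domain ρ₀) G x‖ₑ ≤ P n x := fun n x => by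
    rw [hP]; simp only; rw [← lmollify_congr_ae hp₀m.ae_eq_mk]
    refine (enorm_mollify_le hΩ G x).trans (lmollify_mono (fun y => ?_) x)
    exact indicator_le_indicator le_add_self
  -- the bound on a ray, before the limit
  have hray : ∀ θ ∈ Ioo 0 Real.pi, ∀ η ∈ Ioc 0 (a / 2), ∀ᶠ n in atTop,
      ‖mollify (ψ n) (domain ρ₀) v ((ρ₀ θ - η) • eR θ)‖ₑ ^ (2 : ℝ) ≤
        A ^ (2 : ℝ) * ENNReal.ofReal a *
          ∫⁻ σ in Ioo 0 a, (P n ((ρ₀ θ - σ) • eR θ)) ^ (2 : ℝ) := by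
    intro θ hθ η hη
    have hcs : ContinuousOn (fun σ : ℝ => (ρ₀ θ - σ) • eR θ) (Icc η a) :=
      fun σ _ => (hasDerivAt_ray _ _ σ).continuousAt.continuousWithinAt
    have hcm : Measurable (fun σ : ℝ => (ρ₀ θ - σ) • eR θ) := by
      have : Continuous (fun σ : ℝ => (ρ₀ θ - σ) • eR θ) :=
        continuous_iff_continuousAt.2 fun σ => (hasDerivAt_ray _ _ σ).continuousAt
      exact this.measurable
    filter_upwards [eventually_closedBall_subset hΩo (isCompact_Icc.image_of_continuousOn hcs)
      (by rintro _ ⟨σ, hσ, rfl⟩; exact ray_mem_domain hρa hθ (hη.1.trans_le hσ.1) hσ.2) hψ]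
      with n hn
    have hηa : η < a := by linarith [hη.2]
    have h1 := enorm_mollify_curve_le hΩ hw hvi hGi hηa
      (fun σ _ => hasDerivAt_ray (ρ₀ θ) θ σ) continuousOn_const (K := 1)
      (fun σ _ => by rw [enorm_neg, ← ofReal_norm, norm_eR]; simp)
      (fun σ hσ => hn _ ⟨σ, hσ, rfl⟩) (left_mem_Icc.2 hηa.le)
    have h2 : ‖mollify (ψ n) (domain ρ₀) v ((ρ₀ θ - η) • eR θ)‖ₑ ≤
        A * ∫⁻ σ in Ioo 0 a, P n ((ρ₀ θ - σ) • eR θ) := by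
      refine h1.trans ?_
      have hss : Ioo η a ⊆ Ioo 0 a := Ioo_subset_Ioo hη.1.le le_rfl
      rw [hA, add_mul]
      gcongr ?_ * ?_ + ?_ * ?_
      · rw [ENNReal.inv_le_inv]
        exact ENNReal.ofReal_le_ofReal (by linarith [hη.2])
      · exact (lintegral_mono fun σ => hPv n _).trans (lintegral_mono_set hss)
      · simp
      · exact (lintegral_mono fun σ => hPG n _).trans (lintegral_mono_set hss)
    -- Cauchy–Schwarz on (0, a). After squaring it costs a factor a, which the a⁻¹ of
    -- `lintegral_polar_le` cancels.
    have h3 := eLpNorm'_le_eLpNorm'_mul_rpow_measure_univ (μ := volume.restrict (Ioo 0 a))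
      one_pos (q := 2) (by norm_num) (f := fun σ => P n ((ρ₀ θ - σ) • eR θ))
      ((hPm n).comp hcm).aestronglyMeasurable
    simp only [eLpNorm', enorm_eq_self, ENNReal.rpow_one, div_one, Measure.restrict_apply_univ,
      Real.volume_Ioo, sub_zero] at h3
    calc _ ≤ (A * ((∫⁻ σ in Ioo 0 a, P n ((ρ₀ θ - σ) • eR θ) ^ (2 : ℝ)) ^ (1 / 2 : ℝ) *
          ENNReal.ofReal a ^ (1 - 1 / 2 : ℝ))) ^ (2 : ℝ) := by
          refine ENNReal.rpow_le_rpow (h2.trans ?_) (by norm_num)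
          gcongr
      _ = _ := by
          rw [ENNReal.mul_rpow_of_nonneg _ _ (by norm_num),
            ENNReal.mul_rpow_of_nonneg _ _ (by norm_num), ← ENNReal.rpow_mul, ← ENNReal.rpow_mul]
          norm_num
          ring
  have hA' : A ^ (2 : ℝ) * ENNReal.ofReal a ≠ ⊤ := by
    refine ENNReal.mul_ne_top (ENNReal.rpow_ne_top_of_nonneg (by norm_num) ?_) ENNReal.ofReal_ne_top
    simp [hA, ha]
  -- Two successive limits: first n → ∞ at a fixed interior depth η, then η → 0 by continuity up to
  -- the boundary. The right side does not depend on η, and Fatou's lemma then integrates it over θ.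
  have hlim : ∀ θ ∈ Ioo 0 Real.pi, ‖v (ρ₀ θ • eR θ)‖ₑ ^ (2 : ℝ) ≤
      A ^ (2 : ℝ) * ENNReal.ofReal a *
        liminf (fun n => ∫⁻ σ in Ioo 0 a, (P n ((ρ₀ θ - σ) • eR θ)) ^ (2 : ℝ)) atTop := by
    intro θ hθ
    have h1 : Tendsto (fun η : ℝ => ‖v ((ρ₀ θ - η) • eR θ)‖ₑ ^ (2 : ℝ)) (𝓝[>] 0)
        (𝓝 (‖v (ρ₀ θ • eR θ)‖ₑ ^ (2 : ℝ))) :=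
      ((tendsto_ray hpos ha hρa hc hθ).enorm).ennrpow_const _
    refine le_of_tendsto h1 ?_
    filter_upwards [Ioc_mem_nhdsGT (half_pos ha)] with η hη
    have hmem := ray_mem_domain hρa hθ hη.1 (hη.2.trans (half_le_self ha.le))
    have h2 := ((tendsto_mollify hψ hΩo (hc.mono subset_closure) hmem).enorm).ennrpow_const (2 : ℝ)
    rw [← h2.liminf_eq, ← ENNReal.liminf_const_mul_of_ne_top hA']
    exact liminf_le_liminf (hray θ hθ η hη)
  have hFatou : ∫⁻ θ in Ioo 0 Real.pi,
      liminf (fun n => ∫⁻ σ in Ioo 0 a, (P n ((ρ₀ θ - σ) • eR θ)) ^ (2 : ℝ)) atTop ≤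
      liminf (fun n => ∫⁻ θ in Ioo 0 Real.pi,
        ∫⁻ σ in Ioo 0 a, (P n ((ρ₀ θ - σ) • eR θ)) ^ (2 : ℝ)) atTop := by
    refine lintegral_liminf_le' fun n => ?_
    -- Nothing is known about ρ₀ outside [0, π]; a continuous extension supplies joint measurability
    -- in (θ, σ).
    set r : ℝ → ℝ := IccExtend Real.pi_pos.le ((Icc 0 Real.pi).domRestrict ρ₀) with hr
    have hrc : Continuous r := (continuousOn_iff_continuous_domRestrict.1 hρ).Icc_extend'
    have hm : Measurable fun θ => ∫⁻ σ in Ioo 0 a, (P n ((r θ - σ) • eR θ)) ^ (2 : ℝ) := by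
      refine Measurable.lintegral_prod_right'
        (f := fun z : ℝ × ℝ => (P n ((r z.1 - z.2) • eR z.1)) ^ (2 : ℝ)) ?_
      refine ((hPm n).comp ?_).pow_const _
      exact (Continuous.smul ((hrc.comp continuous_fst).sub continuous_snd)
        (continuous_eR.comp continuous_fst)).measurable
    refine hm.aemeasurable.congr ?_
    filter_upwards [ae_restrict_mem measurableSet_Ioo] with θ hθ
    rw [hr, IccExtend_of_mem _ _ (Ioo_subset_Icc_self hθ)]
    rfl
  have hbound : ∀ n, ∫⁻ θ in Ioo 0 Real.pi,
        ∫⁻ σ in Ioo 0 a, (P n ((ρ₀ θ - σ) • eR θ)) ^ (2 : ℝ) ≤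
      (ENNReal.ofReal a)⁻¹ * ∫⁻ x in domain ρ₀, (‖v x‖ₑ + ‖G x‖ₑ) ^ (2 : ℝ) := by
    intro n
    refine (lintegral_polar_le hρ ha hρa ((hPm n).pow_const 2)).trans ?_
    gcongr _ * ?_
    refine (setLIntegral_le_lintegral _ _).trans ?_
    refine (lintegral_lmollify_rpow_le hpm.aemeasurable (by norm_num)).trans (le_of_eq ?_)
    rw [← lintegral_indicator_rpow hΩ _ (by norm_num)]
    refine lintegral_congr_ae ?_
    filter_upwards [hp₀m.ae_eq_mk] with x hx
    rw [← hp₀, hx]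
  calc _ ≤ ∫⁻ θ in Ioo 0 Real.pi, A ^ (2 : ℝ) * ENNReal.ofReal a *
        liminf (fun n => ∫⁻ σ in Ioo 0 a, (P n ((ρ₀ θ - σ) • eR θ)) ^ (2 : ℝ)) atTop :=
        setLIntegral_mono' measurableSet_Ioo hlim
    _ = A ^ (2 : ℝ) * ENNReal.ofReal a * _ := lintegral_const_mul' _ _ hA'
    _ ≤ A ^ (2 : ℝ) * ENNReal.ofReal a *
        ((ENNReal.ofReal a)⁻¹ * ∫⁻ x in domain ρ₀, (‖v x‖ₑ + ‖G x‖ₑ) ^ (2 : ℝ)) := by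
        gcongr
        refine hFatou.trans ?_
        refine (liminf_le_liminf (Eventually.of_forall hbound)).trans ?_
        simp
    _ = _ := by
        rw [mul_assoc, ← mul_assoc (ENNReal.ofReal a),
          ENNReal.mul_inv_cancel (by simpa using ha) ENNReal.ofReal_ne_top, one_mul]

/-- A lower bound of the radius of the drop: `θ`-curves are uniformly Lipschitz. -/
theorem exists_deriv_bound (hρ : ContDiffOn ℝ 1 ρ₀ (Icc 0 Real.pi)) :
    ∃ K : ℝ≥0, ContinuousOn (deriv ρ₀) (Ioo 0 Real.pi) ∧
      ∀ θ ∈ Ioo 0 Real.pi, HasDerivAt ρ₀ (deriv ρ₀ θ) θ ∧ ‖deriv ρ₀ θ‖ ≤ K ∧ ‖ρ₀ θ‖ ≤ K := by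
  have hu : UniqueDiffOn ℝ (Icc 0 Real.pi) := uniqueDiffOn_Icc Real.pi_pos
  have hc : ContinuousOn (derivWithin ρ₀ (Icc 0 Real.pi)) (Icc 0 Real.pi) :=
    hρ.continuousOn_derivWithin hu le_rfl
  obtain ⟨K1, hK1⟩ := isCompact_Icc.exists_bound_of_continuousOn hc
  obtain ⟨K2, hK2⟩ := isCompact_Icc.exists_bound_of_continuousOn hρ.continuousOn
  have he : ∀ θ ∈ Ioo 0 Real.pi, derivWithin ρ₀ (Icc 0 Real.pi) θ = deriv ρ₀ θ := fun θ hθ =>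
    derivWithin_of_mem_nhds (Icc_mem_nhds hθ.1 hθ.2)
  refine ⟨(max K1 K2).toNNReal, (hc.mono Ioo_subset_Icc_self).congr fun θ hθ => (he θ hθ).symm,
    fun θ hθ => ⟨?_, ?_, ?_⟩⟩
  · exact ((hρ.differentiableOn one_ne_zero θ (Ioo_subset_Icc_self hθ)).differentiableAt
      (Icc_mem_nhds hθ.1 hθ.2)).hasDerivAt
  · rw [← he θ hθ]
    exact ((hK1 θ (Ioo_subset_Icc_self hθ)).trans (le_max_left _ _)).trans (Real.le_coe_toNNReal _)
  · exact ((hK2 θ (Ioo_subset_Icc_self hθ)).trans (le_max_right _ _)).trans (Real.le_coe_toNNReal _)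

/-- Functions in `W^{2,1}` are bounded on the curve `r = ρ₀`. -/
theorem exists_enorm_trace_le (hρ : ContDiffOn ℝ 1 ρ₀ (Icc 0 Real.pi)) {a : ℝ} (ha : 0 < a)
    (hρa : ∀ θ ∈ Icc 0 Real.pi, 2 * a ≤ ρ₀ θ) :
    ∃ C : ℝ≥0, ∀ (u : Plane → F) (G : Plane → Plane →L[ℝ] F) (H : Plane → Plane →L[ℝ] Plane →L[ℝ] F),
      ContinuousOn u (closure (domain ρ₀)) → HasWeakGradient (domain ρ₀) u G →
      HasWeakGradient (domain ρ₀) G H → IntegrableOn u (domain ρ₀) → IntegrableOn G (domain ρ₀) →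
      IntegrableOn H (domain ρ₀) → ∀ θ ∈ Ioo 0 Real.pi,
      ‖u (ρ₀ θ • eR θ)‖ₑ ≤ C * ∫⁻ x in domain ρ₀, (‖u x‖ₑ + ‖G x‖ₑ + ‖H x‖ₑ) := by
  obtain ⟨K, hKc, hK⟩ := exists_deriv_bound hρ
  set B : ℝ≥0 := (Real.toNNReal (Real.pi / 2))⁻¹ + (2 * K + Real.toNNReal a) with hB
  set A : ℝ≥0 := (Real.toNNReal (a / 2))⁻¹ + 1 with hA
  refine ⟨A * B * (Real.toNNReal a)⁻¹, fun u G H hc hw hw2 hui hGi hHi θ₀ hθ₀ => ?_⟩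
  have hΩo := isOpen_domain hρ.continuousOn
  have hΩ := hΩo.measurableSet
  have hpos : ∀ θ ∈ Icc 0 Real.pi, 0 < ρ₀ θ := fun θ hθ => by linarith [hρa θ hθ]
  have hpi := Real.pi_pos
  set p₀ : Plane → ℝ≥0∞ := (domain ρ₀).indicator fun x => ‖u x‖ₑ + ‖G x‖ₑ + ‖H x‖ₑ with hp₀
  have hp₀m : AEMeasurable p₀ :=
    (aemeasurable_indicator_iff hΩ).2 ((hui.1.enorm.add hGi.1.enorm).add hHi.1.enorm)
  set p := hp₀m.mk p₀
  have hpm : Measurable p := hp₀m.measurable_mk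
  obtain ⟨ψ, hψ⟩ := exists_bump_seq
  set P : ℕ → Plane → ℝ≥0∞ := fun n => lmollify (ψ n) p with hP
  have hPm : ∀ n, Measurable (P n) := fun n => measurable_lmollify hpm
  have hPle : ∀ {F' : Type} [NormedAddCommGroup F'] [NormedSpace ℝ F'] (f : Plane → F')
      (_ : ∀ y, ‖f y‖ₑ ≤ ‖u y‖ₑ + ‖G y‖ₑ + ‖H y‖ₑ) (n : ℕ) (x : Plane),
      ‖mollify (ψ n) (domain ρ₀) f x‖ₑ ≤ P n x := fun f hf n x => by
    rw [hP]; simp only; rw [← lmollify_congr_ae hp₀m.ae_eq_mk]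
    refine (enorm_mollify_le hΩ f x).trans (lmollify_mono (fun y => ?_) x)
    exact indicator_le_indicator (hf y)
  have hPu := hPle u fun y => le_self_add.trans le_self_add
  have hPG := hPle G fun y => le_add_self.trans le_self_add
  have hPH := hPle H fun y => le_add_self
  -- The interval [α, β] is compact in (0, π), contains θ₀ and has length at least π/2 wherever θ₀
  -- lies, so the constant is uniform in θ₀.
  set α := min θ₀ (Real.pi / 4) with hα
  set β := max θ₀ (3 * Real.pi / 4) with hβ
  have hα0 : 0 < α := lt_min hθ₀.1 (by linarith)
  have hβπ : β < Real.pi := max_lt hθ₀.2 (by linarith)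
  have hαβ : Real.pi / 2 ≤ β - α := by
    have h1 : α ≤ Real.pi / 4 := min_le_right _ _
    have h2 : 3 * Real.pi / 4 ≤ β := le_max_right _ _
    linarith
  have hJ : Icc α β ⊆ Ioo 0 Real.pi := fun x hx => ⟨hα0.trans_le hx.1, hx.2.trans_lt hβπ⟩
  have hθJ : θ₀ ∈ Icc α β := ⟨min_le_left _ _, le_max_left _ _⟩
  have hIle : ∀ n, ∫⁻ σ in Ioo 0 a, ∫⁻ θ in Ioo 0 Real.pi, P n ((ρ₀ θ - σ) • eR θ) ≤
      (ENNReal.ofReal a)⁻¹ * ∫⁻ x in domain ρ₀, (‖u x‖ₑ + ‖G x‖ₑ + ‖H x‖ₑ) := by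
    intro n
    set r : ℝ → ℝ := IccExtend Real.pi_pos.le ((Icc 0 Real.pi).domRestrict ρ₀) with hr
    have hrc : Continuous r :=
      (continuousOn_iff_continuous_domRestrict.1 hρ.continuousOn).Icc_extend'
    have hreq : ∀ θ ∈ Ioo 0 Real.pi, ρ₀ θ = r θ := fun θ hθ => by
      rw [hr, IccExtend_of_mem _ _ (Ioo_subset_Icc_self hθ)]; rfl
    have hswap : ∫⁻ σ in Ioo 0 a, ∫⁻ θ in Ioo 0 Real.pi, P n ((ρ₀ θ - σ) • eR θ) =
        ∫⁻ θ in Ioo 0 Real.pi, ∫⁻ σ in Ioo 0 a, P n ((ρ₀ θ - σ) • eR θ) := by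
      calc _ = ∫⁻ σ in Ioo 0 a, ∫⁻ θ in Ioo 0 Real.pi, P n ((r θ - σ) • eR θ) := by
            refine lintegral_congr fun σ => setLIntegral_congr_fun measurableSet_Ioo fun θ hθ => ?_
            simp only [hreq θ hθ]
        _ = ∫⁻ θ in Ioo 0 Real.pi, ∫⁻ σ in Ioo 0 a, P n ((r θ - σ) • eR θ) := by
            refine lintegral_lintegral_swap (Measurable.aemeasurable ?_)
            refine (hPm n).comp ?_
            exact (Continuous.smul ((hrc.comp continuous_snd).sub continuous_fst)
              (continuous_eR.comp continuous_snd)).measurable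
        _ = _ := by
            refine setLIntegral_congr_fun measurableSet_Ioo fun θ hθ => ?_
            simp only [hreq θ hθ]
    rw [hswap]
    refine (lintegral_polar_le hρ.continuousOn ha hρa (hPm n)).trans ?_
    gcongr _ * ?_
    refine (setLIntegral_le_lintegral _ _).trans ?_
    have h1 := lintegral_lmollify_rpow_le (φ := ψ n) hpm.aemeasurable le_rfl
    simp only [ENNReal.rpow_one] at h1
    refine h1.trans (le_of_eq ?_)
    rw [← lintegral_indicator hΩ]
    refine lintegral_congr_ae ?_
    filter_upwards [hp₀m.ae_eq_mk] with x hx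
    rw [← hp₀, hx]
  have hderiv : ∀ θ ∈ Ioo 0 Real.pi, ∀ σ, HasDerivAt (fun θ => (ρ₀ θ - σ) • eR θ)
      ((ρ₀ θ - σ) • ePhi θ + deriv ρ₀ θ • eR θ) θ := fun θ hθ σ =>
    ((hK θ hθ).1.sub_const σ).smul (hasDerivAt_eR θ)
  have hmain : ∀ η ∈ Ioc 0 (a / 2), ∀ᶠ n in atTop,
      ‖mollify (ψ n) (domain ρ₀) u ((ρ₀ θ₀ - η) • eR θ₀)‖ₑ ≤
        A * (B * ∫⁻ σ in Ioo 0 a, ∫⁻ θ in Ioo 0 Real.pi, P n ((ρ₀ θ - σ) • eR θ)) := by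
    intro η hη
    have hηa : η < a := by linarith [hη.2]
    have hcs : ContinuousOn (fun z : ℝ × ℝ => (ρ₀ z.1 - z.2) • eR z.1) (Icc α β ×ˢ Icc η a) := by
      refine ContinuousOn.smul (ContinuousOn.sub ?_ continuousOn_snd)
        (continuous_eR.comp continuous_fst).continuousOn
      exact hρ.continuousOn.comp continuousOn_fst fun z hz => Ioo_subset_Icc_self (hJ hz.1)
    filter_upwards [eventually_closedBall_subset hΩo
      ((isCompact_Icc.prod isCompact_Icc).image_of_continuousOn hcs)
      (by rintro _ ⟨z, hz, rfl⟩; exact ray_mem_domain hρa (hJ hz.1) (hη.1.trans_le hz.2.1) hz.2.2) hψ]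
      with n hn
    have h1 := enorm_mollify_curve_le hΩ hw hui hGi hηa
      (fun σ _ => hasDerivAt_ray (ρ₀ θ₀) θ₀ σ) continuousOn_const (K := 1)
      (fun σ _ => by rw [enorm_neg, ← ofReal_norm, norm_eR]; simp)
      (fun σ hσ => hn _ ⟨(θ₀, σ), ⟨hθJ, hσ⟩, rfl⟩) (left_mem_Icc.2 hηa.le)
    have hγ' : ∀ σ, ContinuousOn (fun θ => (ρ₀ θ - σ) • ePhi θ + deriv ρ₀ θ • eR θ) (Icc α β) := by
      intro σ
      have h6 : ContinuousOn (fun θ => ρ₀ θ - σ) (Icc α β) := (hρ.continuousOn.mono (hJ.trans Ioo_subset_Icc_self)).sub continuousOn_const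
      exact (h6.smul continuous_ePhi.continuousOn).add
        ((hKc.mono hJ).smul continuous_eR.continuousOn)
    have hbd : ∀ σ ∈ Icc η a, ∀ θ ∈ Icc α β,
        ‖(ρ₀ θ - σ) • ePhi θ + deriv ρ₀ θ • eR θ‖ₑ ≤ (2 * K + Real.toNNReal a : ℝ≥0) := by
      intro σ hσ θ hθ
      rw [← ofReal_norm, ENNReal.ofReal_le_coe]
      refine (norm_add_le _ _).trans ?_
      rw [norm_smul, norm_smul, norm_eR, norm_ePhi, mul_one, mul_one]
      have h3 := hK θ (hJ hθ)
      have h4 : ‖ρ₀ θ - σ‖ ≤ K + a := (norm_sub_le _ _).trans (add_le_add h3.2.2 (by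
        rw [Real.norm_of_nonneg (hη.1.le.trans hσ.1)]; exact hσ.2))
      push_cast
      rw [Real.coe_toNNReal a ha.le]
      linarith [h3.2.1]
    -- The estimate along the curve r = ρ₀ - σ. After the estimate along the ray has produced u and
    -- G, it is applied to (u, G) and to (G, H); this is where second derivatives enter.
    have hstep : ∀ {F' : Type} [NormedAddCommGroup F'] [NormedSpace ℝ F'] [CompleteSpace F']
        (f : Plane → F') (D : Plane → Plane →L[ℝ] F') (_ : HasWeakGradient (domain ρ₀) f D)
        (_ : IntegrableOn f (domain ρ₀)) (_ : IntegrableOn D (domain ρ₀))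
        (_ : ∀ n x, ‖mollify (ψ n) (domain ρ₀) f x‖ₑ ≤ P n x)
        (_ : ∀ n x, ‖mollify (ψ n) (domain ρ₀) D x‖ₑ ≤ P n x),
        ∀ σ ∈ Icc η a, ‖mollify (ψ n) (domain ρ₀) f ((ρ₀ θ₀ - σ) • eR θ₀)‖ₑ ≤
          B * ∫⁻ θ in Ioo 0 Real.pi, P n ((ρ₀ θ - σ) • eR θ) := by
      intro F' _ _ _ f D hfD hf hD hPf hPD σ hσ
      have h2 := enorm_mollify_curve_le hΩ hfD hf hD (a := α) (b := β) (by linarith)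
        (fun θ hθ => hderiv θ (hJ hθ) σ) (hγ' σ) (hbd σ hσ)
        (fun θ hθ => hn _ ⟨(θ, σ), ⟨hθ, hσ⟩, rfl⟩) hθJ
      refine h2.trans ?_
      have hss : Ioo α β ⊆ Ioo 0 Real.pi := Ioo_subset_Icc_self.trans hJ
      rw [hB, ENNReal.coe_add _ (2 * K + _), add_mul _ ((2 * K + Real.toNNReal a : ℝ≥0) : ℝ≥0∞)]
      gcongr ?_ * ?_ + _ * ?_
      · rw [ENNReal.coe_inv (by simpa using hpi)]
        rw [ENNReal.inv_le_inv]
        exact ENNReal.ofReal_le_ofReal hαβ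
      · exact (lintegral_mono fun σ => hPf n _).trans (lintegral_mono_set hss)
      · exact (lintegral_mono fun σ => hPD n _).trans (lintegral_mono_set hss)
    have hss : Ioo η a ⊆ Ioo 0 a := Ioo_subset_Ioo hη.1.le le_rfl
    have h5 : ∀ {g : ℝ → ℝ≥0∞}, (∀ σ ∈ Icc η a, g σ ≤
        B * ∫⁻ θ in Ioo 0 Real.pi, P n ((ρ₀ θ - σ) • eR θ)) → ∫⁻ σ in Ioo η a, g σ ≤
        B * ∫⁻ σ in Ioo 0 a, ∫⁻ θ in Ioo 0 Real.pi, P n ((ρ₀ θ - σ) • eR θ) := by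
      intro g hg
      rw [← lintegral_const_mul' _ _ ENNReal.coe_ne_top]
      exact (setLIntegral_mono' measurableSet_Ioo fun σ hσ => hg σ (Ioo_subset_Icc_self hσ)).trans
        (lintegral_mono_set hss)
    refine h1.trans ?_
    rw [hA, ENNReal.coe_add, add_mul]
    gcongr ?_ * ?_ + ?_ * ?_
    · rw [ENNReal.coe_inv (by simpa using ha)]
      rw [ENNReal.inv_le_inv]
      exact ENNReal.ofReal_le_ofReal (by linarith [hη.2])
    · exact h5 (hstep u G hw hui hGi hPu hPG)
    · simp
    · exact h5 (hstep G H hw2 hGi hHi hPG hPH)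
  have hfin : ∀ η ∈ Ioc 0 (a / 2), ‖u ((ρ₀ θ₀ - η) • eR θ₀)‖ₑ ≤
      A * (B * ((ENNReal.ofReal a)⁻¹ * ∫⁻ x in domain ρ₀, (‖u x‖ₑ + ‖G x‖ₑ + ‖H x‖ₑ))) := by
    intro η hη
    have hmem := ray_mem_domain hρa hθ₀ hη.1 (hη.2.trans (half_le_self ha.le))
    have h2 := (tendsto_mollify hψ hΩo (hc.mono subset_closure) hmem).enorm
    refine le_of_tendsto h2 ?_
    filter_upwards [hmain η hη] with n hn
    refine hn.trans ?_
    gcongr _ * (_ * ?_)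
    exact hIle n
  refine (le_of_tendsto (tendsto_ray hpos ha hρa hc hθ₀).enorm
    (by filter_upwards [Ioc_mem_nhdsGT (half_pos ha)] with η hη using hfin η hη)).trans
    (le_of_eq ?_)
  rw [ENNReal.coe_mul, ENNReal.coe_mul, ENNReal.coe_inv (by simpa using ha)]
  simp only [mul_assoc]
  rfl

end Traces

/-! ### The trace as a bounded relation. -/

section Relations

/-- Lebesgue measure on `(0, π)`. -/
noncomputable abbrev angleMeasure : Measure ℝ := volume.restrict (Ioo 0 Real.pi)

/-- Square integrable vector fields on `(0, π)`. -/
abbrev AngleL2 : Type := Lp Plane 2 angleMeasure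

/-- Continuous functions on `[0, π]`. -/
abbrev AngleC : Type := C(Icc (0 : ℝ) Real.pi, ℝ)

variable {ρ₀ : ℝ → ℝ}

theorem memLp_of_continuousOn_of_bound {F : Type} [NormedAddCommGroup F] {f : ℝ → F} {K : ℝ}
    (hf : ContinuousOn f (Ioo 0 Real.pi)) (hK : ∀ θ ∈ Ioo 0 Real.pi, ‖f θ‖ ≤ K) (p : ℝ≥0∞) :
    MemLp f p angleMeasure :=
  MemLp.of_bound (hf.aestronglyMeasurable measurableSet_Ioo) K
    ((ae_restrict_iff' measurableSet_Ioo).2 (Eventually.of_forall hK))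

/-- The relation between a field that is continuous up to the boundary and its trace. -/
def traceRel (ρ₀ : ℝ → ℝ) : Submodule ℝ ((Plane → Plane) × AngleL2) where
  carrier := {x | ContinuousOn x.1 (closure (domain ρ₀)) ∧
    x.2 =ᵐ[angleMeasure] fun θ => x.1 (ρ₀ θ • eR θ)}
  zero_mem' := ⟨continuousOn_const, Lp.coeFn_zero _ _ _⟩
  add_mem' := by
    rintro x y ⟨h1, h2⟩ ⟨h1', h2'⟩
    refine ⟨h1.add h1', ?_⟩
    filter_upwards [Lp.coeFn_add x.2 y.2, h2, h2'] with θ h h3 h4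
    rw [Prod.snd_add, h, Pi.add_apply, h3, h4]; rfl
  smul_mem' := by
    rintro c x ⟨h1, h2⟩
    refine ⟨h1.const_smul c, ?_⟩
    filter_upwards [Lp.coeFn_smul c x.2, h2] with θ h h3
    rw [Prod.smul_snd, h, Pi.smul_apply, h3]; rfl

theorem isCompact_closure_domain (hρ : ContinuousOn ρ₀ (Icc 0 Real.pi)) :
    IsCompact (closure (domain ρ₀)) := by
  obtain ⟨R, hR⟩ := isCompact_Icc.exists_bound_of_continuousOn hρ
  exact (isCompact_closedBall (0 : Plane) R).of_isClosed_subset isClosed_closure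
    (closure_minimal (domain_subset_closedBall fun θ hθ => (le_abs_self _).trans (hR θ hθ))
      Metric.isClosed_closedBall)

theorem exists_trace (hρ : ContinuousOn ρ₀ (Icc 0 Real.pi))
    (hpos : ∀ θ ∈ Icc 0 Real.pi, 0 < ρ₀ θ) {v : Plane → Plane}
    (hv : ContinuousOn v (closure (domain ρ₀))) : ∃ w, (v, w) ∈ traceRel ρ₀ := by
  obtain ⟨K, hK⟩ := (isCompact_closure_domain hρ).exists_bound_of_continuousOn hv
  have hc : ContinuousOn (fun θ => v (ρ₀ θ • eR θ)) (Ioo 0 Real.pi) :=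
    hv.comp ((hρ.mono Ioo_subset_Icc_self).smul continuous_eR.continuousOn)
      fun θ hθ => boundary_mem_closure hpos hθ
  have hm := memLp_of_continuousOn_of_bound hc (fun θ hθ => hK _ (boundary_mem_closure hpos hθ)) 2
  exact ⟨hm.toLp _, hv, hm.coeFn_toLp⟩

theorem volume_domain_lt_top (hρ : ContinuousOn ρ₀ (Icc 0 Real.pi)) :
    volume (domain ρ₀) < ⊤ :=
  (measure_mono subset_closure).trans_lt (isCompact_closure_domain hρ).measure_lt_top

theorem integrableOn_of_eLpNorm_lt_top {E F : Type} [MeasureSpace E] [NormedAddCommGroup F]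
    {Ω : Set E} (hΩ : volume Ω < ⊤) {f : E → F} {p : ℝ≥0∞} (hp : 1 ≤ p)
    (hm : AEStronglyMeasurable f (volume.restrict Ω))
    (hf : eLpNorm f p (volume.restrict Ω) < ⊤) : IntegrableOn f Ω := by
  have : IsFiniteMeasure (volume.restrict Ω) := ⟨by simpa using hΩ⟩
  exact MemLp.integrable hp ⟨hm, hf⟩

theorem exists_pos_le (hρ : ContinuousOn ρ₀ (Icc 0 Real.pi))
    (hpos : ∀ θ ∈ Icc 0 Real.pi, 0 < ρ₀ θ) : ∃ a, 0 < a ∧ ∀ θ ∈ Icc 0 Real.pi, 2 * a ≤ ρ₀ θ := by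
  obtain ⟨x, hx, hmin⟩ := isCompact_Icc.exists_isMinOn ⟨0, left_mem_Icc.2 Real.pi_pos.le⟩ hρ
  exact ⟨ρ₀ x / 2, half_pos (hpos x hx), fun θ hθ => by linarith [isMinOn_iff.1 hmin θ hθ]⟩

theorem exists_traceRel_bound (hρ : ContinuousOn ρ₀ (Icc 0 Real.pi))
    (hpos : ∀ θ ∈ Icc 0 Real.pi, 0 < ρ₀ θ) :
    ∃ C : ℝ≥0, ∀ v w, (v, w) ∈ traceRel ρ₀ → ‖w‖ₑ ≤ C * sobolevNorm (domain ρ₀) 1 2 v := by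
  obtain ⟨a, ha, hρa⟩ := exists_pos_le hρ hpos
  refine ⟨(Real.toNNReal (a / 2))⁻¹ + 1, fun v w hvw => ?_⟩
  obtain ⟨hv, hw⟩ := hvw
  set A : ℝ≥0∞ := (((Real.toNNReal (a / 2))⁻¹ + 1 : ℝ≥0) : ℝ≥0∞) with hA
  have hA2 : A = (ENNReal.ofReal (a / 2))⁻¹ + 1 := by
    rw [hA, ENNReal.coe_add, ENNReal.coe_inv (by simpa using ha)]; rfl
  have hA0 : A ≠ 0 := by simp [hA2]
  have hAt : A ≠ ⊤ := ENNReal.coe_ne_top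
  rw [mul_comm, ← ENNReal.div_le_iff hA0 hAt]
  refine le_of_forall_gt fun b hb => ?_
  obtain ⟨G, hG, hGm, hb'⟩ := exists_of_sobolevNorm_one_lt hb
  refine lt_of_le_of_lt ?_ hb'
  have hof : ENNReal.ofReal 2 = 2 := by norm_num
  rw [hof] at hb' ⊢
  rw [ENNReal.div_le_iff hA0 hAt, mul_comm]
  have hvm := hG.1.aestronglyMeasurable
  have hfin := volume_domain_lt_top hρ
  have hvi : IntegrableOn v (domain ρ₀) := integrableOn_of_eLpNorm_lt_top hfin (p := 2) (by norm_num)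
    hvm (le_self_add.trans_lt (hb'.trans_le le_top))
  have hGi : IntegrableOn G (domain ρ₀) := integrableOn_of_eLpNorm_lt_top hfin (p := 2) (by norm_num)
    hGm (le_add_self.trans_lt (hb'.trans_le le_top))
  have h1 := lintegral_trace_sq_le hρ ha hρa hv hG hvi hGi
  rw [← hA2] at h1
  have h2 : ‖w‖ₑ = (∫⁻ θ in Ioo 0 Real.pi, ‖v (ρ₀ θ • eR θ)‖ₑ ^ (2 : ℝ)) ^ (1 / 2 : ℝ) := by
    rw [Lp.enorm_def, eLpNorm_congr_ae hw, eLpNorm_eq_lintegral_rpow_enorm_toReal (by simp) (by simp)]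
    simp
  have h3 : (∫⁻ x in domain ρ₀, (‖v x‖ₑ + ‖G x‖ₑ) ^ (2 : ℝ)) ^ (1 / 2 : ℝ) ≤
      eLpNorm v 2 (volume.restrict (domain ρ₀)) + eLpNorm G 2 (volume.restrict (domain ρ₀)) := by
    have h4 := ENNReal.lintegral_Lp_add_le (μ := volume.restrict (domain ρ₀)) hvm.enorm hGm.enorm
      (p := 2) (by norm_num)
    rw [eLpNorm_eq_lintegral_rpow_enorm_toReal (by simp) (by simp),
      eLpNorm_eq_lintegral_rpow_enorm_toReal (by simp) (by simp)]
    simpa using h4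
  rw [h2]
  calc _ ≤ (A ^ (2 : ℝ) * ∫⁻ x in domain ρ₀, (‖v x‖ₑ + ‖G x‖ₑ) ^ (2 : ℝ)) ^ (1 / 2 : ℝ) :=
        ENNReal.rpow_le_rpow h1 (by norm_num)
    _ = A * (∫⁻ x in domain ρ₀, (‖v x‖ₑ + ‖G x‖ₑ) ^ (2 : ℝ)) ^ (1 / 2 : ℝ) := by
        rw [ENNReal.mul_rpow_of_nonneg _ _ (by norm_num), ← ENNReal.rpow_mul]; norm_num
    _ ≤ _ := mul_le_mul_right h3 _

/-- The drop has finite area, so L^q norms control L¹ norms and `exists_enorm_trace_le` applies. It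
lets the energy, which contains the W^{2,q} norm of u, control the trace of u. -/
theorem exists_traceRel_bound_two (hρ : ContDiffOn ℝ 1 ρ₀ (Icc 0 Real.pi))
    (hpos : ∀ θ ∈ Icc 0 Real.pi, 0 < ρ₀ θ) {q : ℝ} (hq : 1 ≤ q) :
    ∃ C : ℝ≥0, ∀ v w, (v, w) ∈ traceRel ρ₀ → ‖w‖ₑ ≤ C * sobolevNorm (domain ρ₀) 2 q v := by
  obtain ⟨a, ha, hρa⟩ := exists_pos_le hρ.continuousOn hpos
  obtain ⟨C, hC⟩ := exists_enorm_trace_le (F := Plane) hρ ha hρa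
  have hfin := volume_domain_lt_top hρ.continuousOn
  set L : ℝ≥0 := (volume (domain ρ₀) ^ (1 - 1 / q)).toNNReal with hL
  have hLe : (L : ℝ≥0∞) = volume (domain ρ₀) ^ (1 - 1 / q) := by
    refine ENNReal.coe_toNNReal (ENNReal.rpow_ne_top_of_nonneg ?_ hfin.ne)
    rw [sub_nonneg, div_le_one (by linarith)]; exact hq
  set S : ℝ≥0 := (ENNReal.ofReal Real.pi ^ (1 / 2 : ℝ)).toNNReal with hS
  have hSe : (S : ℝ≥0∞) = ENNReal.ofReal Real.pi ^ (1 / 2 : ℝ) :=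
    ENNReal.coe_toNNReal (ENNReal.rpow_ne_top_of_nonneg (by norm_num) ENNReal.ofReal_ne_top)
  -- S passes from the sup norm to L²(0, π) and L from L^q to L¹ on the drop. The summand 1 keeps
  -- the constant nonzero, so that one may divide by it.
  refine ⟨S * (C * L) + 1, fun v w hvw => ?_⟩
  obtain ⟨hv, hw⟩ := hvw
  set A : ℝ≥0∞ := ((S * (C * L) + 1 : ℝ≥0) : ℝ≥0∞) with hA
  have hA0 : A ≠ 0 := by simp [hA]
  have hAt : A ≠ ⊤ := ENNReal.coe_ne_top
  rw [mul_comm, ← ENNReal.div_le_iff hA0 hAt]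
  refine le_of_forall_gt fun b hb => ?_
  obtain ⟨G, H, hG, hH, hHm, hb'⟩ := exists_of_sobolevNorm_two_lt hb
  refine lt_of_le_of_lt ?_ hb'
  rw [ENNReal.div_le_iff hA0 hAt, mul_comm]
  have hq' : 1 ≤ ENNReal.ofReal q := by simpa using hq
  have hvm := hG.1.aestronglyMeasurable
  have hGm := hH.1.aestronglyMeasurable
  have hvi : IntegrableOn v (domain ρ₀) := integrableOn_of_eLpNorm_lt_top hfin hq'
    hvm (le_self_add.trans_lt (hb'.trans_le le_top))
  have hGi : IntegrableOn G (domain ρ₀) := integrableOn_of_eLpNorm_lt_top hfin hq'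
    hGm ((le_self_add.trans le_add_self).trans_lt (hb'.trans_le le_top))
  have hHi : IntegrableOn H (domain ρ₀) := integrableOn_of_eLpNorm_lt_top hfin hq'
    hHm ((le_add_self.trans le_add_self).trans_lt (hb'.trans_le le_top))
  have hone : ∀ {F' : Type} [NormedAddCommGroup F'] {f : Plane → F'}
      (_ : AEStronglyMeasurable f (volume.restrict (domain ρ₀))),
      ∫⁻ x in domain ρ₀, ‖f x‖ₑ ≤
        L * eLpNorm f (ENNReal.ofReal q) (volume.restrict (domain ρ₀)) := by
    intro F' _ f hf
    rw [← eLpNorm_one_eq_lintegral_enorm]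
    refine (eLpNorm_le_eLpNorm_mul_rpow_measure_univ hq' hf).trans (le_of_eq ?_)
    rw [hLe, Measure.restrict_apply_univ, mul_comm, ENNReal.toReal_ofReal (by linarith)]
    simp
  have h1 : ∀ θ ∈ Ioo 0 Real.pi, ‖v (ρ₀ θ • eR θ)‖ₑ ≤ C * (L * (
      eLpNorm v (ENNReal.ofReal q) (volume.restrict (domain ρ₀)) +
        (eLpNorm G (ENNReal.ofReal q) (volume.restrict (domain ρ₀)) +
        eLpNorm H (ENNReal.ofReal q) (volume.restrict (domain ρ₀))))) := by
    intro θ hθ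
    refine (hC v G H hv hG hH hvi hGi hHi θ hθ).trans ?_
    gcongr _ * ?_
    rw [lintegral_add_left' (f := fun x => ‖v x‖ₑ + ‖G x‖ₑ) (hvm.enorm.add hGm.enorm),
      lintegral_add_left' hvm.enorm,
      ← add_assoc, mul_add, mul_add]
    exact add_le_add (add_le_add (hone hvm) (hone hGm)) (hone hHm)
  have h2 : ‖w‖ₑ = (∫⁻ θ in Ioo 0 Real.pi, ‖v (ρ₀ θ • eR θ)‖ₑ ^ (2 : ℝ)) ^ (1 / 2 : ℝ) := by
    rw [Lp.enorm_def, eLpNorm_congr_ae hw, eLpNorm_eq_lintegral_rpow_enorm_toReal (by simp) (by simp)]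
    simp
  set Z := eLpNorm v (ENNReal.ofReal q) (volume.restrict (domain ρ₀)) +
        (eLpNorm G (ENNReal.ofReal q) (volume.restrict (domain ρ₀)) +
        eLpNorm H (ENNReal.ofReal q) (volume.restrict (domain ρ₀))) with hZ
  calc ‖w‖ₑ ≤ (∫⁻ θ in Ioo 0 Real.pi, (C * (L * Z)) ^ (2 : ℝ)) ^ (1 / 2 : ℝ) := by
        rw [h2]
        refine ENNReal.rpow_le_rpow (setLIntegral_mono' measurableSet_Ioo fun θ hθ => ?_) (by norm_num)
        exact ENNReal.rpow_le_rpow (h1 θ hθ) (by norm_num)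
    _ = S * (C * L) * Z := by
        rw [setLIntegral_const, Real.volume_Ioo, ENNReal.mul_rpow_of_nonneg _ _ (by norm_num),
          ← ENNReal.rpow_mul, hSe, sub_zero]
        norm_num
        ring
    _ ≤ A * Z := by
        rw [hA]
        gcongr
        push_cast
        exact le_self_add

end Relations

/-! ### Profiles as continuous functions together with an L² derivative field. -/

section Profiles

theorem hasDerivAt_derivWithin_of_contDiffOn {f : ℝ → ℝ} (hf : ContDiffOn ℝ 1 f (Icc 0 Real.pi))
    {θ : ℝ} (hθ : θ ∈ Ioo 0 Real.pi) : HasDerivAt f (derivWithin f (Icc 0 Real.pi) θ) θ :=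
  ((hf.differentiableOn one_ne_zero θ (Ioo_subset_Icc_self hθ)).hasDerivWithinAt).hasDerivAt
    (Icc_mem_nhds hθ.1 hθ.2)

theorem continuousOn_derivWithin_Icc {f : ℝ → ℝ} (hf : ContDiffOn ℝ 1 f (Icc 0 Real.pi)) :
    ContinuousOn (derivWithin f (Icc 0 Real.pi)) (Icc 0 Real.pi) :=
  hf.continuousOn_derivWithin (uniqueDiffOn_Icc Real.pi_pos) le_rfl

/-- The classical derivative is the weak derivative. -/
theorem weakGradient_eq_derivWithin {f : ℝ → ℝ} {G : ℝ → ℝ →L[ℝ] ℝ}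
    (hf : ContDiffOn ℝ 1 f (Icc 0 Real.pi)) (hG : HasWeakGradient (Ioo 0 Real.pi) f G) :
    (fun θ => G θ 1) =ᵐ[angleMeasure] derivWithin f (Icc 0 Real.pi) := by
  set f' := derivWithin f (Icc 0 Real.pi)
  have hf'c : ContinuousOn f' (Icc 0 Real.pi) := continuousOn_derivWithin_Icc hf
  have hG1 : LocallyIntegrableOn (fun θ => G θ 1) (Ioo 0 Real.pi) := fun x hx => by
    obtain ⟨s, hs, hi⟩ := hG.2.1 x hx
    exact ⟨s, hs, hi.apply_continuousLinearMap 1⟩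
  have hf'l : LocallyIntegrableOn f' (Ioo 0 Real.pi) :=
    (hf'c.mono Ioo_subset_Icc_self).locallyIntegrableOn measurableSet_Ioo
  have hl : LocallyIntegrableOn (fun θ => G θ 1 - f' θ) (Ioo 0 Real.pi) := hG1.sub hf'l
  -- The fundamental lemma of the calculus of variations; it remains to integrate (φ f)' over (0,
  -- π), where φ vanishes at both ends.
  have := isOpen_Ioo.ae_eq_zero_of_integral_contDiff_smul_eq_zero hl (μ := volume) ?_
  · filter_upwards [(ae_restrict_iff' measurableSet_Ioo).2 this] with θ hθ
    exact sub_eq_zero.1 hθ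
  intro φ hφ hc hs
  have h1 := hG.2.2 φ hφ hc hs 1
  have hz : ∀ θ, θ ∉ Ioo 0 Real.pi → φ θ = 0 := fun θ hθ =>
    image_eq_zero_of_notMem_tsupport fun h => hθ (hs h)
  have hz' : ∀ θ, θ ∉ Ioo 0 Real.pi → deriv φ θ = 0 := fun θ hθ => by
    by_contra hne
    exact hθ (hs (support_deriv_subset hne))
  have hφ'c : Continuous (deriv φ) := hφ.continuous_deriv (by simp)
  have hi1 : IntervalIntegrable (fun θ => deriv φ θ * f θ) volume 0 Real.pi :=
    ContinuousOn.intervalIntegrable (by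
      rw [uIcc_of_le Real.pi_pos.le]; exact hφ'c.continuousOn.mul hf.continuousOn)
  have hi2 : IntervalIntegrable (fun θ => φ θ * f' θ) volume 0 Real.pi :=
    ContinuousOn.intervalIntegrable (by
      rw [uIcc_of_le Real.pi_pos.le]; exact hφ.continuous.continuousOn.mul hf'c)
  have h2 : ∫ θ in (0 : ℝ)..Real.pi, (deriv φ θ * f θ + φ θ * f' θ) = 0 := by
    rw [intervalIntegral.integral_eq_sub_of_hasDerivAt_of_le Real.pi_pos.le
      (f := fun θ => φ θ * f θ) (hφ.continuous.continuousOn.mul hf.continuousOn)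
      (fun θ hθ => ((hφ.differentiable (by simp)) θ).hasDerivAt.mul
        (hasDerivAt_derivWithin_of_contDiffOn hf hθ)) (hi1.add hi2)]
    rw [hz 0 (by simp), hz Real.pi (by simp)]
    simp
  rw [intervalIntegral.integral_add hi1 hi2, intervalIntegral.integral_of_le Real.pi_pos.le,
    intervalIntegral.integral_of_le Real.pi_pos.le, integral_Ioc_eq_integral_Ioo,
    integral_Ioc_eq_integral_Ioo] at h2
  have h3 : Integrable (fun θ => φ θ • G θ 1) :=
    integrable_smul_of_tsupport_subset hφ.continuous hc hs hG1
  have h4 : Integrable (fun θ => φ θ • f' θ) :=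
    integrable_smul_of_tsupport_subset hφ.continuous hc hs hf'l
  have h5 : ∀ (h : ℝ → ℝ), ∫ θ, φ θ • h θ = ∫ θ in Ioo 0 Real.pi, φ θ • h θ := fun h => by
    rw [setIntegral_eq_integral_of_forall_compl_eq_zero]
    intro θ hθ
    simp [hz θ hθ]
  simp only [smul_sub]
  rw [integral_sub h3 h4, h5, h5]
  have h6 : ∫ θ in Ioo 0 Real.pi, (fderiv ℝ φ θ 1) • f θ = ∫ θ in Ioo 0 Real.pi, deriv φ θ * f θ := by
    simp
  rw [h6] at h1
  simp only [smul_eq_mul] at h1 ⊢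
  linarith

/-- The relation between a profile `f`, its restriction to `[0, π]` and the field `f' k`. -/
def profileRel (k : ℝ → Plane) : Submodule ℝ ((ℝ → ℝ) × (AngleC × AngleL2)) where
  carrier := {x | ContDiffOn ℝ 1 x.1 (Icc 0 Real.pi) ∧ (∀ θ, x.2.1 θ = x.1 θ) ∧
    x.2.2 =ᵐ[angleMeasure] fun θ => derivWithin x.1 (Icc 0 Real.pi) θ • k θ}
  zero_mem' := ⟨contDiffOn_const, fun _ => rfl, by
    filter_upwards [Lp.coeFn_zero Plane 2 angleMeasure] with θ h
    simp only [Prod.snd_zero, Prod.fst_zero]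
    rw [h, show (0 : ℝ → ℝ) = fun _ => 0 from rfl, derivWithin_fun_const]
    simp⟩
  add_mem' := by
    rintro x y ⟨h1, h2, h3⟩ ⟨h1', h2', h3'⟩
    refine ⟨h1.add h1', fun θ => ?_, ?_⟩
    · change x.2.1 θ + y.2.1 θ = x.1 θ + y.1 θ
      rw [h2, h2']
    · filter_upwards [Lp.coeFn_add x.2.2 y.2.2, h3, h3', ae_restrict_mem measurableSet_Ioo]
        with θ h h4 h5 hθ
      rw [Prod.snd_add, Prod.snd_add, h, Pi.add_apply, h4, h5, Prod.fst_add, derivWithin_add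
        (h1.differentiableOn one_ne_zero θ (Ioo_subset_Icc_self hθ))
        (h1'.differentiableOn one_ne_zero θ (Ioo_subset_Icc_self hθ)), add_smul]
  smul_mem' := by
    rintro c x ⟨h1, h2, h3⟩
    refine ⟨contDiffOn_const.smul h1, fun θ => ?_, ?_⟩
    · change c * x.2.1 θ = c * x.1 θ
      rw [h2]
    · filter_upwards [Lp.coeFn_smul c x.2.2, h3, ae_restrict_mem measurableSet_Ioo]
        with θ h h4 hθ
      rw [Prod.smul_snd, Prod.smul_snd, h, Pi.smul_apply, h4, Prod.smul_fst,
        derivWithin_const_smul, smul_assoc]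
      exact h1.differentiableOn one_ne_zero θ (Ioo_subset_Icc_self hθ)

theorem exists_profile {k : ℝ → Plane} (hk : ContinuousOn k (Icc 0 Real.pi)) {f : ℝ → ℝ}
    (hf : ContDiffOn ℝ 1 f (Icc 0 Real.pi)) : ∃ w, (f, w) ∈ profileRel k := by
  have hc : ContinuousOn (fun θ => derivWithin f (Icc 0 Real.pi) θ • k θ) (Icc 0 Real.pi) :=
    (continuousOn_derivWithin_Icc hf).smul hk
  obtain ⟨K, hK⟩ := isCompact_Icc.exists_bound_of_continuousOn hc
  have hm := memLp_of_continuousOn_of_bound (hc.mono Ioo_subset_Icc_self)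
    (fun θ hθ => hK θ (Ioo_subset_Icc_self hθ)) 2
  exact ⟨(⟨(Icc 0 Real.pi).domRestrict f, continuousOn_iff_continuous_domRestrict.1 hf.continuousOn⟩,
    hm.toLp _), hf, fun θ => rfl, hm.coeFn_toLp⟩

theorem enorm_prod_le {A B : Type} [NormedAddCommGroup A] [NormedAddCommGroup B] (x : A × B) :
    ‖x‖ₑ ≤ ‖x.1‖ₑ + ‖x.2‖ₑ := by
  rw [← ofReal_norm, ← ofReal_norm, ← ofReal_norm, ← ENNReal.ofReal_add (norm_nonneg _)
    (norm_nonneg _), Prod.norm_def]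
  exact ENNReal.ofReal_le_ofReal (max_le_add_of_nonneg (norm_nonneg _) (norm_nonneg _))

/-- The first component is bounded by the embedding of H¹(0, π) in the continuous functions, the
second because k is bounded. -/
theorem exists_profileRel_bound {k : ℝ → Plane} (hk : ContinuousOn k (Icc 0 Real.pi)) :
    ∃ C : ℝ≥0, ∀ f w, (f, w) ∈ profileRel k → ‖w‖ₑ ≤ C * sobolevNorm (Ioo 0 Real.pi) 1 2 f := by
  obtain ⟨K, hK⟩ := isCompact_Icc.exists_bound_of_continuousOn hk
  set S : ℝ≥0 := (ENNReal.ofReal Real.pi ^ (1 / 2 : ℝ)).toNNReal with hS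
  have hSe : (S : ℝ≥0∞) = ENNReal.ofReal Real.pi ^ (1 / 2 : ℝ) :=
    ENNReal.coe_toNNReal (ENNReal.rpow_ne_top_of_nonneg (by norm_num) ENNReal.ofReal_ne_top)
  have hpi : Real.toNNReal Real.pi ≠ 0 := by simpa using Real.pi_pos
  set C1 : ℝ≥0 := (Real.toNNReal Real.pi)⁻¹ + 1 with hC1
  refine ⟨C1 * S + K.toNNReal + 1, fun f w hfw => ?_⟩
  obtain ⟨hf, hF, hD⟩ := hfw
  set A : ℝ≥0∞ := ((C1 * S + K.toNNReal + 1 : ℝ≥0) : ℝ≥0∞) with hA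
  have hA0 : A ≠ 0 := by simp [hA]
  have hAt : A ≠ ⊤ := ENNReal.coe_ne_top
  rw [mul_comm, ← ENNReal.div_le_iff hA0 hAt]
  refine le_of_forall_gt fun b hb => ?_
  obtain ⟨G, hG, hGm, hb'⟩ := exists_of_sobolevNorm_one_lt hb
  refine lt_of_le_of_lt ?_ hb'
  have hof : ENNReal.ofReal 2 = 2 := by norm_num
  rw [hof, ENNReal.div_le_iff hA0 hAt, mul_comm]
  set f' := derivWithin f (Icc 0 Real.pi) with hf'
  have hfm := hG.1.aestronglyMeasurable
  have hf'm : AEStronglyMeasurable f' angleMeasure :=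
    ((continuousOn_derivWithin_Icc hf).mono Ioo_subset_Icc_self).aestronglyMeasurable
      measurableSet_Ioo
  have hf'G : eLpNorm f' 2 angleMeasure ≤ eLpNorm G 2 angleMeasure := by
    rw [← eLpNorm_congr_ae (weakGradient_eq_derivWithin hf hG)]
    refine eLpNorm_mono_enorm fun θ => ?_
    simpa using (G θ).le_opENorm 1
  have hone : ∀ {h : ℝ → ℝ} (_ : AEStronglyMeasurable h angleMeasure),
      ∫⁻ x in Ioo 0 Real.pi, ‖h x‖ₑ ≤ S * eLpNorm h 2 angleMeasure := by
    intro h hh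
    rw [← eLpNorm_one_eq_lintegral_enorm]
    refine (eLpNorm_le_eLpNorm_mul_rpow_measure_univ (q := 2) (by norm_num) hh).trans (le_of_eq ?_)
    rw [hSe, Measure.restrict_apply_univ, Real.volume_Ioo, mul_comm]
    norm_num
  have hsup : ∀ c ∈ Icc 0 Real.pi, ‖f c‖ₑ ≤
      C1 * S * (eLpNorm f 2 angleMeasure + eLpNorm G 2 angleMeasure) := by
    intro c hc
    have h1 := enorm_le_lintegral_add_deriv Real.pi_pos (h := f) (h' := f')
      (fun x hx => (hf.differentiableOn one_ne_zero x hx).hasDerivWithinAt)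
      (continuousOn_derivWithin_Icc hf) hc
    refine h1.trans ?_
    have h2 : (ENNReal.ofReal (Real.pi - 0))⁻¹ ≤ C1 := by
      rw [hC1, ENNReal.coe_add, ENNReal.coe_inv hpi, sub_zero]
      exact le_self_add
    have h3 : (1 : ℝ≥0∞) ≤ C1 := by rw [hC1]; push_cast; exact le_add_self
    rw [mul_add, mul_assoc, mul_assoc]
    refine add_le_add (mul_le_mul' h2 (hone hfm)) ?_
    calc _ ≤ S * eLpNorm f' 2 angleMeasure := hone hf'm
      _ ≤ S * eLpNorm G 2 angleMeasure := mul_le_mul_right hf'G _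
      _ ≤ _ := le_mul_of_one_le_left' h3
  have hD' : ‖w.2‖ₑ ≤ K.toNNReal * eLpNorm G 2 angleMeasure := by
    rw [Lp.enorm_def, eLpNorm_congr_ae hD]
    refine (eLpNorm_le_mul_eLpNorm_of_ae_le_mul' (c := K.toNNReal) (g := f') ?_ 2).trans
      (mul_le_mul_right hf'G _)
    filter_upwards [ae_restrict_mem measurableSet_Ioo] with θ hθ
    rw [enorm_smul, mul_comm]
    gcongr
    rw [← ofReal_norm, ENNReal.ofReal_le_coe]
    exact (hK θ (Ioo_subset_Icc_self hθ)).trans (Real.le_coe_toNNReal _)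
  have hF' : ‖w.1‖ₑ ≤ C1 * S * (eLpNorm f 2 angleMeasure + eLpNorm G 2 angleMeasure) := by
    rw [hof] at hb'
    set R := C1 * S * (eLpNorm f 2 angleMeasure + eLpNorm G 2 angleMeasure) with hR
    have hRt : R ≠ ⊤ := ENNReal.mul_ne_top (ENNReal.mul_ne_top ENNReal.coe_ne_top ENNReal.coe_ne_top)
      (hb'.trans_le le_top).ne
    rw [← ofReal_norm, ← ENNReal.ofReal_toReal hRt]
    refine ENNReal.ofReal_le_ofReal ((ContinuousMap.norm_le _ ENNReal.toReal_nonneg).2 fun θ => ?_)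
    have h4 := hsup θ θ.2
    rw [← (show w.1 θ = f θ from hF θ)] at h4
    have h5 := ENNReal.toReal_mono hRt h4
    rwa [toReal_enorm] at h5
  calc ‖w‖ₑ ≤ ‖w.1‖ₑ + ‖w.2‖ₑ := enorm_prod_le w
    _ ≤ C1 * S * (eLpNorm f 2 angleMeasure + eLpNorm G 2 angleMeasure) +
        K.toNNReal * (eLpNorm f 2 angleMeasure + eLpNorm G 2 angleMeasure) :=
        add_le_add hF' (hD'.trans (mul_le_mul_right le_add_self _))
    _ ≤ A * _ := by
        rw [← add_mul]
        gcongr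
        rw [hA]; push_cast
        exact le_self_add

end Profiles

/-! ### Translated profiles, their derivative in the translation, and the Euler equation. -/

section Pole

/-- The ray of angle `θ` meets the curve `r = ρ₀`, translated by `c`, at distance `r`, in the
translate of the point of angle `φ`. -/
structure IsShift (ρ₀ : ℝ → ℝ) (c θ r φ : ℝ) : Prop where
  pos : 0 < r
  mem : φ ∈ Icc 0 Real.pi
  cos_eq : r * Real.cos θ = ρ₀ φ * Real.cos φ + c
  sin_eq : r * Real.sin θ = ρ₀ φ * Real.sin φ

/-- Bounds of a profile. -/
structure ProfileBounds (ρ₀ : ℝ → ℝ) (m R L : ℝ) : Prop where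
  m_pos : 0 < m
  le_of_mem : ∀ θ ∈ Icc 0 Real.pi, m ≤ ρ₀ θ
  of_mem_le : ∀ θ ∈ Icc 0 Real.pi, ρ₀ θ ≤ R
  L_nonneg : 0 ≤ L
  lip : ∀ θ ∈ Icc 0 Real.pi, ∀ φ ∈ Icc 0 Real.pi, |ρ₀ θ - ρ₀ φ| ≤ L * |θ - φ|

variable {ρ₀ : ℝ → ℝ} {m R L c θ r φ : ℝ}

theorem exists_profileBounds (hρ : ContDiffOn ℝ 1 ρ₀ (Icc 0 Real.pi))
    (hpos : ∀ θ ∈ Icc 0 Real.pi, 0 < ρ₀ θ) : ∃ m R L, ProfileBounds ρ₀ m R L := by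
  obtain ⟨a, ha, hρa⟩ := exists_pos_le hρ.continuousOn hpos
  obtain ⟨R, hR⟩ := isCompact_Icc.exists_bound_of_continuousOn hρ.continuousOn
  obtain ⟨L, hL⟩ := isCompact_Icc.exists_bound_of_continuousOn (continuousOn_derivWithin_Icc hρ)
  refine ⟨2 * a, R, L, by positivity, hρa, fun θ hθ => (le_abs_self _).trans (hR θ hθ),
    (norm_nonneg _).trans (hL 0 (left_mem_Icc.2 Real.pi_pos.le)), fun θ hθ φ hφ => ?_⟩
  exact (convex_Icc 0 Real.pi).norm_image_sub_le_of_norm_derivWithin_le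
    (hρ.differentiableOn one_ne_zero) hL hφ hθ

theorem isShift_iff_mem : (0 < r ∧ ∃ φ ∈ Icc 0 Real.pi, r • eR θ = ρ₀ φ • eR φ + !₂[c, 0]) ↔
    ∃ φ, IsShift ρ₀ c θ r φ := by
  have key : ∀ φ, r • eR θ = ρ₀ φ • eR φ + !₂[c, 0] ↔
      r * Real.cos θ = ρ₀ φ * Real.cos φ + c ∧ r * Real.sin θ = ρ₀ φ * Real.sin φ := by
    intro φ
    constructor
    · intro h
      have h0 := congrArg (fun x : Plane => x 0) h
      have h1 := congrArg (fun x : Plane => x 1) h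
      simp [eR] at h0 h1
      exact ⟨h0, h1⟩
    · rintro ⟨h0, h1⟩
      ext i
      fin_cases i <;> simp [eR, h0, h1]
  constructor
  · rintro ⟨hr, φ, hφ, h⟩
    exact ⟨φ, hr, hφ, ((key φ).1 h).1, ((key φ).1 h).2⟩
  · rintro ⟨φ, h⟩
    exact ⟨h.pos, φ, h.mem, (key φ).2 ⟨h.cos_eq, h.sin_eq⟩⟩

/-- The vector equation projected orthogonally to the ray; projecting along the ray gives
`IsShift.eq_cos`. -/
theorem IsShift.sin_sub (h : IsShift ρ₀ c θ r φ) : ρ₀ φ * Real.sin (φ - θ) = c * Real.sin θ := by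
  rw [Real.sin_sub]
  linear_combination Real.sin θ * h.cos_eq - Real.cos θ * h.sin_eq

theorem IsShift.eq_cos (h : IsShift ρ₀ c θ r φ) :
    r = ρ₀ φ * Real.cos (φ - θ) + c * Real.cos θ := by
  rw [Real.cos_sub]
  linear_combination Real.cos θ * h.cos_eq + Real.sin θ * h.sin_eq -
    r * Real.sin_sq_add_cos_sq θ

theorem ProfileBounds.abs_arg_le (hB : ProfileBounds ρ₀ m R L)
    (hφ : φ ∈ Icc 0 Real.pi) (c θ : ℝ) : |c * (Real.sin θ / ρ₀ φ)| ≤ |c| / m := by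
  have hm := hB.m_pos
  have h1 := hB.le_of_mem φ hφ
  have h2 : 0 < ρ₀ φ := hm.trans_le h1
  rw [abs_mul, abs_div, abs_of_pos h2, ← mul_div_assoc]
  refine div_le_div₀ (abs_nonneg _) ?_ hm h1
  exact mul_le_of_le_one_right (abs_nonneg _) (Real.abs_sin_le_one θ)

/-- The sine of φ - θ is known from `IsShift.sin_sub`; positivity of its cosine selects the
principal branch. The result is a fixed-point equation for φ. -/
theorem IsShift.sub_eq_arcsin (h : IsShift ρ₀ c θ r φ) (hB : ProfileBounds ρ₀ m R L)
    (hc : |c| ≤ m / 2) (hθ : θ ∈ Icc 0 Real.pi) :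
    φ - θ = Real.arcsin (c * (Real.sin θ / ρ₀ φ)) := by
  have hm := hB.m_pos
  have h1 := hB.le_of_mem φ h.mem
  have h2 : 0 < ρ₀ φ := hm.trans_le h1
  have hs : Real.sin (φ - θ) = c * (Real.sin θ / ρ₀ φ) := by
    rw [← mul_div_assoc, ← h.sin_sub]; field_simp
  -- Otherwise r > 0 forces |ρ₀(φ) cos(φ - θ)| ≤ m/2, while |ρ₀(φ) sin(φ - θ)| ≤ m/2 as well, so
  -- ρ₀(φ)² ≤ m²/2, contradicting ρ₀ ≥ m.
  have hcos : 0 < Real.cos (φ - θ) := by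
    by_contra hneg
    push Not at hneg
    have h3 : |c * Real.cos θ| ≤ m / 2 := by
      rw [abs_mul]
      exact (mul_le_of_le_one_right (abs_nonneg _) (Real.abs_cos_le_one θ)).trans hc
    have h4 : |c * Real.sin θ| ≤ m / 2 := by
      rw [abs_mul]
      exact (mul_le_of_le_one_right (abs_nonneg _) (Real.abs_sin_le_one θ)).trans hc
    rw [abs_le] at h3 h4
    have h5 := h.eq_cos
    have h6 := h.pos
    have h7 : ρ₀ φ * Real.cos (φ - θ) ≤ 0 := mul_nonpos_of_nonneg_of_nonpos h2.le hneg
    have h8 : (ρ₀ φ * Real.cos (φ - θ)) ^ 2 + (ρ₀ φ * Real.sin (φ - θ)) ^ 2 = ρ₀ φ ^ 2 := by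
      linear_combination ρ₀ φ ^ 2 * Real.sin_sq_add_cos_sq (φ - θ)
    rw [h.sin_sub] at h8
    have h9 : (ρ₀ φ * Real.cos (φ - θ)) ^ 2 ≤ (m / 2) ^ 2 := by
      rw [sq_le_sq, abs_of_nonpos h7, abs_of_pos (half_pos hm)]; linarith
    have h10 : (c * Real.sin θ) ^ 2 ≤ (m / 2) ^ 2 := by
      rw [sq_le_sq, abs_of_pos (half_pos hm), abs_le]; exact h4
    nlinarith
  rw [← hs, Real.arcsin_sin]
  · by_contra hneg
    push Not at hneg
    have := Real.cos_nonpos_of_pi_div_two_le_of_le (x := -(φ - θ)) (by linarith)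
      (by linarith [h.mem.1, hθ.2, Real.pi_pos])
    rw [Real.cos_neg] at this
    linarith
  · by_contra hneg
    push Not at hneg
    have := Real.cos_nonpos_of_pi_div_two_le_of_le (x := φ - θ) (by linarith)
      (by linarith [h.mem.2, hθ.1, Real.pi_pos])
    linarith

theorem abs_arcsin_sub_le {x y : ℝ} (hx : |x| ≤ 1 / 2) (hy : |y| ≤ 1 / 2) :
    |Real.arcsin x - Real.arcsin y| ≤ 2 * |x - y| := by
  refine (convex_Icc (-(1 / 2) : ℝ) (1 / 2)).norm_image_sub_le_of_norm_hasDerivWithin_le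
    (f := Real.arcsin) (f' := fun x => 1 / √(1 - x ^ 2)) (fun z hz => ?_) (fun z hz => ?_)
    (abs_le.1 hy) (abs_le.1 hx)
  · exact (Real.hasDerivAt_arcsin (by linarith [hz.1]) (by linarith [hz.2])).hasDerivWithinAt
  · have h1 : (1 / 2 : ℝ) ≤ √(1 - z ^ 2) := by
      refine Real.le_sqrt_of_sq_le ?_
      nlinarith [hz.1, hz.2]
    rw [Real.norm_of_nonneg (by positivity), div_le_iff₀ (by linarith)]
    linarith

theorem ProfileBounds.abs_arg_le_half (hB : ProfileBounds ρ₀ m R L) (hc : |c| ≤ m / 2)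
    (hφ : φ ∈ Icc 0 Real.pi) (θ : ℝ) : |c * (Real.sin θ / ρ₀ φ)| ≤ 1 / 2 := by
  refine (hB.abs_arg_le hφ c θ).trans ?_
  rw [div_le_iff₀ hB.m_pos]; linarith

theorem IsShift.abs_sub_le (h : IsShift ρ₀ c θ r φ) (hB : ProfileBounds ρ₀ m R L)
    (hc : |c| ≤ m / 2) (hθ : θ ∈ Icc 0 Real.pi) : |φ - θ| ≤ 2 * |c| / m := by
  rw [h.sub_eq_arcsin hB hc hθ]
  have := abs_arcsin_sub_le (hB.abs_arg_le_half hc h.mem θ) (y := 0) (by norm_num)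
  rw [Real.arcsin_zero, sub_zero, sub_zero] at this
  refine this.trans ?_
  rw [mul_div_assoc]
  gcongr
  exact hB.abs_arg_le h.mem c θ

theorem abs_mul_cos_sub_le (hB : ProfileBounds ρ₀ m R L) {φ₁ φ₂ d₁ d₂ : ℝ}
    (h1 : φ₁ ∈ Icc 0 Real.pi) (h2 : φ₂ ∈ Icc 0 Real.pi) :
    |ρ₀ φ₁ * Real.cos d₁ - ρ₀ φ₂ * Real.cos d₂| ≤ L * |φ₁ - φ₂| + R * |d₁ - d₂| := by
  have h3 : |Real.cos d₁ - Real.cos d₂| ≤ |d₁ - d₂| := by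
    have := Real.lipschitzWith_cos.dist_le_mul d₁ d₂
    simpa [Real.dist_eq] using this
  have h4 : 0 < ρ₀ φ₂ := hB.m_pos.trans_le (hB.le_of_mem φ₂ h2)
  calc |ρ₀ φ₁ * Real.cos d₁ - ρ₀ φ₂ * Real.cos d₂|
      = |(ρ₀ φ₁ - ρ₀ φ₂) * Real.cos d₁ + ρ₀ φ₂ * (Real.cos d₁ - Real.cos d₂)| := by ring_nf
    _ ≤ |ρ₀ φ₁ - ρ₀ φ₂| * |Real.cos d₁| + |ρ₀ φ₂| * |Real.cos d₁ - Real.cos d₂| := by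
        rw [← abs_mul, ← abs_mul]; exact abs_add_le _ _
    _ ≤ (L * |φ₁ - φ₂|) * 1 + R * |d₁ - d₂| := by
        rw [abs_of_pos h4]
        gcongr
        · exact mul_nonneg hB.L_nonneg (abs_nonneg _)
        · exact hB.lip _ h1 _ h2
        · exact Real.abs_cos_le_one _
        · exact h4.le.trans (hB.of_mem_le _ h2)
        · exact hB.of_mem_le _ h2
    _ = _ := by ring

theorem IsShift.abs_sub_profile_le (h : IsShift ρ₀ c θ r φ) (hB : ProfileBounds ρ₀ m R L)
    (hc : |c| ≤ m / 2) (hθ : θ ∈ Icc 0 Real.pi) :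
    |r - ρ₀ θ| ≤ ((L + R) * (2 / m) + 1) * |c| := by
  have h1 := abs_mul_cos_sub_le hB h.mem hθ (d₁ := φ - θ) (d₂ := 0)
  rw [Real.cos_zero, mul_one, sub_zero] at h1
  have h2 := h.abs_sub_le hB hc hθ
  have hR : 0 ≤ R := (hB.m_pos.le.trans (hB.le_of_mem θ hθ)).trans (hB.of_mem_le θ hθ)
  have hL := hB.L_nonneg
  calc |r - ρ₀ θ| = |(ρ₀ φ * Real.cos (φ - θ) - ρ₀ θ) + c * Real.cos θ| := by
        rw [h.eq_cos]; ring_nf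
    _ ≤ |ρ₀ φ * Real.cos (φ - θ) - ρ₀ θ| + |c * Real.cos θ| := abs_add_le _ _
    _ ≤ (L * |φ - θ| + R * |φ - θ|) + |c| := by
        refine add_le_add h1 ?_
        rw [abs_mul]
        exact mul_le_of_le_one_right (abs_nonneg _) (Real.abs_cos_le_one θ)
    _ = (L + R) * |φ - θ| + |c| := by ring
    _ ≤ (L + R) * (2 * |c| / m) + |c| := by gcongr
    _ = _ := by ring

/-- The translations for which the translated curve is seen to be a graph in polar coordinates. -/
noncomputable def shiftRadius (m L : ℝ) : ℝ := min (m / 2) (m ^ 2 / (4 * (L + 1)))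

theorem shiftRadius_pos (hB : ProfileBounds ρ₀ m R L) : 0 < shiftRadius m L := by
  have := hB.m_pos
  have := hB.L_nonneg
  exact lt_min (by positivity) (by positivity)

/-- For small c the right side of the arcsine equation is a contraction in φ. With θ₁ = θ₂ this
gives uniqueness of the radius, in general the Lipschitz continuity of the translated profile. -/
theorem IsShift.abs_sub_le_of_isShift {θ₁ r₁ φ₁ θ₂ r₂ φ₂ : ℝ} (h₁ : IsShift ρ₀ c θ₁ r₁ φ₁)
    (h₂ : IsShift ρ₀ c θ₂ r₂ φ₂) (hB : ProfileBounds ρ₀ m R L) (hc : |c| ≤ shiftRadius m L)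
    (hθ₁ : θ₁ ∈ Icc 0 Real.pi) (hθ₂ : θ₂ ∈ Icc 0 Real.pi) :
    |r₁ - r₂| ≤ (4 * L + 5 * R + m) * |θ₁ - θ₂| := by
  have hm := hB.m_pos
  have hL := hB.L_nonneg
  have hc1 : |c| ≤ m / 2 := hc.trans (min_le_left _ _)
  have hc2 : |c| * (4 * (L + 1)) ≤ m ^ 2 := by
    have := hc.trans (min_le_right _ _)
    rwa [le_div_iff₀ (by positivity)] at this
  have hp1 := hB.le_of_mem φ₁ h₁.mem
  have hp2 := hB.le_of_mem φ₂ h₂.mem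
  have hp1' : 0 < ρ₀ φ₁ := hm.trans_le hp1
  have hp2' : 0 < ρ₀ φ₂ := hm.trans_le hp2
  have hR : 0 ≤ R := hp1'.le.trans (hB.of_mem_le φ₁ h₁.mem)
  have hsin : |Real.sin θ₁ - Real.sin θ₂| ≤ |θ₁ - θ₂| := by
    have := Real.lipschitzWith_sin.dist_le_mul θ₁ θ₂
    simpa [Real.dist_eq] using this
  have h3 : |Real.sin θ₁ / ρ₀ φ₁ - Real.sin θ₂ / ρ₀ φ₂| ≤
      |θ₁ - θ₂| / m + L * |φ₁ - φ₂| / m ^ 2 := by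
    calc |Real.sin θ₁ / ρ₀ φ₁ - Real.sin θ₂ / ρ₀ φ₂|
        = |(Real.sin θ₁ - Real.sin θ₂) / ρ₀ φ₁ +
            Real.sin θ₂ * (ρ₀ φ₂ - ρ₀ φ₁) / (ρ₀ φ₁ * ρ₀ φ₂)| := by
          congr 1; field_simp; ring
      _ ≤ |(Real.sin θ₁ - Real.sin θ₂) / ρ₀ φ₁| +
            |Real.sin θ₂ * (ρ₀ φ₂ - ρ₀ φ₁) / (ρ₀ φ₁ * ρ₀ φ₂)| := abs_add_le _ _
      _ ≤ _ := by
          rw [abs_div, abs_div, abs_of_pos hp1', abs_of_pos (mul_pos hp1' hp2'), abs_mul]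
          gcongr ?_ / ?_ + ?_ / ?_
          · calc _ ≤ 1 * (L * |φ₂ - φ₁|) := by
                  gcongr
                  · exact Real.abs_sin_le_one _
                  · exact hB.lip _ h₂.mem _ h₁.mem
              _ = _ := by rw [one_mul, abs_sub_comm]
          · nlinarith
  have h4 : |(φ₁ - θ₁) - (φ₂ - θ₂)| ≤ |θ₁ - θ₂| + |φ₁ - φ₂| / 2 := by
    rw [h₁.sub_eq_arcsin hB hc1 hθ₁, h₂.sub_eq_arcsin hB hc1 hθ₂]
    refine (abs_arcsin_sub_le (hB.abs_arg_le_half hc1 h₁.mem θ₁)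
      (hB.abs_arg_le_half hc1 h₂.mem θ₂)).trans ?_
    rw [← mul_sub, abs_mul]
    calc 2 * (|c| * |Real.sin θ₁ / ρ₀ φ₁ - Real.sin θ₂ / ρ₀ φ₂|)
        ≤ 2 * (|c| * (|θ₁ - θ₂| / m + L * |φ₁ - φ₂| / m ^ 2)) := by gcongr
      _ = (2 * |c| / m) * |θ₁ - θ₂| + (2 * (|c| * L) / m ^ 2) * |φ₁ - φ₂| := by ring
      -- The two terms in the definition of `shiftRadius` are used here: the first gives the
      -- coefficient 1, the second the contraction factor 1/2.
      _ ≤ 1 * |θ₁ - θ₂| + (1 / 2) * |φ₁ - φ₂| := by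
          gcongr ?_ * _ + ?_ * _
          · rw [div_le_iff₀ hm]; linarith
          · rw [div_le_iff₀ (by positivity)]; nlinarith [abs_nonneg c]
      _ = _ := by ring
  have h5 : |φ₁ - φ₂| ≤ 4 * |θ₁ - θ₂| := by
    have : |φ₁ - φ₂| ≤ |(φ₁ - θ₁) - (φ₂ - θ₂)| + |θ₁ - θ₂| := by
      calc |φ₁ - φ₂| = |((φ₁ - θ₁) - (φ₂ - θ₂)) + (θ₁ - θ₂)| := by congr 1; ring
        _ ≤ _ := abs_add_le _ _
    linarith
  have h6 : |(φ₁ - θ₁) - (φ₂ - θ₂)| ≤ 5 * |θ₁ - θ₂| := by linarith [abs_nonneg (θ₁ - θ₂)]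
  have hcos : |Real.cos θ₁ - Real.cos θ₂| ≤ |θ₁ - θ₂| := by
    have := Real.lipschitzWith_cos.dist_le_mul θ₁ θ₂
    simpa [Real.dist_eq] using this
  have h7 := abs_mul_cos_sub_le hB h₁.mem h₂.mem (d₁ := φ₁ - θ₁) (d₂ := φ₂ - θ₂)
  calc |r₁ - r₂| = |(ρ₀ φ₁ * Real.cos (φ₁ - θ₁) - ρ₀ φ₂ * Real.cos (φ₂ - θ₂)) +
        c * (Real.cos θ₁ - Real.cos θ₂)| := by rw [h₁.eq_cos, h₂.eq_cos]; ring_nf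
    _ ≤ |ρ₀ φ₁ * Real.cos (φ₁ - θ₁) - ρ₀ φ₂ * Real.cos (φ₂ - θ₂)| +
        |c * (Real.cos θ₁ - Real.cos θ₂)| := abs_add_le _ _
    _ ≤ (L * (4 * |θ₁ - θ₂|) + R * (5 * |θ₁ - θ₂|)) + m * |θ₁ - θ₂| := by
        rw [abs_mul]
        refine add_le_add (h7.trans (by gcongr)) ?_
        gcongr
        linarith
    _ = _ := by ring

/-- The polar angle of the translated point depends continuously on φ and runs from 0 to π, because
|c| ≤ m/2 leaves the endpoints on their sides of the pole. The intermediate value theorem gives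
every angle. -/
theorem exists_isShift (hρ : ContinuousOn ρ₀ (Icc 0 Real.pi)) (hB : ProfileBounds ρ₀ m R L)
    (hc : |c| ≤ m / 2) (hθ : θ ∈ Icc 0 Real.pi) : ∃ r φ, IsShift ρ₀ c θ r φ := by
  have hm := hB.m_pos
  have hpi := Real.pi_pos
  set X : ℝ → ℝ := fun φ => ρ₀ φ * Real.cos φ + c with hX
  set Y : ℝ → ℝ := fun φ => ρ₀ φ * Real.sin φ with hY
  set N : ℝ → ℝ := fun φ => √(X φ ^ 2 + Y φ ^ 2) with hN
  have hXY : ∀ φ ∈ Icc 0 Real.pi, 0 < X φ ^ 2 + Y φ ^ 2 := by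
    intro φ hφ
    have h1 := hB.le_of_mem φ hφ
    have h2 : X φ ^ 2 + Y φ ^ 2 = (ρ₀ φ + c * Real.cos φ) ^ 2 + (c * Real.sin φ) ^ 2 := by
      simp only [hX, hY]
      linear_combination (ρ₀ φ ^ 2 - c ^ 2) * Real.sin_sq_add_cos_sq φ
    have h3 : |c * Real.cos φ| ≤ m / 2 := by
      rw [abs_mul]
      exact (mul_le_of_le_one_right (abs_nonneg _) (Real.abs_cos_le_one φ)).trans hc
    rw [abs_le] at h3
    have h4 : 0 < ρ₀ φ + c * Real.cos φ := by linarith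
    rw [h2]
    positivity
  have hNpos : ∀ φ ∈ Icc 0 Real.pi, 0 < N φ := fun φ hφ => Real.sqrt_pos.2 (hXY φ hφ)
  have hXc : ContinuousOn X (Icc 0 Real.pi) :=
    (hρ.mul Real.continuous_cos.continuousOn).add continuousOn_const
  have hYc : ContinuousOn Y (Icc 0 Real.pi) := hρ.mul Real.continuous_sin.continuousOn
  have hNc : ContinuousOn N (Icc 0 Real.pi) := ((hXc.pow 2).add (hYc.pow 2)).sqrt
  have hTc : ContinuousOn (fun φ => Real.arccos (X φ / N φ)) (Icc 0 Real.pi) :=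
    Real.continuous_arccos.comp_continuousOn (hXc.div hNc fun φ hφ => (hNpos φ hφ).ne')
  rw [abs_le] at hc
  have hT0 : Real.arccos (X 0 / N 0) = 0 := by
    have h0 := hB.le_of_mem 0 (left_mem_Icc.2 hpi.le)
    have hx : 0 < X 0 := by simp only [hX, Real.cos_zero]; linarith
    have : N 0 = X 0 := by
      simp only [hN, hY, Real.sin_zero, mul_zero]
      rw [zero_pow two_ne_zero, add_zero, Real.sqrt_sq hx.le]
    rw [this, div_self hx.ne', Real.arccos_one]
  have hTπ : Real.arccos (X Real.pi / N Real.pi) = Real.pi := by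
    have h0 := hB.le_of_mem Real.pi (right_mem_Icc.2 hpi.le)
    have hx : X Real.pi < 0 := by simp only [hX, Real.cos_pi]; linarith
    have : N Real.pi = -X Real.pi := by
      simp only [hN, hY, Real.sin_pi, mul_zero]
      rw [zero_pow two_ne_zero, add_zero, Real.sqrt_sq_eq_abs, abs_of_neg hx]
    rw [this, div_neg, div_self hx.ne, Real.arccos_neg_one]
  have hivt := intermediate_value_Icc hpi.le hTc
  simp only [hT0, hTπ] at hivt
  obtain ⟨φ, hφ, hφθ⟩ := hivt hθ
  have hn := hNpos φ hφ
  have hn2 : N φ ^ 2 = X φ ^ 2 + Y φ ^ 2 := Real.sq_sqrt (hXY φ hφ).le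
  have hle : |X φ / N φ| ≤ 1 := by
    rw [abs_div, abs_of_pos hn, div_le_one hn]
    refine abs_le_of_sq_le_sq ?_ hn.le
    nlinarith [sq_nonneg (Y φ)]
  rw [abs_le] at hle
  refine ⟨N φ, φ, hn, hφ, ?_, ?_⟩
  · rw [← hφθ, Real.cos_arccos hle.1 hle.2, mul_div_cancel₀ _ hn.ne']
  · have hy : 0 ≤ Y φ := mul_nonneg (hm.le.trans (hB.le_of_mem φ hφ))
      (Real.sin_nonneg_of_mem_Icc hφ)
    have h1 : 1 - (X φ / N φ) ^ 2 = (Y φ / N φ) ^ 2 := by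
      field_simp; linarith
    rw [← hφθ, Real.sin_arccos, h1, Real.sqrt_sq (div_nonneg hy hn.le), mul_div_cancel₀ _ hn.ne']

theorem exists_isShift_shiftedProfile (hρ : ContinuousOn ρ₀ (Icc 0 Real.pi))
    (hB : ProfileBounds ρ₀ m R L) (hc : |c| ≤ shiftRadius m L) (hθ : θ ∈ Icc 0 Real.pi) :
    ∃ φ, IsShift ρ₀ c θ (shiftedProfile ρ₀ c θ) φ := by
  obtain ⟨r, φ, h⟩ := exists_isShift hρ hB (hc.trans (min_le_left _ _)) hθ
  have : shiftedProfile ρ₀ c θ = r := by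
    have hset : {r : ℝ | 0 < r ∧ ∃ φ ∈ Icc 0 Real.pi, r • eR θ = ρ₀ φ • eR φ + !₂[c, 0]} = {r} := by
      ext r'
      rw [mem_ofPred_eq, isShift_iff_mem, mem_singleton_iff]
      constructor
      · rintro ⟨φ', h'⟩
        have := h'.abs_sub_le_of_isShift h hB hc hθ hθ
        rw [sub_self, abs_zero, mul_zero] at this
        exact sub_eq_zero.1 (abs_nonpos_iff.1 this)
      · rintro rfl; exact ⟨φ, h⟩
    rw [shiftedProfile, hset, csSup_singleton]
  exact ⟨φ, this ▸ h⟩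

/-- The derivative at `c = 0` of the profile translated by `c`. -/
noncomputable def shiftDeriv (ρ₀ : ℝ → ℝ) (θ : ℝ) : ℝ :=
  Real.cos θ + derivWithin ρ₀ (Icc 0 Real.pi) θ / ρ₀ θ * Real.sin θ

theorem continuousOn_shiftDeriv (hρ : ContDiffOn ℝ 1 ρ₀ (Icc 0 Real.pi))
    (hpos : ∀ θ ∈ Icc 0 Real.pi, 0 < ρ₀ θ) : ContinuousOn (shiftDeriv ρ₀) (Icc 0 Real.pi) :=
  Real.continuous_cos.continuousOn.add (((continuousOn_derivWithin_Icc hρ).div hρ.continuousOn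
    fun θ hθ => (hpos θ hθ).ne').mul Real.continuous_sin.continuousOn)

theorem eventually_abs_le (hr : 0 < r) : ∀ᶠ c in 𝓝 (0 : ℝ), |c| ≤ r := by
  filter_upwards [Metric.closedBall_mem_nhds 0 hr] with c hc
  simpa using hc

/-- The meeting angle Φ(c) tends to θ, and the arcsine equation then makes Φ differentiable at 0; no
implicit function theorem is needed. The radius follows from `IsShift.eq_cos`. -/
theorem hasDerivAt_shiftedProfile (hρ : ContDiffOn ℝ 1 ρ₀ (Icc 0 Real.pi))
    (hB : ProfileBounds ρ₀ m R L) (hθ : θ ∈ Ioo 0 Real.pi) :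
    HasDerivAt (fun c => shiftedProfile ρ₀ c θ) (shiftDeriv ρ₀ θ) 0 := by
  have hθ' := Ioo_subset_Icc_self hθ
  have hρθ : 0 < ρ₀ θ := hB.m_pos.trans_le (hB.le_of_mem θ hθ')
  have hex : ∀ c, ∃ φ, |c| ≤ shiftRadius m L → IsShift ρ₀ c θ (shiftedProfile ρ₀ c θ) φ := by
    intro c
    by_cases hc : |c| ≤ shiftRadius m L
    · obtain ⟨φ, h⟩ := exists_isShift_shiftedProfile hρ.continuousOn hB hc hθ'
      exact ⟨φ, fun _ => h⟩
    · exact ⟨0, fun h => absurd h hc⟩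
  choose Φ hΦ using hex
  have hnear : ∀ᶠ c in 𝓝 (0 : ℝ), |c| ≤ shiftRadius m L :=
    eventually_abs_le (shiftRadius_pos hB)
  have hle : ∀ {c}, |c| ≤ shiftRadius m L → |c| ≤ m / 2 := fun h => h.trans (min_le_left _ _)
  have hΦ0 : Φ 0 = θ := by
    have h0 : |(0 : ℝ)| ≤ shiftRadius m L := by rw [abs_zero]; exact (shiftRadius_pos hB).le
    have := (hΦ 0 h0).abs_sub_le hB (hle h0) hθ'
    rw [abs_zero, mul_zero, zero_div] at this
    exact sub_eq_zero.1 (abs_nonpos_iff.1 this)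
  have hΦt : Tendsto Φ (𝓝 0) (𝓝 θ) := by
    rw [tendsto_iff_dist_tendsto_zero]
    refine squeeze_zero' (Eventually.of_forall fun _ => dist_nonneg) (g := fun c => 2 * |c| / m) ?_ ?_
    · filter_upwards [hnear] with c hc
      exact (hΦ c hc).abs_sub_le hB (hle hc) hθ'
    · have : Continuous fun c : ℝ => 2 * |c| / m := by fun_prop
      simpa using this.tendsto 0
  have hρd := hasDerivAt_derivWithin_of_contDiffOn hρ hθ
  have hk : Tendsto (fun c => Real.sin θ / ρ₀ (Φ c)) (𝓝 0) (𝓝 (Real.sin θ / ρ₀ θ)) :=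
    tendsto_const_nhds.div (hρd.continuousAt.tendsto.comp hΦt) hρθ.ne'
  -- A product c · k(c) is differentiable at 0 as soon as k is continuous there, so no derivative of
  -- Φ is presupposed.
  have h1 : HasDerivAt (fun c => c * (Real.sin θ / ρ₀ (Φ c))) (Real.sin θ / ρ₀ θ) 0 := by
    rw [hasDerivAt_iff_tendsto_slope_zero]
    refine (hk.mono_left nhdsWithin_le_nhds).congr' ?_
    filter_upwards [self_mem_nhdsWithin] with c hc
    have hc' : c ≠ 0 := hc
    simp only [zero_add, zero_mul, sub_zero, smul_eq_mul]
    rw [inv_mul_cancel_left₀ hc']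
  have h2 : HasDerivAt Φ (Real.sin θ / ρ₀ θ) 0 := by
    have h3 : HasDerivAt (fun c => θ + Real.arcsin (c * (Real.sin θ / ρ₀ (Φ c))))
        (Real.sin θ / ρ₀ θ) 0 := by
      have ha : HasDerivAt Real.arcsin 1 (0 * (Real.sin θ / ρ₀ (Φ 0))) := by
        rw [zero_mul]
        simpa using Real.hasDerivAt_arcsin (x := 0) (by norm_num) (by norm_num)
      have := (ha.comp (0 : ℝ) h1).const_add θ
      rw [one_mul] at this
      exact this
    refine h3.congr_of_eventuallyEq ?_
    filter_upwards [hnear] with c hc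
    rw [← (hΦ c hc).sub_eq_arcsin hB (hle hc) hθ']
    ring
  have h4 : HasDerivAt (fun c => ρ₀ (Φ c) * Real.cos (Φ c - θ) + c * Real.cos θ)
      (shiftDeriv ρ₀ θ) 0 := by
    have h5 : HasDerivAt ρ₀ (derivWithin ρ₀ (Icc 0 Real.pi) θ) (Φ 0) := by rw [hΦ0]; exact hρd
    have h6 := ((h5.comp (0 : ℝ) h2).mul ((h2.sub_const θ).cos)).add
      ((hasDerivAt_id (0 : ℝ)).mul_const (Real.cos θ))
    refine h6.congr_deriv ?_
    rw [hΦ0, shiftDeriv]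
    simp
    ring
  refine h4.congr_of_eventuallyEq ?_
  filter_upwards [hnear] with c hc
  exact (hΦ c hc).eq_cos

theorem abs_shiftedProfile_sub_le (hρ : ContinuousOn ρ₀ (Icc 0 Real.pi))
    (hB : ProfileBounds ρ₀ m R L) (hc : |c| ≤ shiftRadius m L) (hθ : θ ∈ Icc 0 Real.pi) :
    |shiftedProfile ρ₀ c θ - ρ₀ θ| ≤ ((L + R) * (2 / m) + 1) * |c| := by
  obtain ⟨φ, h⟩ := exists_isShift_shiftedProfile hρ hB hc hθ
  exact h.abs_sub_profile_le hB (hc.trans (min_le_left _ _)) hθ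

theorem continuousOn_shiftedProfile (hρ : ContinuousOn ρ₀ (Icc 0 Real.pi))
    (hB : ProfileBounds ρ₀ m R L) (hc : |c| ≤ shiftRadius m L) :
    ContinuousOn (shiftedProfile ρ₀ c) (Icc 0 Real.pi) := by
  have hlip : LipschitzOnWith (4 * L + 5 * R + m).toNNReal (shiftedProfile ρ₀ c) (Icc 0 Real.pi) := by
    refine LipschitzOnWith.of_dist_le_mul fun θ₁ h₁ θ₂ h₂ => ?_
    obtain ⟨φ₁, h1⟩ := exists_isShift_shiftedProfile hρ hB hc h₁
    obtain ⟨φ₂, h2⟩ := exists_isShift_shiftedProfile hρ hB hc h₂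
    refine (h1.abs_sub_le_of_isShift h2 hB hc h₁ h₂).trans ?_
    rw [Real.dist_eq]
    gcongr
    exact Real.le_coe_toNNReal _
  exact hlip.continuousOn

/-- The Euler equation of the position of the pole. -/
theorem integral_mul_shiftDeriv_eq_zero (hρ : ContDiffOn ℝ 1 ρ₀ (Icc 0 Real.pi))
    (hpos : ∀ θ ∈ Icc 0 Real.pi, 0 < ρ₀ θ) {ξ : ℝ → ℝ} (hξ : ContinuousOn ξ (Icc 0 Real.pi))
    (hmin : IsLocalMin (fun c : ℝ => ∫ θ in (0 : ℝ)..Real.pi,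
      (shiftedProfile ρ₀ c θ - (ρ₀ θ + ξ θ)) ^ 2) 0) :
    ∫ θ in Ioo 0 Real.pi, ξ θ * shiftDeriv ρ₀ θ = 0 := by
  obtain ⟨m, R, L, hB⟩ := exists_profileBounds hρ hpos
  have hρc := hρ.continuousOn
  have hr := shiftRadius_pos hB
  set r := shiftRadius m L with hrdef
  set K := (L + R) * (2 / m) + 1 with hK
  obtain ⟨B, hξB⟩ := isCompact_Icc.exists_bound_of_continuousOn hξ
  have h0r : |(0 : ℝ)| ≤ r := by rw [abs_zero]; exact hr.le
  have hsp0 : ∀ θ ∈ Icc 0 Real.pi, shiftedProfile ρ₀ 0 θ = ρ₀ θ := by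
    intro θ hθ
    have := abs_shiftedProfile_sub_le hρc hB h0r hθ
    rw [abs_zero, mul_zero] at this
    exact sub_eq_zero.1 (abs_nonpos_iff.1 this)
  have hcont : ∀ {c}, |c| ≤ r → ContinuousOn
      (fun θ => (shiftedProfile ρ₀ c θ - (ρ₀ θ + ξ θ)) ^ 2) (Icc 0 Real.pi) := fun hc =>
    ((continuousOn_shiftedProfile hρc hB hc).sub (hρc.add hξ)).pow 2
  have hgc := continuousOn_shiftDeriv hρ hpos
  have hGc : ContinuousOn (fun θ => ContinuousLinearMap.toSpanSingleton ℝ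
      (2 * (shiftedProfile ρ₀ 0 θ - (ρ₀ θ + ξ θ)) * shiftDeriv ρ₀ θ)) (Ioo 0 Real.pi) := by
    have h1 : ContinuousOn (fun θ => 2 * (shiftedProfile ρ₀ 0 θ - (ρ₀ θ + ξ θ)) * shiftDeriv ρ₀ θ)
        (Ioo 0 Real.pi) :=
      ((continuousOn_const.mul ((continuousOn_shiftedProfile hρc hB h0r).sub (hρc.add hξ))).mul
        hgc).mono Ioo_subset_Icc_self
    exact (ContinuousLinearMap.toSpanSingletonCLE (𝕜 := ℝ) (E := ℝ)).continuous.comp_continuousOn h1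
  have hs : {c : ℝ | |c| ≤ r} ∈ 𝓝 (0 : ℝ) := eventually_abs_le hr
  have key := hasFDerivAt_integral_of_dominated_loc_of_lip' (𝕜 := ℝ) (μ := angleMeasure)
    (F := fun c θ => (shiftedProfile ρ₀ c θ - (ρ₀ θ + ξ θ)) ^ 2) (x₀ := (0 : ℝ))
    (F' := fun θ => ContinuousLinearMap.toSpanSingleton ℝ
      (2 * (shiftedProfile ρ₀ 0 θ - (ρ₀ θ + ξ θ)) * shiftDeriv ρ₀ θ))
    (bound := fun _ => K * (K * r + 2 * B)) hs
    (fun c hc => ((hcont hc).mono Ioo_subset_Icc_self).aestronglyMeasurable measurableSet_Ioo)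
    ((hcont h0r).integrableOn_Icc.mono_set Ioo_subset_Icc_self)
    (hGc.aestronglyMeasurable measurableSet_Ioo)
    (by
      filter_upwards [ae_restrict_mem measurableSet_Ioo] with θ hθ c hc
      have hθ' := Ioo_subset_Icc_self hθ
      have h1 := abs_shiftedProfile_sub_le hρc hB hc hθ'
      have h2 : |ξ θ| ≤ B := hξB θ hθ'
      have h3 : K * |c| ≤ K * r := by
        have hR : 0 ≤ R := (hB.m_pos.le.trans (hB.le_of_mem θ hθ')).trans (hB.of_mem_le θ hθ')
        have hL := hB.L_nonneg
        have hm := hB.m_pos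
        have hc' : |c| ≤ r := hc
        gcongr
      rw [hsp0 θ hθ', sub_zero, Real.norm_eq_abs, Real.norm_eq_abs]
      -- The difference of squares contains the factor `shiftedProfile ρ₀ c θ - ρ₀ θ`, which is at
      -- most K |c|; this is the domination needed to differentiate under the integral at 0.
      have h4 : (shiftedProfile ρ₀ c θ - (ρ₀ θ + ξ θ)) ^ 2 - (ρ₀ θ - (ρ₀ θ + ξ θ)) ^ 2 =
          (shiftedProfile ρ₀ c θ - ρ₀ θ) * ((shiftedProfile ρ₀ c θ - ρ₀ θ) - 2 * ξ θ) := by ring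
      rw [h4, abs_mul]
      have h5 : |shiftedProfile ρ₀ c θ - ρ₀ θ - 2 * ξ θ| ≤ K * r + 2 * B := by
        refine (abs_sub _ _).trans ?_
        rw [abs_mul, abs_two]
        linarith
      calc _ ≤ (K * |c|) * (K * r + 2 * B) := by
            refine mul_le_mul h1 h5 (abs_nonneg _) ((abs_nonneg _).trans h1)
        _ = _ := by ring)
    (integrable_const _)
    (by
      filter_upwards [ae_restrict_mem measurableSet_Ioo] with θ hθ
      have h1 := ((hasDerivAt_shiftedProfile hρ hB hθ).sub_const (ρ₀ θ + ξ θ)).pow 2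
      refine h1.hasFDerivAt.congr_fderiv ?_
      ext
      simp)
  have hmin' : IsLocalMin (fun c : ℝ => ∫ θ, (shiftedProfile ρ₀ c θ - (ρ₀ θ + ξ θ)) ^ 2
      ∂angleMeasure) 0 := by
    refine hmin.congr (Eventually.of_forall fun c => ?_)
    simp only [intervalIntegral.integral_of_le Real.pi_pos.le, integral_Ioc_eq_integral_Ioo]
  have h6 := hmin'.hasFDerivAt_eq_zero key.2
  have h7 := congrArg (fun T : ℝ →L[ℝ] ℝ => T 1) h6
  simp only [zero_apply] at h7
  rw [ContinuousLinearMap.integral_apply key.1] at h7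
  have h8 : ∫ θ in Ioo 0 Real.pi, ξ θ * shiftDeriv ρ₀ θ = (-(1 / 2)) *
      ∫ θ, ContinuousLinearMap.toSpanSingleton ℝ
        (2 * (shiftedProfile ρ₀ 0 θ - (ρ₀ θ + ξ θ)) * shiftDeriv ρ₀ θ) 1 ∂angleMeasure := by
    rw [← integral_const_mul]
    refine setIntegral_congr_fun measurableSet_Ioo fun θ hθ => ?_
    simp only [hsp0 θ (Ioo_subset_Icc_self hθ), ContinuousLinearMap.toSpanSingleton_apply, one_smul]
    ring
  rw [h8, h7, mul_zero]

end Pole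

/-! ### The velocity of the pole as a functional of profile and trace. -/

section PoleVelocity

/-- The extension of a continuous function on `[0, π]` by constants. -/
noncomputable def AngleC.extend (F : AngleC) : ℝ → ℝ := IccExtend Real.pi_pos.le F

theorem AngleC.extend_of_mem (F : AngleC) {θ : ℝ} (hθ : θ ∈ Icc 0 Real.pi) :
    F.extend θ = F ⟨θ, hθ⟩ := IccExtend_of_mem _ _ hθ

theorem AngleC.norm_extend_le (F : AngleC) (θ : ℝ) : ‖F.extend θ‖ ≤ ‖F‖ := F.norm_coe_le_norm _

theorem AngleC.continuous_extend (F : AngleC) : Continuous F.extend := F.continuous.Icc_extend'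

theorem AngleC.memLp_smul (F : AngleC) (D : AngleL2) :
    MemLp (fun θ => F.extend θ • D θ) 2 angleMeasure :=
  (Lp.memLp D).of_le_mul (c := ‖F‖)
    (F.continuous_extend.aestronglyMeasurable.smul (Lp.memLp D).1)
    (Eventually.of_forall fun θ => by
      rw [norm_smul]; gcongr; exact F.norm_extend_le θ)

/-- Multiplication of a square integrable field by a continuous function. -/
noncomputable def angleMul : AngleC →L[ℝ] AngleL2 →L[ℝ] AngleL2 :=
  LinearMap.mkContinuous₂
    (LinearMap.mk₂ ℝ (fun F D => (F.memLp_smul D).toLp _)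
      (fun F G D => by
        rw [← MemLp.toLp_add]
        refine MemLp.toLp_congr _ _ (Eventually.of_forall fun θ => ?_)
        exact add_smul (F.extend θ) (G.extend θ) (D θ))
      (fun c F D => by
        rw [← MemLp.toLp_const_smul]
        refine MemLp.toLp_congr _ _ (Eventually.of_forall fun θ => ?_)
        exact smul_assoc c (F.extend θ) (D θ))
      (fun F D E => by
        rw [← MemLp.toLp_add]
        refine MemLp.toLp_congr _ _ ?_
        filter_upwards [Lp.coeFn_add D E] with θ h
        rw [h]; exact smul_add _ _ _)
      (fun c F D => by
        rw [← MemLp.toLp_const_smul]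
        refine MemLp.toLp_congr _ _ ?_
        filter_upwards [Lp.coeFn_smul c D] with θ h
        rw [h]; exact smul_comm (F.extend θ) c (D θ : Plane)))
    1 (fun F D => by
      rw [one_mul]
      refine Lp.norm_le_mul_norm_of_ae_le_mul ?_
      filter_upwards [(F.memLp_smul D).coeFn_toLp] with θ h
      rw [LinearMap.mk₂_apply, h, norm_smul]
      gcongr
      exact F.norm_extend_le θ)

theorem angleMul_coeFn (F : AngleC) (D : AngleL2) :
    angleMul F D =ᵐ[angleMeasure] fun θ => F.extend θ • D θ :=
  (F.memLp_smul D).coeFn_toLp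

/-- The horizontal unit field. -/
noncomputable def horizontal : AngleL2 := (memLp_const (!₂[1, 0] : Plane)).toLp _

variable {ρ₀ : ℝ → ℝ}

/-- The field `g e_r - R⁻¹ D`. -/
noncomputable def weight (c₀ : AngleL2) (q : AngleC × AngleL2) : AngleL2 :=
  c₀ - angleMul (Ring.inverse q.1) q.2

/-- The velocity of the pole as a functional of the trace of the velocity field. -/
noncomputable def poleFunctional (c₀ : AngleL2) (q : AngleC × AngleL2) : AngleL2 →L[ℝ] ℝ :=
  (inner ℝ (weight c₀ q) horizontal)⁻¹ • innerSL ℝ (weight c₀ q)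

/-- Inversion is smooth at units of the Banach algebra C([0, π]), and the product with an L² field
is a bounded bilinear map. -/
theorem contDiffAt_weight (c₀ : AngleL2) {q : AngleC × AngleL2} (hq : IsUnit q.1) :
    ContDiffAt ℝ 2 (weight c₀) q := by
  obtain ⟨x, hx⟩ := hq
  have h0 : ContDiffAt ℝ 2 (Ring.inverse : AngleC → AngleC) q.1 := by
    rw [← hx]; exact contDiffAt_ringInverse ℝ x
  have h1 : ContDiffAt ℝ 2 (fun q : AngleC × AngleL2 => Ring.inverse q.1) q :=
    ContDiffAt.comp q h0 contDiffAt_fst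
  exact contDiffAt_const.sub ((angleMul.contDiff.contDiffAt.comp q h1).clm_apply contDiffAt_snd)

theorem contDiffAt_poleFunctional (c₀ : AngleL2) {q : AngleC × AngleL2} (hq : IsUnit q.1)
    (hne : inner ℝ (weight c₀ q) horizontal ≠ 0) : ContDiffAt ℝ 2 (poleFunctional c₀) q := by
  have hw := contDiffAt_weight c₀ hq
  exact ((hw.inner ℝ contDiffAt_const).inv hne).smul
    ((innerSL ℝ (E := AngleL2)).contDiff.contDiffAt.comp q hw)

/-- The field `θ ↦ g(θ) e_φ(θ)`. -/
noncomputable def angularField (ρ₀ : ℝ → ℝ) (θ : ℝ) : Plane := shiftDeriv ρ₀ θ • ePhi θ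

theorem continuousOn_angularField (hρ : ContDiffOn ℝ 1 ρ₀ (Icc 0 Real.pi))
    (hpos : ∀ θ ∈ Icc 0 Real.pi, 0 < ρ₀ θ) : ContinuousOn (angularField ρ₀) (Icc 0 Real.pi) :=
  (continuousOn_shiftDeriv hρ hpos).smul continuous_ePhi.continuousOn

theorem exists_radialField (hρ : ContDiffOn ℝ 1 ρ₀ (Icc 0 Real.pi))
    (hpos : ∀ θ ∈ Icc 0 Real.pi, 0 < ρ₀ θ) :
    ∃ c₀ : AngleL2, c₀ =ᵐ[angleMeasure] fun θ => shiftDeriv ρ₀ θ • eR θ := by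
  have hc : ContinuousOn (fun θ => shiftDeriv ρ₀ θ • eR θ) (Icc 0 Real.pi) :=
    (continuousOn_shiftDeriv hρ hpos).smul continuous_eR.continuousOn
  obtain ⟨K, hK⟩ := isCompact_Icc.exists_bound_of_continuousOn hc
  have hm := memLp_of_continuousOn_of_bound (hc.mono Ioo_subset_Icc_self)
    (fun θ hθ => hK θ (Ioo_subset_Icc_self hθ)) 2
  exact ⟨hm.toLp _, hm.coeFn_toLp⟩

/-- Where f is positive this field is g 𝒩 / f, with 𝒩 the normal of the profile f: exactly what the
kinematic condition tested with g requires. -/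
theorem weight_coeFn {c₀ : AngleL2} (hc₀ : c₀ =ᵐ[angleMeasure] fun θ => shiftDeriv ρ₀ θ • eR θ)
    {f : ℝ → ℝ} {q : AngleC × AngleL2} (hq : (f, q) ∈ profileRel (angularField ρ₀))
    (hu : IsUnit q.1) :
    weight c₀ q =ᵐ[angleMeasure] fun θ => shiftDeriv ρ₀ θ •
      (eR θ - ((f θ)⁻¹ * derivWithin f (Icc 0 Real.pi) θ) • ePhi θ) := by
  obtain ⟨-, hF, hD⟩ := hq
  filter_upwards [Lp.coeFn_sub c₀ (angleMul (Ring.inverse q.1) q.2), hc₀, hD,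
    angleMul_coeFn (Ring.inverse q.1) q.2, ae_restrict_mem measurableSet_Ioo] with θ h1 h2 h3 h4 hθ
  have hθ' := Ioo_subset_Icc_self hθ
  have h5 : (Ring.inverse q.1 : AngleC).extend θ = (f θ)⁻¹ := by
    rw [AngleC.extend_of_mem _ hθ']
    have h6 : Ring.inverse q.1 * q.1 = 1 := Ring.inverse_mul_cancel _ hu
    have h7 := congrArg (fun F : AngleC => F ⟨θ, hθ'⟩) h6
    simp only [ContinuousMap.mul_apply, ContinuousMap.one_apply] at h7
    rw [show q.1 ⟨θ, hθ'⟩ = f θ from hF ⟨θ, hθ'⟩] at h7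
    exact eq_inv_of_mul_eq_one_left h7
  rw [weight, h1, Pi.sub_apply, h2, h4, h5]
  change _ - (f θ)⁻¹ • (q.2 θ : Plane) = _
  rw [show (q.2 θ : Plane) = derivWithin f (Icc 0 Real.pi) θ • angularField ρ₀ θ from h3,
    angularField, smul_sub, smul_smul, smul_smul, smul_smul]
  congr 2
  ring

theorem horizontal_coeFn : horizontal =ᵐ[angleMeasure] fun _ => !₂[1, 0] :=
  (memLp_const (!₂[1, 0] : Plane)).coeFn_toLp

/-- The kinematic condition, tested with `g`, determines the velocity of the pole. -/
theorem inner_weight_trace {c₀ : AngleL2}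
    (hc₀ : c₀ =ᵐ[angleMeasure] fun θ => shiftDeriv ρ₀ θ • eR θ)
    {f : ℝ → ℝ} {q : AngleC × AngleL2} (hq : (f, q) ∈ profileRel (angularField ρ₀))
    (hu : IsUnit q.1) {v : Plane → Plane} {U : AngleL2} (hv : (v, U) ∈ traceRel ρ₀) {n : ℝ}
    {ξt : ℝ → ℝ} (hkin : ∀ᵐ θ ∂angleMeasure, ξt θ = (f θ)⁻¹ *
      inner ℝ (v (ρ₀ θ • eR θ) - !₂[n, 0]) (normal f θ))
    (hξt : ∫ θ, ξt θ * shiftDeriv ρ₀ θ ∂angleMeasure = 0) :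
    inner ℝ (weight c₀ q) U = n * inner ℝ (weight c₀ q) horizontal := by
  have h0 : inner ℝ (weight c₀ q) (U - n • horizontal) = 0 := by
    rw [L2.inner_def, ← hξt]
    refine integral_congr_ae ?_
    filter_upwards [weight_coeFn hc₀ hq hu, hv.2, Lp.coeFn_sub U (n • horizontal),
      Lp.coeFn_smul n horizontal, horizontal_coeFn, hkin, ae_restrict_mem measurableSet_Ioo]
      with θ h1 h2 h3 h4 h5 h6 hθ
    have hθ' := Ioo_subset_Icc_self hθ
    have hne : f θ ≠ 0 := by
      intro h
      obtain ⟨y, hy⟩ := hu.exists_right_inv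
      have h7 := congrArg (fun F : AngleC => F ⟨θ, hθ'⟩) hy
      simp only [ContinuousMap.mul_apply, ContinuousMap.one_apply] at h7
      rw [show q.1 ⟨θ, hθ'⟩ = f θ from hq.2.1 ⟨θ, hθ'⟩, h, zero_mul] at h7
      exact zero_ne_one h7
    have hd : derivWithin f (Icc 0 Real.pi) θ = deriv f θ :=
      derivWithin_of_mem_nhds (Icc_mem_nhds hθ.1 hθ.2)
    have h8 : (!₂[n, 0] : Plane) = n • !₂[1, 0] := by
      ext i; fin_cases i <;> simp
    rw [h1, h3, Pi.sub_apply, h4, Pi.smul_apply, h5, h6, hd, h8, normal]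
    rw [show (U θ : Plane) = v (ρ₀ θ • eR θ) from h2]
    set z : Plane := v (ρ₀ θ • eR θ) - n • !₂[1, 0]
    rw [real_inner_comm]
    simp only [inner_add_right, inner_sub_right, inner_smul_right]
    field_simp
    ring
  rw [inner_sub_right, inner_smul_right] at h0
  linarith

/-- The translation of the reference profile is not tangential. -/
theorem inner_weight_horizontal_ne_zero (hρ : ContDiffOn ℝ 1 ρ₀ (Icc 0 Real.pi))
    (hpos : ∀ θ ∈ Icc 0 Real.pi, 0 < ρ₀ θ) {c₀ : AngleL2}
    (hc₀ : c₀ =ᵐ[angleMeasure] fun θ => shiftDeriv ρ₀ θ • eR θ) {q : AngleC × AngleL2}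
    (hq : (ρ₀, q) ∈ profileRel (angularField ρ₀)) (hu : IsUnit q.1) :
    inner ℝ (weight c₀ q) horizontal ≠ 0 := by
  -- The horizontal component of e_r - (ρ₀'/ρ₀) e_φ is cos θ + (ρ₀'/ρ₀) sin θ, which is g again.
  have h1 : inner ℝ (weight c₀ q) horizontal = ∫ θ, shiftDeriv ρ₀ θ ^ 2 ∂angleMeasure := by
    rw [L2.inner_def]
    refine integral_congr_ae ?_
    filter_upwards [weight_coeFn hc₀ hq hu, horizontal_coeFn] with θ h2 h3
    rw [h2, h3, inner_smul_left]
    simp [shiftDeriv, eR, ePhi, PiLp.inner_apply, Fin.sum_univ_two]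
    ring
  rw [h1]
  intro h2
  have hgc := continuousOn_shiftDeriv hρ hpos
  have hint : IntegrableOn (fun θ => shiftDeriv ρ₀ θ ^ 2) (Ioo 0 Real.pi) :=
    (hgc.pow 2).integrableOn_Icc.mono_set Ioo_subset_Icc_self
  rw [integral_eq_zero_iff_of_nonneg (fun θ => sq_nonneg _) hint] at h2
  have hpi := Real.pi_pos
  have hsub : Icc 0 (Real.pi / 2) ⊆ Icc 0 Real.pi := Icc_subset_Icc_right (by linarith)
  -- Since ρ₀ g = (ρ₀ sin θ)', integrating up to π/2 gives ρ₀(π/2) > 0, which is impossible if g = 0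
  -- almost everywhere.
  have h3 : ∫ θ in (0 : ℝ)..Real.pi / 2, ρ₀ θ * shiftDeriv ρ₀ θ =
      ρ₀ (Real.pi / 2) * Real.sin (Real.pi / 2) - ρ₀ 0 * Real.sin 0 := by
    refine intervalIntegral.integral_eq_sub_of_hasDerivAt_of_le (f := fun θ => ρ₀ θ * Real.sin θ)
      (by linarith) ((hρ.continuousOn.mono hsub).mul Real.continuous_sin.continuousOn)
      (fun θ hθ => ?_) ?_
    · have hθ' : θ ∈ Ioo 0 Real.pi := ⟨hθ.1, by linarith [hθ.2]⟩
      have h4 := (hpos θ (Ioo_subset_Icc_self hθ')).ne'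
      refine ((hasDerivAt_derivWithin_of_contDiffOn hρ hθ').mul (Real.hasDerivAt_sin θ)).congr_deriv ?_
      rw [shiftDeriv]
      field_simp
      ring
    · refine ContinuousOn.intervalIntegrable ?_
      rw [uIcc_of_le (by linarith)]
      exact (hρ.continuousOn.mul hgc).mono hsub
  have h5 : ∫ θ in (0 : ℝ)..Real.pi / 2, ρ₀ θ * shiftDeriv ρ₀ θ = 0 := by
    rw [intervalIntegral.integral_of_le (by linarith), integral_Ioc_eq_integral_Ioo]
    refine integral_eq_zero_of_ae (ae_restrict_of_ae_restrict_of_subset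
      (Ioo_subset_Ioo_right (by linarith) : Ioo 0 (Real.pi / 2) ⊆ Ioo 0 Real.pi) ?_)
    filter_upwards [h2] with θ h6
    have : shiftDeriv ρ₀ θ = 0 := by simpa using h6
    simp [this]
  rw [h5, Real.sin_pi_div_two, Real.sin_zero] at h3
  have := hpos (Real.pi / 2) ⟨by linarith, by linarith⟩
  linarith

end PoleVelocity

/-! ### Differentiation in time of constraints and of composed functionals. -/

section TimeCalculus

theorem exists_integral_mul_bound {g : ℝ → ℝ} (hg : ContinuousOn g (Icc 0 Real.pi)) :
    ∃ C : ℝ≥0, ∀ f : ℝ → ℝ, sobolevNorm (Ioo 0 Real.pi) 1 2 f < ⊤ →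
      Integrable (fun θ => f θ * g θ) angleMeasure ∧
      ‖∫ θ, f θ * g θ ∂angleMeasure‖ₑ ≤ C * sobolevNorm (Ioo 0 Real.pi) 1 2 f := by
  obtain ⟨K, hK⟩ := isCompact_Icc.exists_bound_of_continuousOn hg
  have hgm : MemLp g 2 angleMeasure := memLp_of_continuousOn_of_bound (hg.mono Ioo_subset_Icc_self)
    (fun θ hθ => hK θ (Ioo_subset_Icc_self hθ)) 2
  refine ⟨(eLpNorm g 2 angleMeasure).toNNReal, fun f hf => ?_⟩
  rw [ENNReal.coe_toNNReal hgm.2.ne]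
  obtain ⟨G, hG, -, -⟩ := exists_of_sobolevNorm_one_lt hf
  have h1 := eLpNorm_le_sobolevNorm_one (Ω := Ioo 0 Real.pi) 2 f
  rw [show ENNReal.ofReal 2 = 2 by norm_num] at h1
  have hfm : MemLp f 2 angleMeasure := ⟨hG.1.aestronglyMeasurable, h1.trans_lt hf⟩
  refine ⟨hfm.integrable_mul hgm, (enorm_integral_le_lintegral_enorm _).trans ?_⟩
  rw [← eLpNorm_one_eq_lintegral_enorm]
  have h2 := eLpNorm_smul_le_mul_eLpNorm (p := 2) (q := 2) (r := 1) hgm.1 hfm.1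
  refine h2.trans ?_
  rw [mul_comm]
  exact mul_le_mul_right h1 _

/-- Difference quotients of ξ are orthogonal to g, so the integral for ξt equals minus that of the
remainder, which tends to 0 by Cauchy–Schwarz. -/
theorem integral_timeDeriv_mul_eq_zero {g : ℝ → ℝ} (hg : ContinuousOn g (Icc 0 Real.pi))
    {ξ : ℝ → ℝ → ℝ} {ξt : ℝ → ℝ} {t : ℝ}
    (hξ : ∀ᶠ s in 𝓝 t, ContinuousOn (ξ s) (Icc 0 Real.pi) ∧
      ∫ θ, ξ s θ * g θ ∂angleMeasure = 0)
    (hd : HasTimeDeriv (sobolevNorm (Ioo 0 Real.pi) 1 2) ξ ξt t) :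
    ∫ θ, ξt θ * g θ ∂angleMeasure = 0 := by
  obtain ⟨C, hC⟩ := exists_integral_mul_bound hg
  have hint : ∀ {f : ℝ → ℝ}, ContinuousOn f (Icc 0 Real.pi) →
      Integrable (fun θ => f θ * g θ) angleMeasure := fun {f} hf => by
    have : IntegrableOn (fun θ => f θ * g θ) (Icc 0 Real.pi) := (hf.mul hg).integrableOn_Icc
    exact this.mono_set Ioo_subset_Icc_self
  have hsh : Tendsto (fun h : ℝ => t + h) (𝓝[≠] 0) (𝓝 t) := by
    have : Tendsto (fun h : ℝ => t + h) (𝓝 0) (𝓝 (t + 0)) := tendsto_const_nhds.add tendsto_id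
    rw [add_zero] at this
    exact this.mono_left nhdsWithin_le_nhds
  have hle : ∀ᶠ h in 𝓝[≠] (0 : ℝ), ‖∫ θ, ξt θ * g θ ∂angleMeasure‖ₑ ≤
      C * sobolevNorm (Ioo 0 Real.pi) 1 2 (h⁻¹ • (ξ (t + h) - ξ t) - ξt) := by
    filter_upwards [hsh.eventually hξ, hd.eventually_lt_const ENNReal.zero_lt_top] with h h1 h2
    obtain ⟨h3, h4⟩ := hC _ h2
    have h0 := hξ.self_of_nhds
    have h5 : ∫ θ, ξt θ * g θ ∂angleMeasure =
        ∫ θ, (h⁻¹ * (ξ (t + h) θ * g θ - ξ t θ * g θ) -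
          (h⁻¹ • (ξ (t + h) - ξ t) - ξt) θ * g θ) ∂angleMeasure := by
      congr 1 with θ
      simp only [Pi.sub_apply, Pi.smul_apply, smul_eq_mul]
      ring
    have h6 : Integrable (fun θ => h⁻¹ * (ξ (t + h) θ * g θ - ξ t θ * g θ)) angleMeasure :=
      ((hint h1.1).sub (hint h0.1)).const_mul _
    rw [h5, integral_sub h6 h3, integral_const_mul,
      integral_sub (hint h1.1) (hint h0.1), h1.2, h0.2, sub_zero, mul_zero, zero_sub, enorm_neg]
    exact h4
  have hlim : Tendsto (fun h : ℝ => C * sobolevNorm (Ioo 0 Real.pi) 1 2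
      (h⁻¹ • (ξ (t + h) - ξ t) - ξt)) (𝓝[≠] 0) (𝓝 0) := by
    have := ENNReal.Tendsto.const_mul (a := (C : ℝ≥0∞)) hd (Or.inr ENNReal.coe_ne_top)
    rwa [mul_zero] at this
  exact enorm_eq_zero.1 (le_antisymm (ge_of_tendsto hlim hle) zero_le)

/-- A curve related to a twice differentiable curve is twice differentiable. -/
theorem exists_two_derivs {V W : Type} [AddCommGroup V] [Module ℝ V] [NormedAddCommGroup W]
    [NormedSpace ℝ W] [CompleteSpace W] {N : V → ℝ≥0∞} (hN : IsPrenorm N)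
    {S : Submodule ℝ (V × W)} {C : ℝ≥0} (hb : ∀ v w, (v, w) ∈ S → ‖w‖ₑ ≤ C * N v) {s : Set ℝ}
    (hs : IsOpen s) {v v' v'' : ℝ → V} {w : ℝ → W} (hvw : ∀ t ∈ s, (v t, w t) ∈ S)
    (hv : ∀ t ∈ s, Tendsto (fun h : ℝ => N (h⁻¹ • (v (t + h) - v t) - v' t)) (𝓝[≠] 0) (𝓝 0))
    (hv' : ∀ t ∈ s, Tendsto (fun h : ℝ => N (h⁻¹ • (v' (t + h) - v' t) - v'' t)) (𝓝[≠] 0) (𝓝 0)) :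
    ∃ w' w'' : ℝ → W, ∀ t ∈ s, HasDerivAt w (w' t) t ∧ HasDerivAt w' (w'' t) t ∧
      ‖w' t‖ₑ ≤ C * N (v' t) ∧ ‖w'' t‖ₑ ≤ C * N (v'' t) := by
  have hb' := closureRel_bound hN hb
  have h1 : ∀ t, ∃ w', t ∈ s → HasDerivAt w w' t ∧ (v' t, w') ∈ closureRel hN S := fun t => by
    by_cases ht : t ∈ s
    · obtain ⟨w', h⟩ := exists_hasDerivAt_of_rel hN (isClosedRel_closureRel hN S) hb'
        (by filter_upwards [hs.mem_nhds ht] with r hr using le_closureRel hN S (hvw r hr)) (hv t ht)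
      exact ⟨w', fun _ => h⟩
    · exact ⟨0, fun h => absurd h ht⟩
  choose w' hw' using h1
  have h2 : ∀ t, ∃ w'', t ∈ s → HasDerivAt w' w'' t ∧ (v'' t, w'') ∈ closureRel hN S := fun t => by
    by_cases ht : t ∈ s
    · obtain ⟨w'', h⟩ := exists_hasDerivAt_of_rel hN (isClosedRel_closureRel hN S) hb'
        (by filter_upwards [hs.mem_nhds ht] with r hr using (hw' r hr).2) (hv' t ht)
      exact ⟨w'', fun _ => h⟩
    · exact ⟨0, fun h => absurd h ht⟩
  choose w'' hw'' using h2
  exact ⟨w', w'', fun t ht => ⟨(hw' t ht).1, (hw'' t ht).1, hb' _ _ (hw' t ht).2,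
    hb' _ _ (hw'' t ht).2⟩⟩

theorem exists_contDiffAt_two_bounds {E G : Type} [NormedAddCommGroup E] [NormedSpace ℝ E]
    [NormedAddCommGroup G] [NormedSpace ℝ G] {Λ : E → G} {q₀ : E} (h : ContDiffAt ℝ 2 Λ q₀) :
    ∃ K : ℝ≥0, ∀ᶠ q in 𝓝 q₀, DifferentiableAt ℝ Λ q ∧ DifferentiableAt ℝ (fderiv ℝ Λ) q ∧
      ‖Λ q‖ₑ ≤ K ∧ ‖fderiv ℝ Λ q‖ₑ ≤ K ∧ ‖fderiv ℝ (fderiv ℝ Λ) q‖ₑ ≤ K := by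
  have h1 : ContDiffAt ℝ 1 (fderiv ℝ Λ) q₀ := h.fderiv_right (by norm_num)
  have h2 : ContDiffAt ℝ 0 (fderiv ℝ (fderiv ℝ Λ)) q₀ := h1.fderiv_right (by norm_num)
  have hbd : ∀ {H : Type} [NormedAddCommGroup H] {f : E → H}, ContinuousAt f q₀ →
      ∃ K : ℝ≥0, ∀ᶠ q in 𝓝 q₀, ‖f q‖ₑ ≤ K := by
    intro H _ f hf
    refine ⟨‖f q₀‖₊ + 1, ?_⟩
    have := hf.nnnorm.eventually_lt_const (lt_add_one ‖f q₀‖₊)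
    filter_upwards [this] with q hq
    rw [enorm_eq_nnnorm]
    exact ENNReal.coe_le_coe.2 hq.le
  obtain ⟨K0, hK0⟩ := hbd h.continuousAt
  obtain ⟨K1, hK1⟩ := hbd h1.continuousAt
  obtain ⟨K2, hK2⟩ := hbd h2.continuousAt
  refine ⟨K0 + K1 + K2, ?_⟩
  filter_upwards [hK0, hK1, hK2, h.eventually (by simp), h1.eventually (by simp)]
    with q a b c d e
  refine ⟨d.differentiableAt (by simp), e.differentiableAt (by simp), a.trans ?_, b.trans ?_,
    c.trans ?_⟩ <;> push_cast
  · rw [add_assoc]; exact le_self_add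
  · rw [add_right_comm]; exact le_add_self
  · exact le_add_self

theorem enorm_clm_apply_le {E F : Type} [NormedAddCommGroup E] [NormedSpace ℝ E]
    [NormedAddCommGroup F] [NormedSpace ℝ F] (L : E →L[ℝ] F) (x : E) {a b : ℝ≥0∞}
    (ha : ‖L‖ₑ ≤ a) (hb : ‖x‖ₑ ≤ b) : ‖L x‖ₑ ≤ a * b :=
  (L.le_opENorm x).trans (mul_le_mul' ha hb)

/-- Two derivatives of `τ ↦ Λ(q(τ)) U(τ)`, with bounds. -/
theorem deriv_bounds_of_eq_apply {E F : Type} [NormedAddCommGroup E] [NormedSpace ℝ E]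
    [NormedAddCommGroup F] [NormedSpace ℝ F] {Λ : E → F →L[ℝ] ℝ} {K : ℝ≥0∞} {s : Set ℝ}
    (hs : IsOpen s) {q q' q'' : ℝ → E} {U U' U'' : ℝ → F} {m : ℝ → ℝ}
    (hΛ : ∀ t ∈ s, DifferentiableAt ℝ Λ (q t) ∧ DifferentiableAt ℝ (fderiv ℝ Λ) (q t) ∧
      ‖Λ (q t)‖ₑ ≤ K ∧ ‖fderiv ℝ Λ (q t)‖ₑ ≤ K ∧ ‖fderiv ℝ (fderiv ℝ Λ) (q t)‖ₑ ≤ K)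
    (hq : ∀ t ∈ s, HasDerivAt q (q' t) t) (hq' : ∀ t ∈ s, HasDerivAt q' (q'' t) t)
    (hU : ∀ t ∈ s, HasDerivAt U (U' t) t) (hU' : ∀ t ∈ s, HasDerivAt U' (U'' t) t)
    (hm : ∀ t ∈ s, m t = Λ (q t) (U t)) {t : ℝ} (ht : t ∈ s) :
    ‖m t‖ₑ ≤ K * ‖U t‖ₑ ∧ DifferentiableAt ℝ m t ∧
    ‖deriv m t‖ₑ ≤ K * ‖q' t‖ₑ * ‖U t‖ₑ + K * ‖U' t‖ₑ ∧ DifferentiableAt ℝ (deriv m) t ∧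
    ‖deriv (deriv m) t‖ₑ ≤ (K * ‖q' t‖ₑ * ‖q' t‖ₑ * ‖U t‖ₑ + K * ‖q'' t‖ₑ * ‖U t‖ₑ +
      K * ‖q' t‖ₑ * ‖U' t‖ₑ) + (K * ‖q' t‖ₑ * ‖U' t‖ₑ + K * ‖U'' t‖ₑ) := by
  have h1 : ∀ r ∈ s, HasDerivAt m (fderiv ℝ Λ (q r) (q' r) (U r) + Λ (q r) (U' r)) r := by
    intro r hr
    have h := ((hΛ r hr).1.hasFDerivAt.comp_hasDerivAt r (hq r hr)).clm_apply (hU r hr)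
    refine h.congr_of_eventuallyEq ?_
    filter_upwards [hs.mem_nhds hr] with x hx using hm x hx
  have h2 : ∀ r ∈ s, HasDerivAt (deriv m)
      ((fderiv ℝ (fderiv ℝ Λ) (q r) (q' r) (q' r) + fderiv ℝ Λ (q r) (q'' r)) (U r) +
        fderiv ℝ Λ (q r) (q' r) (U' r) +
        (fderiv ℝ Λ (q r) (q' r) (U' r) + Λ (q r) (U'' r))) r := by
    intro r hr
    have ha := (hΛ r hr).1.hasFDerivAt.comp_hasDerivAt r (hq r hr)
    have hb := (hΛ r hr).2.1.hasFDerivAt.comp_hasDerivAt r (hq r hr)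
    have h := ((hb.clm_apply (hq' r hr)).clm_apply (hU r hr)).add (ha.clm_apply (hU' r hr))
    refine h.congr_of_eventuallyEq ?_
    filter_upwards [hs.mem_nhds hr] with x hx using (h1 x hx).deriv
  obtain ⟨-, -, b0, b1, b2⟩ := hΛ t ht
  refine ⟨?_, (h1 t ht).differentiableAt, ?_, (h2 t ht).differentiableAt, ?_⟩
  · rw [hm t ht]
    exact enorm_clm_apply_le _ _ b0 le_rfl
  · rw [(h1 t ht).deriv]
    refine (enorm_add_le _ _).trans (add_le_add ?_ ?_)
    · exact enorm_clm_apply_le _ _ (enorm_clm_apply_le _ _ b1 le_rfl) le_rfl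
    · exact enorm_clm_apply_le _ _ b0 le_rfl
  · rw [(h2 t ht).deriv]
    refine (enorm_add_le _ _).trans (add_le_add ((enorm_add_le _ _).trans (add_le_add ?_ ?_))
      ((enorm_add_le _ _).trans (add_le_add ?_ ?_)))
    · rw [add_apply]
      refine (enorm_add_le _ _).trans (add_le_add ?_ ?_)
      · exact enorm_clm_apply_le _ _ (enorm_clm_apply_le _ _ (enorm_clm_apply_le _ _ b2 le_rfl)
          le_rfl) le_rfl
      · exact enorm_clm_apply_le _ _ (enorm_clm_apply_le _ _ b1 le_rfl) le_rfl
    · exact enorm_clm_apply_le _ _ (enorm_clm_apply_le _ _ b1 le_rfl) le_rfl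
    · exact enorm_clm_apply_le _ _ (enorm_clm_apply_le _ _ b1 le_rfl) le_rfl
    · exact enorm_clm_apply_le _ _ b0 le_rfl

end TimeCalculus

/-! ### Norms dominated by the energy. -/

section Energy

variable (ρ₀ : ℝ → ℝ) (εm εp α : ℝ) (M : Motion) (t : ℝ)

theorem sobolevNorm_u_sq_le_energyMinus :
    sobolevNorm (domain ρ₀) 2 (qExp εp) (M.u t) ^ 2 ≤ energyMinus ρ₀ εm εp α M t :=
  le_add_right (le_add_right (le_add_right (le_add_right (le_add_right (le_add_right
    (le_add_right le_self_add))))))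

theorem sobolevNorm_ut_sq_le_energyMinus :
    sobolevNorm (domain ρ₀) (1 + εm / 2) 2 (M.ut t) ^ 2 ≤ energyMinus ρ₀ εm εp α M t :=
  le_add_right (le_add_right (le_add_right (le_add_right (le_add_right (le_add_right
    (le_add_right le_add_self))))))

theorem sobolevNorm_ξ_sq_le_energyMinus :
    sobolevNorm (Ioo 0 Real.pi) 1 2 (M.ξ t) ^ 2 ≤ energyMinus ρ₀ εm εp α M t :=
  le_add_right (le_add_right (le_add_right (le_add_left (le_add_right (le_add_right
    le_add_self)))))

theorem sobolevNorm_ξt_sq_le_energyMinus :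
    sobolevNorm (Ioo 0 Real.pi) 1 2 (M.ξt t) ^ 2 ≤ energyMinus ρ₀ εm εp α M t :=
  le_add_right (le_add_right (le_add_right (le_add_left (le_add_right le_add_self))))

theorem sobolevNorm_ξtt_sq_le_energyMinus :
    sobolevNorm (Ioo 0 Real.pi) 1 2 (M.ξtt t) ^ 2 ≤ energyMinus ρ₀ εm εp α M t :=
  le_add_self

end Energy

/-! ### Smoothness near the reference profile and the formula for n'. -/

section Pole

variable {ρ₀ : ℝ → ℝ}

/-- Near the reference profile the pole functional is smooth, with uniform bounds. -/
theorem exists_poleFunctional_bounds (hρ : ContDiffOn ℝ 1 ρ₀ (Icc 0 Real.pi))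
    (hpos : ∀ θ ∈ Icc 0 Real.pi, 0 < ρ₀ θ) {c₀ : AngleL2}
    (hc₀ : c₀ =ᵐ[angleMeasure] fun θ => shiftDeriv ρ₀ θ • eR θ) {q₀ : AngleC × AngleL2}
    (hq₀ : (ρ₀, q₀) ∈ profileRel (angularField ρ₀)) :
    ∃ (K : ℝ≥0) (r : ℝ), 0 < r ∧ ∀ x : AngleC × AngleL2, ‖x‖ < r →
      IsUnit (q₀ + x).1 ∧ inner ℝ (weight c₀ (q₀ + x)) horizontal ≠ 0 ∧
      DifferentiableAt ℝ (poleFunctional c₀) (q₀ + x) ∧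
      DifferentiableAt ℝ (fderiv ℝ (poleFunctional c₀)) (q₀ + x) ∧
      ‖poleFunctional c₀ (q₀ + x)‖ₑ ≤ K ∧ ‖fderiv ℝ (poleFunctional c₀) (q₀ + x)‖ₑ ≤ K ∧
      ‖fderiv ℝ (fderiv ℝ (poleFunctional c₀)) (q₀ + x)‖ₑ ≤ K := by
  have hu : IsUnit q₀.1 := by
    rw [ContinuousMap.isUnit_iff_forall_ne_zero]
    intro θ
    rw [show q₀.1 θ = ρ₀ θ from hq₀.2.1 θ]
    exact (hpos θ θ.2).ne'
  have hne := inner_weight_horizontal_ne_zero hρ hpos hc₀ hq₀ hu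
  obtain ⟨K, hK⟩ := exists_contDiffAt_two_bounds (contDiffAt_poleFunctional c₀ hu hne)
  have h1 : ∀ᶠ q : AngleC × AngleL2 in 𝓝 q₀, IsUnit q.1 :=
    continuousAt_fst.eventually (Units.isOpen.mem_nhds hu)
  have h2 : ∀ᶠ q : AngleC × AngleL2 in 𝓝 q₀, inner ℝ (weight c₀ q) horizontal ≠ 0 :=
    ((contDiffAt_weight c₀ hu).continuousAt.inner continuousAt_const).eventually_ne hne
  obtain ⟨r, hr, h⟩ := Metric.eventually_nhds_iff.1 (h1.and (h2.and hK))
  exact ⟨K, r, hr, fun x hx => h (by simpa using hx)⟩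

theorem IsMovingDrop.integral_ξt_mul_eq_zero {T : ℝ} {M : Motion} (hM : IsMovingDrop ρ₀ T M)
    (hρ : ContDiffOn ℝ 1 ρ₀ (Icc 0 Real.pi)) (hpos : ∀ θ ∈ Icc 0 Real.pi, 0 < ρ₀ θ) {t : ℝ}
    (ht : t ∈ Ioo 0 T) : ∫ θ, M.ξt t θ * shiftDeriv ρ₀ θ ∂angleMeasure = 0 := by
  refine integral_timeDeriv_mul_eq_zero (continuousOn_shiftDeriv hρ hpos) ?_ (hM.deriv_ξ t ht)
  filter_upwards [isOpen_Ioo.mem_nhds ht] with s hs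
  exact ⟨(hM.cont_ξ s hs).continuousOn,
    integral_mul_shiftDeriv_eq_zero hρ hpos (hM.cont_ξ s hs).continuousOn (hM.pole s hs)⟩

/-- The velocity of the pole is a smooth functional of the free surface and the velocity field. -/
theorem IsMovingDrop.deriv_n_eq {T : ℝ} {M : Motion} (hM : IsMovingDrop ρ₀ T M)
    (hρ : ContDiffOn ℝ 1 ρ₀ (Icc 0 Real.pi)) (hpos : ∀ θ ∈ Icc 0 Real.pi, 0 < ρ₀ θ) {t : ℝ}
    (ht : t ∈ Ioo 0 T) {c₀ : AngleL2}
    (hc₀ : c₀ =ᵐ[angleMeasure] fun θ => shiftDeriv ρ₀ θ • eR θ) {q₀ x : AngleC × AngleL2}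
    (hq₀ : (ρ₀, q₀) ∈ profileRel (angularField ρ₀))
    (hx : (M.ξ t, x) ∈ profileRel (angularField ρ₀)) (hu : IsUnit (q₀ + x).1)
    (hne : inner ℝ (weight c₀ (q₀ + x)) horizontal ≠ 0) {U : AngleL2}
    (hU : (M.u t, U) ∈ traceRel ρ₀) : deriv M.n t = poleFunctional c₀ (q₀ + x) U := by
  have h := inner_weight_trace hc₀ (f := M.ρ ρ₀ t)
    ((profileRel (angularField ρ₀)).add_mem hq₀ hx) hu hU
    (hM.kinematic t ht) (hM.integral_ξt_mul_eq_zero hρ hpos ht)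
  change _ = (inner ℝ (weight c₀ (q₀ + x)) horizontal)⁻¹ * inner ℝ (weight c₀ (q₀ + x)) U
  rw [show inner ℝ (weight c₀ (q₀ + x)) U = _ from h]
  field_simp

end Pole

end Drop

theorem mainTheorem8 (ρ₀ : ℝ → ℝ) (hρ₀ : ContDiffOn ℝ ∞ ρ₀ (Set.Icc 0 Real.pi))
    (hpos : ∀ θ ∈ Set.Icc 0 Real.pi, 0 < ρ₀ θ)
    (εm εp α : ℝ) (hεm : 0 < εm) (hε : εm < εp) (hεp : εp ≤ (εm + 1) / 2)
    (hα : 0 < α) (hαε : α < εm) (hαmin : α < min ((1 - εp) / 2) ((εp - εm) / 2)) :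
    ∃ δ C : ℝ≥0, 0 < δ ∧ ∀ (T : ℝ) (M : Drop.Motion), Drop.IsMovingDrop ρ₀ T M →
      (∀ t ∈ Set.Ioo 0 T, Drop.energy ρ₀ εm εp α M t ≤ δ) →
      ∀ t ∈ Set.Ioo 0 T,
        ‖deriv M.n t‖ₑ ≤ C * Drop.sobolevNorm (Drop.domain ρ₀) 1 2 (M.u t) ∧
        DifferentiableAt ℝ (deriv M.n) t ∧
        ‖iteratedDeriv 2 M.n t‖ₑ ≤ C * (Drop.sobolevNorm (Drop.domain ρ₀) 1 2 (M.ut t)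
          + Drop.energyMinus ρ₀ εm εp α M t) ∧
        DifferentiableAt ℝ (iteratedDeriv 2 M.n) t ∧
        ‖iteratedDeriv 3 M.n t‖ₑ ≤ C * (Drop.sobolevNorm (Drop.domain ρ₀) 1 2 (M.utt t)
          + Drop.energyMinus ρ₀ εm εp α M t) := by
  open Drop in
  have hρ : ContDiffOn ℝ 1 ρ₀ (Icc 0 Real.pi) := hρ₀.of_le (by simp)
  have hεp1 : εp < 1 := by linarith
  have hq : 1 ≤ qExp εp := by
    rw [qExp, le_div_iff₀ (by linarith)]; linarith
  have hk := continuousOn_angularField hρ hpos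
  obtain ⟨c₀, hc₀⟩ := exists_radialField hρ hpos
  obtain ⟨q₀, hq₀⟩ := exists_profile hk hρ
  obtain ⟨K, r, hr, hK⟩ := exists_poleFunctional_bounds hρ hpos hc₀ hq₀
  obtain ⟨C₁, hC₁⟩ := exists_traceRel_bound hρ.continuousOn hpos
  obtain ⟨C₂, hC₂⟩ := exists_traceRel_bound_two hρ hpos hq
  obtain ⟨C₃, hC₃⟩ := exists_profileRel_bound hk
  set D : ℝ≥0 := C₁ + C₂ + C₃ with hD
  have hD1 : (C₁ : ℝ≥0∞) ≤ D := by
    rw [ENNReal.coe_le_coe, hD, add_assoc]; exact le_self_add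
  have hD2 : (C₂ : ℝ≥0∞) ≤ D := by
    rw [ENNReal.coe_le_coe, hD, add_right_comm]; exact le_add_self
  have hD3 : (C₃ : ℝ≥0∞) ≤ D := by
    rw [ENNReal.coe_le_coe, hD]; exact le_add_self
  -- A bound for the square root of the energy: the second entry keeps the profile within r of the
  -- reference one, the first makes the energy at most 1.
  set η : ℝ≥0 := min 1 (r.toNNReal / (2 * (D + 1))) with hη
  have hr' : 0 < r.toNNReal := by simpa using hr
  have hη0 : 0 < η := lt_min one_pos (div_pos hr' (by positivity))
  have hηr : D * η < r.toNNReal := by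
    calc D * η ≤ D * (r.toNNReal / (2 * (D + 1))) := mul_le_mul_right (min_le_right _ _) _
      _ < (2 * (D + 1)) * (r.toNNReal / (2 * (D + 1))) := by
        refine mul_lt_mul_of_pos_right ?_ (by positivity)
        rw [two_mul]
        exact (lt_add_one D).trans_le le_self_add
      _ = r.toNNReal := by field_simp
  -- The constant collects the coefficients of the third estimate: one cubic term, three quadratic
  -- ones, and the linear term in the top derivative.
  refine ⟨η ^ 2, K * (D ^ 3 + 3 * D ^ 2 + D), by positivity, fun T M hM hE => ?_⟩
  have hsq : ∀ t ∈ Ioo 0 T, ∃ s : ℝ≥0∞, s ^ 2 = energyMinus ρ₀ εm εp α M t ∧ s ≤ η := by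
    intro t ht
    refine ⟨energyMinus ρ₀ εm εp α M t ^ (1 / 2 : ℝ), ?_, ?_⟩
    · rw [← ENNReal.rpow_natCast, ← ENNReal.rpow_mul]; norm_num
    · have h1 : energyMinus ρ₀ εm εp α M t ≤ (η : ℝ≥0∞) ^ (2 : ℝ) := by
        refine (le_add_right le_self_add).trans ((hE t ht).trans (le_of_eq ?_))
        push_cast
        norm_cast
      calc _ ≤ ((η : ℝ≥0∞) ^ (2 : ℝ)) ^ (1 / 2 : ℝ) := ENNReal.rpow_le_rpow h1 (by norm_num)
        _ = η := by rw [← ENNReal.rpow_mul]; norm_num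
  have hle : ∀ {a s : ℝ≥0∞}, a ^ 2 ≤ s ^ 2 → a ≤ s := fun h =>
    (ENNReal.pow_le_pow_left_iff two_ne_zero).1 h
  have hx : ∀ t, ∃ x, t ∈ Ioo 0 T → (M.ξ t, x) ∈ profileRel (angularField ρ₀) := fun t => by
    by_cases ht : t ∈ Ioo 0 T
    · obtain ⟨x, hx⟩ := exists_profile hk (hM.cont_ξ t ht)
      exact ⟨x, fun _ => hx⟩
    · exact ⟨0, fun h => absurd h ht⟩
  choose x hx using hx
  have hU : ∀ t, ∃ U, t ∈ Ioo 0 T → (M.u t, U) ∈ traceRel ρ₀ := fun t => by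
    by_cases ht : t ∈ Ioo 0 T
    · obtain ⟨U, hU⟩ := exists_trace hρ.continuousOn hpos (hM.cont_u t ht)
      exact ⟨U, fun _ => hU⟩
    · exact ⟨0, fun h => absurd h ht⟩
  choose U hU using hU
  -- The derivatives exist in C([0, π]) × L² and are bounded by the H¹ norms of ξt and ξtt, which
  -- need not be C¹ themselves.
  obtain ⟨x', x'', hx'⟩ := exists_two_derivs (isPrenorm_sobolevNorm_one _ one_le_two) hC₃
    isOpen_Ioo hx hM.deriv_ξ hM.deriv_ξt
  obtain ⟨U', U'', hU'⟩ := exists_two_derivs (isPrenorm_sobolevNorm_one _ one_le_two) hC₁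
    isOpen_Ioo hU hM.deriv_u hM.deriv_ut
  have hsmall : ∀ t ∈ Ioo 0 T, ‖x t‖ < r := by
    intro t ht
    obtain ⟨s, hs, hsη⟩ := hsq t ht
    have h1 : ‖x t‖ₑ ≤ D * η := (hC₃ _ _ (hx t ht)).trans
      (mul_le_mul' hD3 ((hle (hs ▸ sobolevNorm_ξ_sq_le_energyMinus ρ₀ εm εp α M t)).trans hsη))
    have h2 : ‖x t‖₊ < r.toNNReal := by
      rw [enorm_eq_nnnorm, ← ENNReal.coe_mul, ENNReal.coe_le_coe] at h1
      exact h1.trans_lt hηr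
    have h3 := NNReal.coe_lt_coe.2 h2
    rwa [coe_nnnorm, Real.coe_toNNReal _ hr.le] at h3
  intro t ht
  obtain ⟨a1, a2, a3, a4, a5⟩ := deriv_bounds_of_eq_apply isOpen_Ioo (q := fun t => q₀ + x t)
    (fun t ht => (hK _ (hsmall t ht)).2.2) (fun t ht => (hx' t ht).1.const_add q₀)
    (fun t ht => (hx' t ht).2.1) (fun t ht => (hU' t ht).1) (fun t ht => (hU' t ht).2.1)
    (fun t ht => hM.deriv_n_eq hρ hpos ht hc₀ hq₀ (hx t ht) (hK _ (hsmall t ht)).1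
      (hK _ (hsmall t ht)).2.1 (hU t ht)) ht
  have h2 : iteratedDeriv 2 M.n = deriv (deriv M.n) := by
    rw [iteratedDeriv_succ, iteratedDeriv_one]
  have h3 : iteratedDeriv 3 M.n = deriv (deriv (deriv M.n)) := by
    rw [iteratedDeriv_succ, h2]
  rw [h2, h3]
  obtain ⟨s, hs, hsη⟩ := hsq t ht
  have hs1 : s ≤ 1 := hsη.trans (ENNReal.coe_le_one_iff.2 (min_le_left _ _))
  have bx' : ‖x' t‖ₑ ≤ D * s := (hx' t ht).2.2.1.trans
    (mul_le_mul' hD3 (hle (hs ▸ sobolevNorm_ξt_sq_le_energyMinus ρ₀ εm εp α M t)))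
  have bx'' : ‖x'' t‖ₑ ≤ D * s := (hx' t ht).2.2.2.trans
    (mul_le_mul' hD3 (hle (hs ▸ sobolevNorm_ξtt_sq_le_energyMinus ρ₀ εm εp α M t)))
  have bU : ‖U t‖ₑ ≤ D * sobolevNorm (domain ρ₀) 1 2 (M.u t) :=
    (hC₁ _ _ (hU t ht)).trans (mul_le_mul_left hD1 _)
  -- A second bound of the same trace, by the energy through W^{2,q}: in the product terms U must be
  -- small like s.
  have bUs : ‖U t‖ₑ ≤ D * s := (hC₂ _ _ (hU t ht)).trans
    (mul_le_mul' hD2 (hle (hs ▸ sobolevNorm_u_sq_le_energyMinus ρ₀ εm εp α M t)))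
  have bU' : ‖U' t‖ₑ ≤ D * sobolevNorm (domain ρ₀) 1 2 (M.ut t) :=
    (hU' t ht).2.2.1.trans (mul_le_mul_left hD1 _)
  have bU's : ‖U' t‖ₑ ≤ D * s := bU'.trans (mul_le_mul_right
    ((sobolevNorm_one_le_sobolevNorm (r := 1 + εm / 2) (by linarith) (by linarith) _).trans
      (hle (hs ▸ sobolevNorm_ut_sq_le_energyMinus ρ₀ εm εp α M t))) _)
  have bU'' : ‖U'' t‖ₑ ≤ D * sobolevNorm (domain ρ₀) 1 2 (M.utt t) :=
    (hU' t ht).2.2.2.trans (mul_le_mul_left hD1 _)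
  refine ⟨?_, a2, ?_, a4, ?_⟩
  · refine a1.trans ((mul_le_mul_right bU _).trans ?_)
    rw [← mul_assoc]
    gcongr
    rw [← ENNReal.coe_mul, ENNReal.coe_le_coe]
    exact mul_le_mul_right le_add_self _
  · rw [← hs]
    set N := sobolevNorm (domain ρ₀) 1 2 (M.ut t)
    push_cast
    calc _ ≤ (K : ℝ≥0∞) * ‖x' t‖ₑ * ‖U t‖ₑ + K * ‖U' t‖ₑ := a3
      _ ≤ K * (D * s) * (D * s) + K * (D * N) := by gcongr
      _ ≤ K * (D * s) * (D * s) + K * (D * N) +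
          (K * (D ^ 3 + 2 * D ^ 2 + D) * s ^ 2 + K * (D ^ 3 + 3 * D ^ 2) * N) := le_self_add
      _ = _ := by ring
  · rw [← hs]
    set N := sobolevNorm (domain ρ₀) 1 2 (M.utt t)
    push_cast
    calc _ ≤ _ := a5
      -- In the cubic term s ≤ 1 is used for the trace, so that only s², that is the energy,
      -- remains.
      _ ≤ (K * (D * s) * (D * s) * (D * 1) + K * (D * s) * (D * s) + K * (D * s) * (D * s)) +
          (K * (D * s) * (D * s) + K * (D * N)) := by
        have bU1 : ‖U t‖ₑ ≤ D * 1 := bUs.trans (mul_le_mul_right hs1 _)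
        gcongr
      _ ≤ (K * (D * s) * (D * s) * (D * 1) + K * (D * s) * (D * s) + K * (D * s) * (D * s)) +
          (K * (D * s) * (D * s) + K * (D * N)) +
          (K * D * s ^ 2 + K * (D ^ 3 + 3 * D ^ 2) * N) := le_self_add
      _ = _ := by ring
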